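/- **Setting.** Identify $\mathbb R^2$ with $\mathbb C$. A field is a signed Borel measure $\mu$ on $\mathbb C$ with locally finite variation $|\mu|$. Its discrete part is written $2\pi\sum_{\lambda\in\Lambda}\alpha_\lambda\delta_\lambda$ with $\alpha_\lambda\neq0$, where $\alpha_\lambda$ is the intensity of the atom $\lambda$, and $\mu_c$ denotes the atomless part. A potential of $\mu$ is a function $\Psi\in L_{1,\mathrm{loc}}(\mathbb C)$ with $\Delta\Psi=\mu$ in the sense of distributions. A set is $r$-separated if any two distinct points of it have distance at least $r$. Pointwise inequalities for potentials are understood almost everywhere. For a potential $\Psi$ of a field $\mu$ with atoms $\Lambda$, the spin-down Pauli operator is the operator in $L_2(\mathbb C)$ associated with the form $\mathfrak p_-[\psi]=4\int|\partial(e^{\Psi}\psi)|^2e^{-2\Psi}\,dx$ on all $\psi\in L_2$ for which the distribution $\partial(e^{\Psi}\psi)$ is a function and the form is finite. For $P_{-\max}$ the derivative is taken in $\mathcal D'(\mathbb C\setminus\Lambda)$. For $P_{-EV}$ (all intensities in $[-\frac12,\frac12)$) it is taken in $\mathcal D'(\mathbb C)$. Zero modes are the elements of the kernel of the operator. **Theorem.**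 For every $r>0$ and $B\in\mathbb R$ there is a constant $C=C(r,B)>0$ such that the following holds. *Unperturbed field.* Let $\mu_0$ be a field whose set of atoms $\Lambda_0$ is $r_0$-separated for some $r_0>0$, with intensities $\alpha_\lambda$ satisfying either (max) $0<\alpha_\lambda\le\theta_0$ for all $\lambda\in\Lambda_0$ with some $\theta_0<1$, or (EV) $\alpha_\lambda\in[-\frac12,\frac12)$ for all $\lambda\in\Lambda_0$. Suppose that $\mu_0$ has a potential $\Psi_0$ such that, for some $\gamma>0$ and all $|z|$ large enough, $\Psi_0(z)-\alpha_0(z)\ln|z-\lambda_0(z)|\ge\gamma|z|^2$, where $\lambda_0(z)$ is a point of $\Lambda_0$ nearest to $z$ and $\alpha_0(z)=\alpha_{\lambda_0(z)}$ (the logarithmic term is omitted if $\Lambda_0=\emptyset$). *Perturbation.* Let $\mu$ be a field whose set of atoms $\Lambda$ is $r$-separated, with intensities $\beta_\lambda$ satisfying $|\beta_\lambda|\le\theta$ for some $\theta<1$, and such that $\int_{|w-z|<r}|\ln|w-z||\,d|\mu_c|(w)\le B$ for all $z\in\mathbb C$. Put $\omega(\rho)=|\mu|(\{|w|<\rho\})$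 and, for a fixed $r_1>0$, $M(\rho)=\int_{r_1\le|w|\le \rho}w^{-2}\,d\mu(w)$. Suppose that one of the following holds: 1. there are $\tau>0$ and $K$ with $\omega(\rho)\le K\rho^{2-\tau}$ for all large $\rho$; 2. there is $\varepsilon\in(0,\frac12]$ with $\omega(\rho)\le\varepsilon\rho^2$ and $|M(\rho)|\le\varepsilon$ for all large $\rho$, and $C\varepsilon\ln(1/\varepsilon)<\gamma$. Suppose finally that $\Lambda_0\cup\Lambda$ is $r'$-separated for some $r'>0$. *Conclusion.* Let $\mu^*=\mu_0+\mu$, with set of atoms $\Lambda^*$ and intensities $\alpha^*_\lambda$. (a) $\mu^*$ has a potential $\Psi^*$ such that for some $\gamma^*>0$ and all $|z|$ large enough $$\Psi^*(z)-\alpha^*(z)\ln d^*(z)\ge\gamma^*|z|^2,$$ where $d^*(z)$ is the distance from $z$ to $\Lambda^*$ and $\alpha^*(z)$ is the intensity of $\mu^*$ at a nearest point of $\Lambda^*$ (any of them, if there are several; the logarithmic term is omitted if $\Lambda^*=\emptyset$). (b) In case (max), if $\alpha^*_\lambda\le\theta^*$ for all $\lambda\in\Lambda^*$ with some $\theta^*<1$,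 then $P_{-\max}$ with field $\mu^*$, defined by any potential of $\mu^*$, has an infinite-dimensional space of zero modes. (c) In case (EV), if $\alpha^*_\lambda\in[-\frac12,\frac12)$ for all $\lambda\in\Lambda^*$, then $P_{-EV}$ with field $\mu^*$, defined by any potential of $\mu^*$, has an infinite-dimensional space of zero modes. -/

import Mathlib

open MeasureTheory

noncomputable section

namespace PauliZeroModes

/-! ### Signed Borel measures on the plane with locally finite variation -/

/-- A signed Borel measure on `ℂ` with locally finite variation (a magnetic field), given by its
Jordan decomposition `pos - neg`. -/
structure SignedField where
  pos : Measure ℂ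
  neg : Measure ℂ
  pos_locallyFinite : IsLocallyFiniteMeasure pos
  neg_locallyFinite : IsLocallyFiniteMeasure neg
  mutuallySingular : pos ⟂ₘ neg

attribute [instance] SignedField.pos_locallyFinite SignedField.neg_locallyFinite

/-- The part of `P` that exceeds `N`, i.e. the positive part of `P - N`. -/
def excess (P N : Measure ℂ) : Measure ℂ :=
  (P + N).withDensity (fun z => P.rnDeriv (P + N) z - N.rnDeriv (P + N) z)

instance instLocallyFiniteAdd (P N : Measure ℂ) [IsLocallyFiniteMeasure P]
    [IsLocallyFiniteMeasure N] : IsLocallyFiniteMeasure (P + N) := by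
  refine ⟨fun x => ?_⟩
  obtain ⟨s, hs, hs'⟩ := P.finiteAt_nhds x
  obtain ⟨t, ht, ht'⟩ := N.finiteAt_nhds x
  refine ⟨s ∩ t, Filter.inter_mem hs ht, ?_⟩
  rw [Measure.add_apply]
  exact ENNReal.add_lt_top.2 ⟨(measure_mono Set.inter_subset_left).trans_lt hs',
    (measure_mono Set.inter_subset_right).trans_lt ht'⟩

theorem withDensity_rnDeriv_left (P N : Measure ℂ) [IsLocallyFiniteMeasure P]
    [IsLocallyFiniteMeasure N] : (P + N).withDensity (P.rnDeriv (P + N)) = P :=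
  Measure.withDensity_rnDeriv_eq _ _ (Measure.absolutelyContinuous_of_le (Measure.le_add_right le_rfl))

theorem excess_le (P N : Measure ℂ) [IsLocallyFiniteMeasure P] [IsLocallyFiniteMeasure N] :
    excess P N ≤ P := by
  conv_rhs => rw [← withDensity_rnDeriv_left P N]
  exact withDensity_mono (Filter.Eventually.of_forall fun z => tsub_le_self)

theorem excess_locallyFinite (P N : Measure ℂ) [IsLocallyFiniteMeasure P]
    [IsLocallyFiniteMeasure N] : IsLocallyFiniteMeasure (excess P N) :=
  Measure.isLocallyFiniteMeasure_of_le (excess_le P N)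

theorem excess_mutuallySingular (P N : Measure ℂ) : excess P N ⟂ₘ excess N P := by
  have hP := Measure.measurable_rnDeriv P (P + N)
  have hN := Measure.measurable_rnDeriv N (P + N)
  refine ⟨{z | P.rnDeriv (P + N) z ≤ N.rnDeriv (P + N) z}, measurableSet_le hP hN, ?_, ?_⟩
  · rw [excess, withDensity_apply _ (measurableSet_le hP hN),
      setLIntegral_congr_fun (g := fun _ => 0) (measurableSet_le hP hN)
        (fun z hz => tsub_eq_zero_of_le hz)]
    simp
  · rw [excess, add_comm N P, withDensity_apply _ (measurableSet_le hP hN).compl,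
      setLIntegral_congr_fun (g := fun _ => 0) (measurableSet_le hP hN).compl
        (fun z hz => tsub_eq_zero_of_le (le_of_not_ge (Set.notMem_ofPred_iff.1 hz)))]
    simp

/-- `excess P N - excess N P = P - N`. -/
theorem excess_add (P N : Measure ℂ) [IsLocallyFiniteMeasure P] [IsLocallyFiniteMeasure N] :
    excess P N + N = P + excess N P := by
  have hP := Measure.measurable_rnDeriv P (P + N)
  have hN := Measure.measurable_rnDeriv N (P + N)
  have h2 : (P + N).withDensity (N.rnDeriv (P + N)) = N := by
    have := withDensity_rnDeriv_left N P
    rwa [add_comm N P] at this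
  have h3 : excess N P =
      (P + N).withDensity (fun z => N.rnDeriv (P + N) z - P.rnDeriv (P + N) z) := by
    rw [excess, add_comm N P]
  have e1 : excess P N + N = (P + N).withDensity
      ((fun z => P.rnDeriv (P + N) z - N.rnDeriv (P + N) z) + N.rnDeriv (P + N)) := by
    rw [withDensity_add_right _ hN, h2, excess]
  have e2 : P + excess N P = (P + N).withDensity
      (P.rnDeriv (P + N) + fun z => N.rnDeriv (P + N) z - P.rnDeriv (P + N) z) := by
    rw [withDensity_add_left hP, withDensity_rnDeriv_left P N, h3]
  rw [e1, e2]
  congr 1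
  funext z
  simp only [Pi.add_apply]
  rw [tsub_add_eq_max, add_tsub_eq_max]

namespace SignedField

/-- The sum of two signed measures, again in Jordan form. -/
instance : Add SignedField where
  add μ ν :=
    { pos := excess (μ.pos + ν.pos) (μ.neg + ν.neg)
      neg := excess (μ.neg + ν.neg) (μ.pos + ν.pos)
      pos_locallyFinite := excess_locallyFinite _ _
      neg_locallyFinite := excess_locallyFinite _ _
      mutuallySingular := excess_mutuallySingular _ _ }

/-- The variation `|μ|`. -/
def variation (μ : SignedField) : Measure ℂ := μ.pos + μ.neg

/-- The intensity `α` at `z`: the mass of the atom of `μ` at `z` is `2π α`. -/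
def intensity (μ : SignedField) (z : ℂ) : ℝ :=
  (μ.pos.real {z} - μ.neg.real {z}) / (2 * Real.pi)

/-- The set of atoms of `μ`, i.e. the set carrying the discrete part
`2π ∑ α_l δ_l` of `μ`. -/
def atoms (μ : SignedField) : Set ℂ := {z | μ.intensity z ≠ 0}

/-- The variation `|μ_c|` of the continuous (that is, atomless) part of `μ`. -/
def contVariation (μ : SignedField) : Measure ℂ := μ.variation.restrict μ.atomsᶜ

/-- `Ψ` is a scalar potential of `μ`: `ΔΨ = μ` in the sense of distributions on `ℂ = ℝ²`. -/
def IsPotential (μ : SignedField) (Ψ : ℂ → ℝ) : Prop :=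
  LocallyIntegrable Ψ volume ∧
    ∀ φ : ℂ → ℝ, ContDiff ℝ (⊤ : ℕ∞) φ → HasCompactSupport φ →
      ∫ z, Ψ z * Laplacian.laplacian φ z = (∫ z, φ z ∂μ.pos) - ∫ z, φ z ∂μ.neg

/-- `Ψ(z) - α(z) ln d(z) ≥ γ |z|²` for `|z|` large, where `d(z)` is the distance from `z` to the
nearest atom of `μ` and `α(z)` is the intensity of `μ` there (of any of the nearest atoms, if there
are several). The logarithmic term is absent if `μ` has no atoms. Potentials are functions
determined almost everywhere. -/
def QuadraticLowerBound (μ : SignedField) (Ψ : ℂ → ℝ) (γ : ℝ) : Prop :=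
  ∃ R : ℝ, ∀ᵐ z : ℂ, R ≤ ‖z‖ →
    (μ.atoms = ∅ → γ * ‖z‖ ^ 2 ≤ Ψ z) ∧
    ∀ l ∈ μ.atoms, (∀ l' ∈ μ.atoms, dist z l ≤ dist z l') →
      γ * ‖z‖ ^ 2 ≤ Ψ z - μ.intensity l * Real.log (dist z l)

/-- Normalization of the intensities of the unperturbed field for the maximal operator. -/
def MaxNormalized (μ : SignedField) : Prop :=
  ∃ θ : ℝ, θ < 1 ∧ ∀ l ∈ μ.atoms, 0 < μ.intensity l ∧ μ.intensity l ≤ θ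

/-- Normalization of the intensities for the `EV` operator. -/
def EVNormalized (μ : SignedField) : Prop :=
  ∀ l ∈ μ.atoms, μ.intensity l ∈ Set.Ico (-(1 / 2) : ℝ) (1 / 2)

/-- `M(ρ) = ∫_{r₁ ≤ |w| ≤ ρ} w⁻² dμ(w)`. -/
def secondMoment (μ : SignedField) (r₁ ρ : ℝ) : ℂ :=
  (∫ w in {w : ℂ | r₁ ≤ ‖w‖ ∧ ‖w‖ ≤ ρ}, (w ^ 2)⁻¹ ∂μ.pos) -
    ∫ w in {w : ℂ | r₁ ≤ ‖w‖ ∧ ‖w‖ ≤ ρ}, (w ^ 2)⁻¹ ∂μ.neg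

/-- `ω(ρ) = |μ|(D(0, ρ))`. -/
def growth (μ : SignedField) (ρ : ℝ) : ℝ := μ.variation.real (Metric.ball 0 ρ)

end SignedField

/-- Uniform discreteness with separation at least `r`. -/
def UniformlyDiscrete (L : Set ℂ) (r : ℝ) : Prop :=
  ∀ l ∈ L, ∀ l' ∈ L, l ≠ l' → r ≤ dist l l'

namespace SignedField

/-- The standing conditions on an additive perturbation: its atoms are `r`-separated, their
intensities are bounded by some `θ < 1` in absolute value, and the logarithmic potential of the
continuous part is locally bounded by `B`, uniformly in the plane. -/
structure IsPerturbation (μ : SignedField) (r B : ℝ) : Prop where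
  separated : UniformlyDiscrete μ.atoms r
  intensity_le : ∃ θ : ℝ, θ < 1 ∧ ∀ l ∈ μ.atoms, |μ.intensity l| ≤ θ
  log_bound : ∀ z : ℂ,
    ∫⁻ w in Metric.ball z r, ENNReal.ofReal |Real.log ‖w - z‖| ∂μ.contVariation ≤ ENNReal.ofReal B

/-- The sparse case: `ω(ρ) = O(ρ^{2-τ})` for some `τ > 0`. -/
def IsSparse (μ : SignedField) : Prop :=
  ∃ τ K R : ℝ, 0 < τ ∧ ∀ ρ : ℝ, R ≤ ρ → μ.growth ρ ≤ K * ρ ^ (2 - τ)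

/-- The small case: `ω(ρ) ≤ ε ρ²` and `|M(ρ)| ≤ ε` for `ρ` large. -/
def IsSmall (μ : SignedField) (ε : ℝ) : Prop :=
  ∃ r₁ R₀ : ℝ, 0 < r₁ ∧ ∀ ρ : ℝ, R₀ < ρ →
    μ.growth ρ ≤ ε * ρ ^ 2 ∧ ‖μ.secondMoment r₁ ρ‖ ≤ ε

end SignedField

/-! ### The spin-down Pauli operators -/

/-- The Hilbert space `L₂(ℝ²)`. -/
abbrev L2 : Type := Lp ℂ 2 (volume : Measure ℂ)

/-- `∂φ = (∂₁φ - i ∂₂φ) / 2`. -/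
def del (φ : ℂ → ℂ) (z : ℂ) : ℂ :=
  (fderiv ℝ φ z 1 - Complex.I * fderiv ℝ φ z Complex.I) / 2

/-- `g` and `h` are locally integrable on the open set `Ω`, and `∂g = h` in the sense of
distributions on `Ω`. -/
def HasWeakDel (Ω : Set ℂ) (g h : ℂ → ℂ) : Prop :=
  LocallyIntegrableOn g Ω volume ∧ LocallyIntegrableOn h Ω volume ∧
    ∀ φ : ℂ → ℂ, ContDiff ℝ (⊤ : ℕ∞) φ → HasCompactSupport φ → tsupport φ ⊆ Ω →
      ∫ z, g z * del φ z = -∫ z, h z * φ z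

/-- `ψ` is in the domain of the form `𝔭₋[ψ] = 4 ∫ |∂(e^Ψ ψ)|² e^{-2Ψ} dx`, with `∂` taken in the
sense of distributions on `Ω`, and `h` is the function `∂(e^Ψ ψ)`. -/
def InFormDomain (Ω : Set ℂ) (Ψ : ℂ → ℝ) (ψ : L2) (h : ℂ → ℂ) : Prop :=
  HasWeakDel Ω (fun z => (Real.exp (Ψ z) : ℂ) * ψ z) h ∧
    MemLp (fun z => (Real.exp (-Ψ z) : ℂ) * h z) 2 volume

/-- The graph of the operator `P` associated with the form `𝔭₋` (with derivatives taken on `Ω`):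
`ψ ∈ dom P` and `P ψ = w` iff `ψ` is in the form domain and `𝔭₋[φ, ψ] = ⟨φ, w⟩` for all `φ` in the
form domain. -/
def IsPauliValue (Ω : Set ℂ) (Ψ : ℂ → ℝ) (ψ w : L2) : Prop :=
  ∃ h : ℂ → ℂ, InFormDomain Ω Ψ ψ h ∧
    ∀ (φ : L2) (k : ℂ → ℂ), InFormDomain Ω Ψ φ k →
      4 * ∫ z, (starRingEnd ℂ) ((Real.exp (-Ψ z) : ℂ) * k z) * ((Real.exp (-Ψ z) : ℂ) * h z)
        = inner ℂ φ w

theorem del_hasCompactSupport {φ : ℂ → ℂ} (hφ : HasCompactSupport φ) :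
    HasCompactSupport (del φ) :=
  (hφ.fderiv (𝕜 := ℝ)).comp_left (g := fun L : ℂ →L[ℝ] ℂ => (L 1 - Complex.I * L Complex.I) / 2)
    (by simp)

theorem tsupport_del_subset {φ : ℂ → ℂ} : tsupport (del φ) ⊆ tsupport φ := by
  refine (closure_mono ?_).trans (tsupport_fderiv_subset ℝ)
  intro z hz hz'
  exact hz (by simp [del, hz'])

theorem continuous_del {φ : ℂ → ℂ} (hφ : ContDiff ℝ (⊤ : ℕ∞) φ) : Continuous (del φ) := by
  have h := hφ.continuous_fderiv (by simp)
  unfold del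
  fun_prop

theorem integrable_mul_of_tsupport {Ω : Set ℂ} {g χ : ℂ → ℂ}
    (hg : LocallyIntegrableOn g Ω volume) (hχ : Continuous χ) (hc : HasCompactSupport χ)
    (hs : tsupport χ ⊆ Ω) : Integrable (fun z => g z * χ z) volume := by
  have h1 : IntegrableOn g (tsupport χ) volume := hg.integrableOn_compact_subset hs hc
  have h2 : IntegrableOn (fun z => g z * χ z) (tsupport χ) volume :=
    h1.mul_continuousOn hχ.continuousOn hc
  refine (integrableOn_iff_integrable_of_support_subset ?_).1 h2
  intro z hz
  apply subset_tsupport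
  intro h0
  exact hz (by simp [h0])

theorem HasWeakDel.congr {Ω : Set ℂ} {g g' h : ℂ → ℂ} (H : HasWeakDel Ω g h)
    (e : g =ᵐ[volume] g') : HasWeakDel Ω g' h := by
  refine ⟨fun x hx => ?_, H.2.1, fun φ h1 h2 h3 => ?_⟩
  · exact IntegrableAtFilter.congr (H.1 x hx) e
  · rw [← H.2.2 φ h1 h2 h3]
    refine integral_congr_ae ?_
    filter_upwards [e] with z hz
    rw [hz]

theorem HasWeakDel.add {Ω : Set ℂ} {g g' h h' : ℂ → ℂ} (H : HasWeakDel Ω g h)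
    (H' : HasWeakDel Ω g' h') : HasWeakDel Ω (fun z => g z + g' z) (fun z => h z + h' z) := by
  refine ⟨H.1.add H'.1, H.2.1.add H'.2.1, fun φ h1 h2 h3 => ?_⟩
  have t := tsupport_del_subset.trans h3
  simp only [add_mul]
  rw [integral_add (integrable_mul_of_tsupport H.1 (continuous_del h1) (del_hasCompactSupport h2) t)
      (integrable_mul_of_tsupport H'.1 (continuous_del h1) (del_hasCompactSupport h2) t),
    integral_add (integrable_mul_of_tsupport H.2.1 h1.continuous h2 h3)
      (integrable_mul_of_tsupport H'.2.1 h1.continuous h2 h3),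
    H.2.2 φ h1 h2 h3, H'.2.2 φ h1 h2 h3]
  ring

theorem HasWeakDel.const_mul {Ω : Set ℂ} {g h : ℂ → ℂ} (H : HasWeakDel Ω g h) (c : ℂ) :
    HasWeakDel Ω (fun z => c * g z) (fun z => c * h z) := by
  refine ⟨H.1.smul c, H.2.1.smul c, fun φ h1 h2 h3 => ?_⟩
  simp only [mul_assoc]
  rw [integral_const_mul, integral_const_mul, H.2.2 φ h1 h2 h3]
  ring

theorem InFormDomain.add {Ω : Set ℂ} {Ψ : ℂ → ℝ} {ψ ψ' : L2} {h h' : ℂ → ℂ}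
    (H : InFormDomain Ω Ψ ψ h) (H' : InFormDomain Ω Ψ ψ' h') :
    InFormDomain Ω Ψ (ψ + ψ') (fun z => h z + h' z) := by
  refine ⟨(H.1.add H'.1).congr ?_, ?_⟩
  · filter_upwards [Lp.coeFn_add ψ ψ'] with z hz
    rw [hz, Pi.add_apply, mul_add]
  · have := H.2.add H'.2
    refine this.congr_norm this.1 ?_ |>.ae_eq ?_
    · exact Filter.Eventually.of_forall fun z => rfl
    · exact Filter.Eventually.of_forall fun z => by simp [mul_add]

theorem InFormDomain.smul {Ω : Set ℂ} {Ψ : ℂ → ℝ} {ψ : L2} {h : ℂ → ℂ}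
    (H : InFormDomain Ω Ψ ψ h) (c : ℂ) : InFormDomain Ω Ψ (c • ψ) (fun z => c * h z) := by
  refine ⟨(H.1.const_mul c).congr ?_, ?_⟩
  · filter_upwards [Lp.coeFn_smul c ψ] with z hz
    rw [hz, Pi.smul_apply, smul_eq_mul]
    ring
  · refine (H.2.const_mul c).ae_eq ?_
    exact Filter.Eventually.of_forall fun z => by simp only []; ring

theorem InFormDomain.integrable {Ω : Set ℂ} {Ψ : ℂ → ℝ} {ψ φ : L2} {h k : ℂ → ℂ}
    (H : InFormDomain Ω Ψ ψ h) (K : InFormDomain Ω Ψ φ k) :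
    Integrable (fun z => (starRingEnd ℂ) ((Real.exp (-Ψ z) : ℂ) * k z) *
      ((Real.exp (-Ψ z) : ℂ) * h z)) volume :=
  MemLp.integrable_mul (p := 2) (q := 2) K.2.star H.2

/-- The kernel of the operator associated with the form `𝔭₋`: the space of its zero modes. -/
def zeroModes (Ω : Set ℂ) (Ψ : ℂ → ℝ) : Submodule ℂ L2 where
  carrier := {ψ | IsPauliValue Ω Ψ ψ 0}
  zero_mem' := by
    refine ⟨fun _ => 0, ⟨⟨?_, ?_, ?_⟩, ?_⟩, ?_⟩
    · have e : (fun _ : ℂ => (0 : ℂ)) =ᵐ[volume]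
          fun z => (Real.exp (Ψ z) : ℂ) * (0 : L2) z := by
        filter_upwards [Lp.coeFn_zero ℂ 2 (volume : Measure ℂ)] with z hz
        rw [hz]; simp
      intro x hx
      exact IntegrableAtFilter.congr (locallyIntegrableOn_zero x hx) e
    · exact locallyIntegrableOn_zero
    · intro φ _ _ _
      have : (fun z => (Real.exp (Ψ z) : ℂ) * (0 : L2) z * del φ z) =ᵐ[volume] 0 := by
        filter_upwards [Lp.coeFn_zero ℂ 2 (volume : Measure ℂ)] with z hz
        rw [hz]; simp
      rw [integral_congr_ae this]; simp
    · simp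
    · intro φ k _; simp
  add_mem' := by
    rintro ψ ψ' ⟨h, H, H0⟩ ⟨h', H', H0'⟩
    refine ⟨_, H.add H', fun φ k K => ?_⟩
    have e := H0 φ k K
    have e' := H0' φ k K
    rw [inner_zero_right] at e e' ⊢
    simp only [mul_add]
    rw [integral_add (H.integrable K) (H'.integrable K), mul_add, e, e', add_zero]
  smul_mem' := by
    rintro c ψ ⟨h, H, H0⟩
    refine ⟨_, H.smul c, fun φ k K => ?_⟩
    have e := H0 φ k K
    rw [inner_zero_right] at e ⊢
    have : ∀ z, (starRingEnd ℂ) ((Real.exp (-Ψ z) : ℂ) * k z) *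
        ((Real.exp (-Ψ z) : ℂ) * (c * h z)) =
        c * ((starRingEnd ℂ) ((Real.exp (-Ψ z) : ℂ) * k z) * ((Real.exp (-Ψ z) : ℂ) * h z)) :=
      fun z => by ring
    simp only [this]
    rw [integral_const_mul, mul_left_comm, e, mul_zero]

/-- Zero modes of the maximal spin-down operator `P₋max` with field `μ` and scalar potential `Ψ`:
derivatives are taken in the sense of distributions away from the atoms of `μ`. -/
def zeroModesMax (μ : SignedField) (Ψ : ℂ → ℝ) : Submodule ℂ L2 := zeroModes μ.atomsᶜ Ψ

/-- Zero modes of the spin-down operator `P₋EV`, for a field whose intensities are in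
`[-1/2, 1/2)`, with scalar potential `Ψ`: derivatives are taken in the sense of distributions on the
whole plane. -/
def zeroModesEV (Ψ : ℂ → ℝ) : Submodule ℂ L2 := zeroModes Set.univ Ψ

end PauliZeroModes

end

/-! ### The Laplacian of test functions and Green's identity -/

namespace PauliZeroModes
open Filter Topology Set Metric Laplacian

/-! Everything reduces to a potential of `μ₀ + μ` that grows quadratically up to logarithmic poles.
Put Ψ* = Ψ₀ + Φ, where Φ is the logarithmic potential of the perturbation with the genus-two kernel
log|z-w| - log|w| + Re(z/w) + Re(z²/w²)/2 (plain log|z-w| for |w| < r₁). This kernel is O(|z/w|³)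
for |w| ≥ 2|z|, so it is integrable against a measure of quadratic growth, and the correction is
harmonic in z, so ΔΦ = μ.

The heart is the lower bound Φ ≥ β log d - Cε log(1/ε)|z|² - E|z|, with the logarithm present only
near an atom (`IsPerturbation.exists_potential`). Two contributions cannot be estimated by absolute
values: the quadratic correction over r₁ ≤ |w| ≤ 2|z|, which integrates to Re(z² M(2|z|))/2 and is
small because M is, and the logarithm at a nearby atom, which is the pole. The rest is estimated
against |μ|. The factor log(1/ε) appears on splitting the disc |w| < 4|z| at |w-z| = √ε|z|: outside,
log(4|z|/|w-z|) is at most log(4/√ε) and the mass is O(ε|z|²) up to a constant; inside, the mass of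
every disc of radius s is at most A(s²+1), and a dyadic sum gives O(Aε|z|²) + O(|z|). The constant
A, hence C = 601 + 32A, depends on r and B only (`exists_variation_ball_le`): separated atoms of
bounded intensity and the logarithmic bound on the continuous part limit the mass of small discs. A
sparse field is small for every ε (`IsSparse.isSmall`).

To add the bounds for Ψ₀ and Φ, both are written with poles on the common separated set S = Λ₀ ∪ Λ
(`PoleLowerBound`). A pole at distance at least δ costs only O(|z|), which the quadratic term
absorbs, so coinciding or cancelling atoms need no special treatment.

For the zero modes, e^{-Ψ} times an antiholomorphic function is annihilated on any Ω, once it is in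
L₂. Two potentials differ by Re F with F entire (Weyl's lemma), so e^{-Ψ} p(z̄) conj(e^F) has
modulus e^{-Ψ*}|p(z̄)|, and it suffices that |z|^{2n} e^{-2Ψ*} is integrable. At infinity this is a
Gaussian times uniformly integrable poles d^{-s} with s < 2 (`integrable_gaussian_mul_poleFactor`).
Locally it follows from Jensen's inequality, because no point carries positive mass 2π or more
(`IsPotential.locallyIntegrable_exp`). Polynomials p then give an infinite-dimensional space. -/

theorem laplacian_apply (f : ℂ → ℝ) (x : ℂ) :
    Δ f x = fderiv ℝ (fderiv ℝ f) x 1 1 + fderiv ℝ (fderiv ℝ f) x Complex.I Complex.I := by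
  rw [InnerProductSpace.laplacian_eq_iteratedFDeriv_complexPlane]
  simp [iteratedFDeriv_two_apply]

theorem fderiv_fderiv_apply {f : ℂ → ℝ} (hf : ContDiff ℝ 2 f) (v x : ℂ) :
    fderiv ℝ (fun y => fderiv ℝ f y v) x v = fderiv ℝ (fderiv ℝ f) x v v := by
  have h : DifferentiableAt ℝ (fderiv ℝ f) x :=
    ((hf.fderiv_right (m := 1) (by norm_num)).differentiable (by norm_num)) x
  rw [fderiv_clm_apply h (differentiableAt_const v)]
  simp

theorem continuous_fderiv_fderiv {f : ℂ → ℝ} (hf : ContDiff ℝ 2 f) (v : ℂ) :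
    Continuous (fun x => fderiv ℝ (fderiv ℝ f) x v v) := by
  have h0 : ContDiff ℝ 1 (fderiv ℝ f) := hf.fderiv_right (by norm_num)
  have h : Continuous (fderiv ℝ (fderiv ℝ f)) := h0.continuous_fderiv one_ne_zero
  exact (h.clm_apply continuous_const).clm_apply continuous_const

theorem continuous_laplacian {f : ℂ → ℝ} (hf : ContDiff ℝ 2 f) : Continuous (Δ f) := by
  have : Δ f = fun x => fderiv ℝ (fderiv ℝ f) x 1 1 +
      fderiv ℝ (fderiv ℝ f) x Complex.I Complex.I := funext (laplacian_apply f)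
  rw [this]
  exact (continuous_fderiv_fderiv hf 1).add (continuous_fderiv_fderiv hf Complex.I)

theorem tsupport_laplacian_subset (f : ℂ → ℝ) : tsupport (Δ f) ⊆ tsupport f := by
  have h : tsupport (fderiv ℝ (fderiv ℝ f)) ⊆ tsupport f :=
    (tsupport_fderiv_subset ℝ (f := fderiv ℝ f)).trans (tsupport_fderiv_subset ℝ)
  refine Subset.trans (closure_mono ?_) h
  intro z hz hz'
  exact hz (by simp [laplacian_apply, hz'])

theorem hasCompactSupport_laplacian {f : ℂ → ℝ} (hf : HasCompactSupport f) :
    HasCompactSupport (Δ f) :=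
  IsCompact.of_isClosed_subset hf (isClosed_tsupport _) (tsupport_laplacian_subset f)

theorem integral_mul_fderiv_fderiv {f φ : ℂ → ℝ} (hf : ContDiff ℝ 2 f) (hφ : ContDiff ℝ 2 φ)
    (hc : HasCompactSupport φ) (v : ℂ) :
    ∫ z, f z * fderiv ℝ (fderiv ℝ φ) z v v = ∫ z, fderiv ℝ (fderiv ℝ f) z v v * φ z := by
  have d1 : ContDiff ℝ 1 (fun y => fderiv ℝ φ y v) := by
    have := hφ.fderiv_right (m := 1) (by norm_num)
    fun_prop
  have d2 : ContDiff ℝ 1 (fun y => fderiv ℝ f y v) := by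
    have := hf.fderiv_right (m := 1) (by norm_num)
    fun_prop
  have c1 : HasCompactSupport (fun y => fderiv ℝ φ y v) := hc.fderiv_apply (𝕜 := ℝ) v
  have c2 : HasCompactSupport (fun y => fderiv ℝ (fderiv ℝ φ) y v v) := by
    simp only [← fderiv_fderiv_apply hφ]
    exact c1.fderiv_apply (𝕜 := ℝ) v
  have e1 := integral_mul_fderiv_eq_neg_fderiv_mul_of_integrable (μ := (volume : Measure ℂ))
    (f := f) (g := fun y => fderiv ℝ φ y v) (v := v)
    ((d2.continuous.mul d1.continuous).integrable_of_hasCompactSupport c1.mul_left)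
    (by
      simp only [fderiv_fderiv_apply hφ]
      exact (hf.continuous.mul (continuous_fderiv_fderiv hφ v)).integrable_of_hasCompactSupport
        c2.mul_left)
    ((hf.continuous.mul d1.continuous).integrable_of_hasCompactSupport c1.mul_left)
    (fun x _ => hf.differentiable (by norm_num) x) (fun x _ => d1.differentiable (by norm_num) x)
  have e2 := integral_mul_fderiv_eq_neg_fderiv_mul_of_integrable (μ := (volume : Measure ℂ))
    (f := fun y => fderiv ℝ f y v) (g := φ) (v := v)
    (by
      simp only [fderiv_fderiv_apply hf]
      exact ((continuous_fderiv_fderiv hf v).mul hφ.continuous).integrable_of_hasCompactSupport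
        hc.mul_left)
    ((d2.continuous.mul d1.continuous).integrable_of_hasCompactSupport c1.mul_left)
    ((d2.continuous.mul hφ.continuous).integrable_of_hasCompactSupport hc.mul_left)
    (fun x _ => d2.differentiable (by norm_num) x) (fun x _ => hφ.differentiable (by norm_num) x)
  simp only [fderiv_fderiv_apply hφ, fderiv_fderiv_apply hf] at e1 e2
  rw [e1, e2, neg_neg]

/-- Green's second identity for a compactly supported function. -/
theorem integral_mul_laplacian {f φ : ℂ → ℝ} (hf : ContDiff ℝ 2 f) (hφ : ContDiff ℝ 2 φ)
    (hc : HasCompactSupport φ) : ∫ z, f z * Δ φ z = ∫ z, Δ f z * φ z := by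
  have c2 : ∀ v, HasCompactSupport (fun y => fderiv ℝ (fderiv ℝ φ) y v v) := fun v =>
    ((hc.fderiv (𝕜 := ℝ)).fderiv (𝕜 := ℝ)).comp_left
      (g := fun L : ℂ →L[ℝ] ℂ →L[ℝ] ℝ => L v v) (by simp)
  simp only [laplacian_apply, mul_add, add_mul]
  rw [integral_add, integral_add, integral_mul_fderiv_fderiv hf hφ hc,
    integral_mul_fderiv_fderiv hf hφ hc]
  · exact ((continuous_fderiv_fderiv hf 1).mul hφ.continuous).integrable_of_hasCompactSupport
      hc.mul_left
  · exact ((continuous_fderiv_fderiv hf _).mul hφ.continuous).integrable_of_hasCompactSupport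
      hc.mul_left
  · exact (hf.continuous.mul (continuous_fderiv_fderiv hφ 1)).integrable_of_hasCompactSupport
      (c2 1).mul_left
  · exact (hf.continuous.mul (continuous_fderiv_fderiv hφ _)).integrable_of_hasCompactSupport
      (c2 _).mul_left

/-! ### Powers of the distance -/

theorem integrableOn_norm_rpow {s : ℝ} (hs : s < 2) (R : ℝ) :
    IntegrableOn (fun z : ℂ => ‖z‖ ^ (-s)) (ball 0 R) := by
  rw [integrableOn_fun_norm_addHaar (volume : Measure ℂ) (f := fun t => t ^ (-s))]
  simp only [Complex.finrank_real_complex]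
  have h : IntegrableOn (fun t : ℝ => t ^ (1 - s)) (Ioo 0 R) := by
    rcases le_or_gt R 0 with hR | hR
    · simp [Ioo_eq_empty_of_le hR]
    · exact (intervalIntegral.integrableOn_Ioo_rpow_iff hR).2 (by linarith)
  refine h.congr_fun (fun t ht => ?_) measurableSet_Ioo
  simp only [smul_eq_mul]
  rw [show 1 - s = 1 + -s by ring, Real.rpow_add ht.1]
  simp

theorem abs_log_le_inv_add {x : ℝ} (hx : 0 ≤ x) : |Real.log x| ≤ x ^ (-1 : ℝ) + x := by
  rcases hx.eq_or_lt with rfl | hx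
  · simp [Real.zero_rpow]
  rw [Real.rpow_neg_one]
  have h1 := Real.log_le_sub_one_of_pos hx
  have h2 := Real.log_le_sub_one_of_pos (inv_pos.2 hx)
  rw [Real.log_inv] at h2
  have := inv_pos.2 hx
  rw [abs_le]
  constructor <;> linarith

theorem integrableOn_log_norm (R : ℝ) :
    IntegrableOn (fun z : ℂ => Real.log ‖z‖) (ball 0 R) := by
  have h1 : IntegrableOn (fun z : ℂ => ‖z‖ ^ (-1 : ℝ) + ‖z‖) (ball 0 R) :=
    (integrableOn_norm_rpow (by norm_num) R).add
      ((continuous_norm.locallyIntegrable.integrableOn_isCompact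
        (isCompact_closedBall 0 R)).mono_set ball_subset_closedBall)
  refine h1.mono' (Real.measurable_log.comp measurable_norm).aestronglyMeasurable
    (Eventually.of_forall fun z => ?_)
  exact abs_log_le_inv_add (norm_nonneg z)

theorem integrableOn_ball_comp_sub {f : ℂ → ℝ} (w : ℂ) (R : ℝ) :
    IntegrableOn (fun z => f (z - w)) (ball w R) ↔ IntegrableOn f (ball 0 R) := by
  have := (measurePreserving_sub_right (volume : Measure ℂ) w).integrableOn_comp_preimage
    (measurableEmbedding_subRight w) (f := f) (s := ball 0 R)
  rw [← this]
  have e : (fun x => x - w) ⁻¹' ball 0 R = ball w R := by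
    ext z
    simp [dist_eq_norm]
  rw [e]
  rfl

theorem locallyIntegrable_log_norm_sub (w : ℂ) :
    LocallyIntegrable (fun z : ℂ => Real.log ‖z - w‖) := fun z =>
  ⟨ball w (dist z w + 1), isOpen_ball.mem_nhds (by simp),
    (integrableOn_ball_comp_sub (f := fun z => Real.log ‖z‖) w _).2 (integrableOn_log_norm _)⟩

/-! ### The fundamental solution -/

/-- A smooth approximation of `log ‖z‖`. -/
noncomputable def smoothLog (ε : ℝ) (z : ℂ) : ℝ := Real.log (‖z‖ ^ 2 + ε) / 2

theorem contDiff_smoothLog {ε : ℝ} (hε : 0 < ε) : ContDiff ℝ 2 (smoothLog ε) := by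
  unfold smoothLog
  refine ContDiff.div_const (ContDiff.log ?_ fun z => by positivity) _
  exact (contDiff_norm_sq ℝ).add contDiff_const

/-- For ε = c⁻² this is 2π times the rescaling by c of the probability density π⁻¹(1+|z|²)⁻², so it
tends to 2πδ₀ as c → ∞. -/
theorem laplacian_smoothLog {ε : ℝ} (hε : 0 < ε) (z : ℂ) :
    Δ (smoothLog ε) z = 2 * ε / (‖z‖ ^ 2 + ε) ^ 2 := by
  have hq : ∀ z : ℂ, ‖z‖ ^ 2 + ε ≠ 0 := fun z => by positivity
  have h1 : ∀ z v : ℂ, fderiv ℝ (smoothLog ε) z v = inner ℝ z v / (‖z‖ ^ 2 + ε) := by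
    intro z v
    have := (((hasStrictFDerivAt_norm_sq z).hasFDerivAt.add_const ε).log (hq z)).mul_const
      (2⁻¹ : ℝ)
    have e : smoothLog ε = fun y => Real.log (‖y‖ ^ 2 + ε) * 2⁻¹ := by
      funext y; simp [smoothLog, div_eq_mul_inv]
    rw [e, this.fderiv]
    simp
    ring
  have h2 : ∀ v : ℂ, fderiv ℝ (fderiv ℝ (smoothLog ε)) z v v =
      ‖v‖ ^ 2 / (‖z‖ ^ 2 + ε) - 2 * inner ℝ z v ^ 2 / (‖z‖ ^ 2 + ε) ^ 2 := by
    intro v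
    rw [← fderiv_fderiv_apply (contDiff_smoothLog hε)]
    simp only [h1]
    have a1 : HasFDerivAt (fun y : ℂ => inner ℝ y v) (innerSL ℝ v) z := by
      have := (innerSL ℝ v).hasFDerivAt (x := z)
      refine this.congr_of_eventuallyEq (Eventually.of_forall fun y => ?_)
      simp [real_inner_comm]
    have a2 := ((hasStrictFDerivAt_norm_sq z).hasFDerivAt.add_const ε)
    have a3 := a1.mul ((hasDerivAt_inv (hq z)).comp_hasFDerivAt z a2)
    have e : (fun y : ℂ => inner ℝ y v / (‖y‖ ^ 2 + ε)) =
      (fun y : ℂ => inner ℝ y v) * (Inv.inv ∘ fun y => (‖y‖ ^ 2 + ε)) := by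
      funext y; simp [div_eq_mul_inv]
    rw [e, a3.fderiv]
    have := hq z
    simp
    field_simp
    ring
  rw [laplacian_apply, h2, h2]
  have hn : ‖z‖ ^ 2 = z.re ^ 2 + z.im ^ 2 := by
    rw [Complex.sq_norm, Complex.normSq_apply]; ring
  have := hq z
  simp only [norm_one, Complex.norm_I, Complex.inner]
  simp
  rw [hn] at this ⊢
  field_simp
  ring

theorem integral_planar_bump :
    ∫ z : ℂ, Real.pi⁻¹ * ((1 + ‖z‖ ^ 2) ^ 2)⁻¹ = 1 := by
  rw [integral_const_mul,
    integral_fun_norm_addHaar (volume : Measure ℂ) (fun t => ((1 + t ^ 2) ^ 2)⁻¹)]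
  have hd : ∀ y ∈ Ici (0 : ℝ), HasDerivAt (fun y : ℝ => -(2 * (1 + y ^ 2))⁻¹)
      (y * ((1 + y ^ 2) ^ 2)⁻¹) y := by
    intro y _
    have h0 : 2 * (1 + y ^ 2) ≠ 0 := by positivity
    have h1 : HasDerivAt (fun y : ℝ => 2 * (1 + y ^ 2)) (2 * (2 * y)) y := by
      simpa using (((hasDerivAt_id y).pow 2).const_add 1).const_mul 2
    have h2 : 1 + y ^ 2 ≠ 0 := by positivity
    refine (h1.fun_inv h0).fun_neg.congr_deriv ?_
    field_simp
  have ht : Tendsto (fun y : ℝ => -(2 * (1 + y ^ 2))⁻¹) atTop (𝓝 0) := by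
    rw [← neg_zero]
    refine (Tendsto.inv_tendsto_atTop ?_).neg
    exact (tendsto_atTop_add_const_left _ _ (tendsto_pow_atTop two_ne_zero)).const_mul_atTop
      two_pos
  have hi := integral_Ioi_of_hasDerivAt_of_nonneg' hd
    (fun y hy => mul_nonneg (le_of_lt hy) (by positivity)) ht
  simp only [Complex.finrank_real_complex, smul_eq_mul, Nat.add_one_sub_one, pow_one, hi]
  rw [measureReal_def, Complex.volume_ball]
  have := Real.pi_pos
  simp
  field_simp

theorem tendsto_integral_planar_bump {g : ℂ → ℝ} (hg : Integrable g) (h0 : ContinuousAt g 0) :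
    Tendsto (fun c : ℝ => ∫ z, Δ (smoothLog (c ^ 2)⁻¹) z * g z) atTop
      (𝓝 (2 * Real.pi * g 0)) := by
  have h := tendsto_integral_comp_smul_smul_of_integrable (μ := (volume : Measure ℂ))
    (φ := fun z : ℂ => Real.pi⁻¹ * ((1 + ‖z‖ ^ 2) ^ 2)⁻¹) (fun z => by positivity)
    integral_planar_bump ?_ hg h0
  · refine (h.const_mul (2 * Real.pi)).congr' ?_
    filter_upwards [eventually_gt_atTop 0] with c hc
    rw [← integral_const_mul]
    congr 1
    funext z
    have hp := Real.pi_pos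
    rw [laplacian_smoothLog (by positivity)]
    simp only [Complex.finrank_real_complex, smul_eq_mul, norm_smul, Real.norm_eq_abs, mul_pow,
      sq_abs]
    field_simp
    ring
  · have hp := Real.pi_pos
    have h1 : Tendsto (fun x : ℂ => Real.pi⁻¹ * (‖x‖ ^ 2)⁻¹) (Bornology.cobounded ℂ) (𝓝 0) := by
      rw [← mul_zero Real.pi⁻¹]
      refine Tendsto.const_mul _ (Tendsto.inv_tendsto_atTop ?_)
      exact (tendsto_pow_atTop two_ne_zero).comp tendsto_norm_cobounded_atTop
    refine squeeze_zero' (Eventually.of_forall fun x => by positivity) ?_ h1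
    filter_upwards [Bornology.eventually_ne_cobounded (0 : ℂ)] with x hx
    have hx' : 0 < ‖x‖ := norm_pos_iff.2 hx
    simp only [Complex.finrank_real_complex]
    field_simp
    nlinarith [sq_nonneg (‖x‖ ^ 2)]

theorem abs_smoothLog_le {ε : ℝ} (hε : 0 < ε) (hε1 : ε ≤ 1) {z : ℂ} (hz : z ≠ 0) :
    |smoothLog ε z| ≤ |Real.log ‖z‖| + (‖z‖ ^ 2 + 1) := by
  unfold smoothLog
  have hz' : 0 < ‖z‖ := norm_pos_iff.2 hz
  have h1 : Real.log (‖z‖ ^ 2 + ε) ≤ ‖z‖ ^ 2 + 1 := by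
    have := Real.log_le_sub_one_of_pos (x := ‖z‖ ^ 2 + ε) (by positivity)
    linarith
  have h2 : 2 * Real.log ‖z‖ ≤ Real.log (‖z‖ ^ 2 + ε) := by
    have : 2 * Real.log ‖z‖ = Real.log (‖z‖ ^ 2) := by rw [Real.log_pow]; norm_num
    rw [this]
    exact Real.log_le_log (by positivity) (by linarith)
  have h3 := neg_abs_le (Real.log ‖z‖)
  have h4 := abs_nonneg (Real.log ‖z‖)
  rw [abs_le]
  constructor <;> nlinarith [sq_nonneg ‖z‖]

theorem tendsto_smoothLog {z : ℂ} (hz : z ≠ 0) :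
    Tendsto (fun c : ℝ => smoothLog (c ^ 2)⁻¹ z) atTop (𝓝 (Real.log ‖z‖)) := by
  have h1 : Tendsto (fun c : ℝ => ‖z‖ ^ 2 + (c ^ 2)⁻¹) atTop (𝓝 (‖z‖ ^ 2 + 0)) :=
    (Tendsto.inv_tendsto_atTop (tendsto_pow_atTop two_ne_zero)).const_add _
  rw [add_zero] at h1
  have h2 := (h1.log (by positivity)).div_const 2
  rw [Real.log_pow] at h2
  simpa [smoothLog] using h2

/-- `log ‖z‖ / 2π` is a fundamental solution of the Laplacian. -/
theorem integral_log_norm_mul_laplacian {φ : ℂ → ℝ} (hφ : ContDiff ℝ 2 φ)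
    (hc : HasCompactSupport φ) :
    ∫ z, Real.log ‖z‖ * Δ φ z = 2 * Real.pi * φ 0 := by
  have h1 := tendsto_integral_planar_bump (hφ.continuous.integrable_of_hasCompactSupport hc)
    hφ.continuous.continuousAt
  refine tendsto_nhds_unique ?_ h1
  have hΔ := continuous_laplacian hφ
  have hs := hasCompactSupport_laplacian hc
  have h2 : Tendsto (fun c : ℝ => ∫ z, smoothLog (c ^ 2)⁻¹ z * Δ φ z) atTop
      (𝓝 (∫ z, Real.log ‖z‖ * Δ φ z)) := by
    refine tendsto_integral_filter_of_dominated_convergence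
      (fun z => (|Real.log ‖z‖| + (‖z‖ ^ 2 + 1)) * ‖Δ φ z‖) ?_ ?_ ?_ ?_
    · filter_upwards [eventually_gt_atTop 0] with c hc
      exact ((contDiff_smoothLog (by positivity)).continuous.mul hΔ).aestronglyMeasurable
    · filter_upwards [eventually_ge_atTop 1] with c hc
      filter_upwards [Measure.ae_ne volume (0 : ℂ)] with z hz
      rw [norm_mul]
      gcongr
      exact abs_smoothLog_le (by positivity)
        (inv_le_one_of_one_le₀ (one_le_pow₀ hc)) hz
    · have l1 : LocallyIntegrable (fun z : ℂ => |Real.log ‖z‖| + (‖z‖ ^ 2 + 1)) := by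
        refine LocallyIntegrable.add ?_ (by fun_prop : Continuous _).locallyIntegrable
        have := locallyIntegrable_log_norm_sub 0
        simp only [sub_zero] at this
        exact this.mono this.aestronglyMeasurable.norm (by simp)
      exact l1.integrable_smul_right_of_hasCompactSupport hΔ.norm hs.norm
    · filter_upwards [Measure.ae_ne volume (0 : ℂ)] with z hz
      exact (tendsto_smoothLog hz).mul_const _
  refine h2.congr' ?_
  filter_upwards [eventually_gt_atTop 0] with c hc'
  exact integral_mul_laplacian (contDiff_smoothLog (by positivity)) hφ hc

theorem laplacian_comp_add (φ : ℂ → ℝ) (w z : ℂ) :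
    Δ (fun y => φ (y + w)) z = Δ φ (z + w) := by
  have h : fderiv ℝ (fun y => φ (y + w)) = fun y => fderiv ℝ φ (y + w) :=
    funext fun y => fderiv_comp_add_right w
  rw [laplacian_apply, laplacian_apply, h, fderiv_comp_add_right (f := fderiv ℝ φ)]

theorem integral_log_norm_sub_mul_laplacian {φ : ℂ → ℝ} (hφ : ContDiff ℝ 2 φ)
    (hc : HasCompactSupport φ) (w : ℂ) :
    ∫ z, Real.log ‖z - w‖ * Δ φ z = 2 * Real.pi * φ w := by
  have h := integral_log_norm_mul_laplacian (φ := fun y => φ (y + w))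
    (hφ.comp (contDiff_id.add contDiff_const)) (hc.comp_homeomorph (Homeomorph.addRight w))
  rw [← integral_add_right_eq_self _ w]
  simpa [laplacian_comp_add] using h

end PauliZeroModes
namespace PauliZeroModes
open Filter Topology Set Metric Laplacian Convolution Pointwise

/-! ### Weyl's lemma in the plane -/

theorem contDiff_laplacian {f : ℂ → ℝ} (hf : ContDiff ℝ (⊤ : ℕ∞) f) :
    ContDiff ℝ (⊤ : ℕ∞) (Δ f) := by
  have : Δ f = fun x => fderiv ℝ (fderiv ℝ f) x 1 1 +
      fderiv ℝ (fderiv ℝ f) x Complex.I Complex.I := funext (laplacian_apply f)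
  rw [this]
  have h1 : ContDiff ℝ (⊤ : ℕ∞) (fderiv ℝ f) := hf.fderiv_right (by simp)
  have h2 : ContDiff ℝ (⊤ : ℕ∞) (fderiv ℝ (fderiv ℝ f)) := h1.fderiv_right (by simp)
  exact ((h2.clm_apply contDiff_const).clm_apply contDiff_const).add
    ((h2.clm_apply contDiff_const).clm_apply contDiff_const)

theorem contDiff_two_of_top {f : ℂ → ℝ} (hf : ContDiff ℝ (⊤ : ℕ∞) f) : ContDiff ℝ 2 f :=
  hf.of_le (WithTop.coe_le_coe.2 (le_top (a := (2 : ℕ∞))))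

theorem laplacian_eq_of_eventuallyEq {f g : ℂ → ℝ} {z : ℂ} (h : f =ᶠ[𝓝 z] g) :
    Δ f z = Δ g z :=
  (InnerProductSpace.laplacian_congr_nhds h).self_of_nhds

/-- A parametrix of the Laplacian with small support. -/
theorem exists_parametrix {d : ℝ} (hd : 0 < d) : ∃ κ η : ℂ → ℝ,
    LocallyIntegrable κ ∧ tsupport κ ⊆ closedBall 0 d ∧ ContDiff ℝ (⊤ : ℕ∞) η ∧
    HasCompactSupport η ∧ ∀ ψ : ℂ → ℝ, ContDiff ℝ (⊤ : ℕ∞) ψ → HasCompactSupport ψ →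
      ∫ z, κ z * Δ ψ z = ψ 0 + ∫ z, η z * ψ z := by
  let χ : ContDiffBump (0 : ℂ) := ⟨d / 2, d, by positivity, by linarith⟩
  let χ₂ : ContDiffBump (0 : ℂ) := ⟨d / 4, d / 2, by positivity, by linarith⟩
  have hχ : ContDiff ℝ (⊤ : ℕ∞) χ := χ.contDiff
  -- E is the logarithm with its singularity cut out. It is smooth and agrees with log‖z‖ for ‖z‖ ≥
  -- d/2, where the cutoff χ begins to vary, so the errors caused by χ are smooth.
  let E : ℂ → ℝ := fun z => (1 - χ₂ z) * Real.log ‖z‖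
  have hE : ContDiff ℝ (⊤ : ℕ∞) E := by
    rw [contDiff_iff_contDiffAt]
    intro z
    by_cases hz : z = 0
    · have : E =ᶠ[𝓝 z] fun _ => 0 := by
        rw [hz]
        filter_upwards [χ₂.eventuallyEq_one] with y hy
        simp [E, hy]
      exact contDiffAt_const.congr_of_eventuallyEq this
    · exact (contDiffAt_const.sub χ₂.contDiff.contDiffAt).mul
        ((contDiffAt_norm ℝ hz).log (norm_ne_zero_iff.2 hz))
  have hEχ : ContDiff ℝ (⊤ : ℕ∞) (fun z => E z * χ z) := hE.mul hχ
  have hE2 : ContDiff ℝ 2 E := contDiff_two_of_top hE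
  have hχ2 : ContDiff ℝ 2 χ := χ.contDiff
  have hlog := locallyIntegrable_log_norm_sub 0
  simp only [sub_zero] at hlog
  refine ⟨fun z => (2 * Real.pi)⁻¹ * (χ z * Real.log ‖z‖),
    fun z => (2 * Real.pi)⁻¹ * (Δ (fun z => E z * χ z) z - χ z * Δ E z), ?_, ?_, ?_, ?_, ?_⟩
  · refine LocallyIntegrable.smul ?_ (2 * Real.pi)⁻¹
    refine hlog.mono (χ.continuous.aestronglyMeasurable.mul hlog.aestronglyMeasurable) ?_
    refine Eventually.of_forall fun z => ?_
    rw [norm_mul, Real.norm_of_nonneg χ.nonneg]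
    exact mul_le_of_le_one_left (norm_nonneg _) χ.le_one
  · rw [← χ.tsupport_eq]
    refine closure_mono fun z hz hz' => hz (by simp [hz'])
  · exact contDiff_const.mul ((contDiff_laplacian hEχ).sub (hχ.mul (contDiff_laplacian hE)))
  · have h1 : HasCompactSupport (fun z => E z * χ z) := χ.hasCompactSupport.mul_left
    exact ((hasCompactSupport_laplacian h1).sub (χ.hasCompactSupport.mul_right)).mul_left
  · intro ψ hψ hc
    have hψ2 : ContDiff ℝ 2 ψ := contDiff_two_of_top hψ
    have hχψ : ContDiff ℝ 2 (fun z => χ z * ψ z) := hχ2.mul hψ2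
    have hcχ : HasCompactSupport (fun z => χ z * ψ z) := hc.mul_left
    -- For ‖z‖ < d/2 the bracket vanishes because χ = 1 near z; elsewhere E z = log‖z‖.
    have e1 : ∀ z, Real.log ‖z‖ * (χ z * Δ ψ z) = Real.log ‖z‖ * Δ (fun z => χ z * ψ z) z +
        (E z * χ z * Δ ψ z - E z * Δ (fun z => χ z * ψ z) z) := by
      intro z
      rcases lt_or_ge ‖z‖ (d / 2) with h | h
      · have : (fun z => χ z * ψ z) =ᶠ[𝓝 z] ψ := by
          filter_upwards [isOpen_ball.mem_nhds (show z ∈ ball 0 (d / 2) by simpa using h)] with y hy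
          rw [χ.one_of_mem_closedBall (ball_subset_closedBall hy), one_mul]
        rw [laplacian_eq_of_eventuallyEq this, χ.one_of_mem_closedBall (by simpa using h.le)]
        ring
      · have : E z = Real.log ‖z‖ := by
          simp only [E]
          rw [χ₂.zero_of_le_dist (by simpa using h)]
          ring
        rw [this]; ring
    have i1 : Integrable (fun z => Real.log ‖z‖ * Δ (fun z => χ z * ψ z) z) :=
      hlog.integrable_smul_right_of_hasCompactSupport (continuous_laplacian hχψ)
        (hasCompactSupport_laplacian hcχ)
    have i2 : Integrable (fun z => E z * χ z * Δ ψ z) :=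
      (hEχ.continuous.mul (continuous_laplacian hψ2)).integrable_of_hasCompactSupport
        (hasCompactSupport_laplacian hc).mul_left
    have i3 : Integrable (fun z => E z * Δ (fun z => χ z * ψ z) z) :=
      (hE.continuous.mul (continuous_laplacian hχψ)).integrable_of_hasCompactSupport
        (hasCompactSupport_laplacian hcχ).mul_left
    have e2 : ∫ z, χ z * Real.log ‖z‖ * Δ ψ z = 2 * Real.pi * ψ 0 +
        ∫ z, (Δ (fun z => E z * χ z) z - χ z * Δ E z) * ψ z := by
      have : ∀ z, χ z * Real.log ‖z‖ * Δ ψ z = Real.log ‖z‖ * (χ z * Δ ψ z) := fun z => by ring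
      simp only [this, e1]
      have i4 := integral_add i1 (i2.sub i3)
      simp only [Pi.sub_apply] at i4
      rw [i4, integral_sub i2 i3,
        integral_log_norm_mul_laplacian hχψ hcχ, χ.one_of_mem_closedBall (mem_closedBall_self χ.rIn_pos.le),
        one_mul, integral_mul_laplacian (contDiff_two_of_top hEχ) hψ2 hc,
        integral_mul_laplacian hE2 hχψ hcχ, ← integral_sub]
      · simp only [sub_mul]
        congr 2
        funext z
        ring
      · exact ((contDiff_laplacian hEχ).continuous.mul hψ.continuous).integrable_of_hasCompactSupport
          hc.mul_left
      · exact ((contDiff_laplacian hE).continuous.mul hχψ.continuous).integrable_of_hasCompactSupport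
          hcχ.mul_left
    have hp := Real.pi_pos
    simp only [mul_assoc] at e2 ⊢
    rw [integral_const_mul, e2, integral_const_mul]
    field_simp

theorem laplacian_convolution {κ φ : ℂ → ℝ} (hκ : LocallyIntegrable κ) (hφ : ContDiff ℝ 2 φ)
    (hc : HasCompactSupport φ) :
    Δ (κ ⋆[ContinuousLinearMap.mul ℝ ℝ] φ) = κ ⋆[ContinuousLinearMap.mul ℝ ℝ] Δ φ := by
  have key : ∀ {g : ℂ → ℝ}, ContDiff ℝ 1 g → HasCompactSupport g → ∀ v x,
      fderiv ℝ (κ ⋆[ContinuousLinearMap.mul ℝ ℝ] g) x v =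
        (κ ⋆[ContinuousLinearMap.mul ℝ ℝ] fun y => fderiv ℝ g y v) x := by
    intro g hg hgc v x
    rw [(hgc.hasFDerivAt_convolution_right (ContinuousLinearMap.mul ℝ ℝ) hκ hg x).fderiv,
      convolution_precompR_apply _ hκ (hgc.fderiv (𝕜 := ℝ)) (hg.continuous_fderiv one_ne_zero)]
  have hK : ContDiff ℝ 2 (κ ⋆[ContinuousLinearMap.mul ℝ ℝ] φ) :=
    hc.contDiff_convolution_right (n := 2) _ hκ hφ
  have h1 : ∀ v, ContDiff ℝ 1 (fun y => fderiv ℝ φ y v) := fun v => by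
    have : ContDiff ℝ 1 (fderiv ℝ φ) := hφ.fderiv_right (by norm_num)
    exact this.clm_apply contDiff_const
  have h2 : ∀ v, HasCompactSupport (fun y => fderiv ℝ φ y v) := fun v =>
    hc.fderiv_apply (𝕜 := ℝ) v
  have h3 : ∀ v x, fderiv ℝ (fderiv ℝ (κ ⋆[ContinuousLinearMap.mul ℝ ℝ] φ)) x v v =
      (κ ⋆[ContinuousLinearMap.mul ℝ ℝ] fun y => fderiv ℝ (fderiv ℝ φ) y v v) x := by
    intro v x
    rw [← fderiv_fderiv_apply hK]
    have : (fun y => fderiv ℝ (κ ⋆[ContinuousLinearMap.mul ℝ ℝ] φ) y v) =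
        κ ⋆[ContinuousLinearMap.mul ℝ ℝ] fun y => fderiv ℝ φ y v :=
      funext fun y => key (hφ.of_le (by norm_num)) hc v y
    rw [this, key (h1 v) (h2 v)]
    simp only [fderiv_fderiv_apply hφ]
  have h4 : ∀ v x, ConvolutionExistsAt κ (fun y => fderiv ℝ (fderiv ℝ φ) y v v) x
      (ContinuousLinearMap.mul ℝ ℝ) volume := by
    intro v x
    refine HasCompactSupport.convolutionExists_right _ ?_ hκ (continuous_fderiv_fderiv hφ v) x
    simp only [← fderiv_fderiv_apply hφ]
    exact (h2 v).fderiv_apply (𝕜 := ℝ) v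
  funext x
  rw [laplacian_apply, h3, h3, ← (h4 1 x).distrib_add (h4 Complex.I x)]
  congr 1
  funext y
  rw [laplacian_apply]
  rfl

theorem laplacian_comp_const_sub (φ : ℂ → ℝ) (w z : ℂ) :
    Δ (fun y => φ (w - y)) z = Δ φ (w - z) := by
  have h : ∀ {F : Type} [NormedAddCommGroup F] [NormedSpace ℝ F] (g : ℂ → F) (v : ℂ),
      fderiv ℝ (fun y => g (w - y)) v = -fderiv ℝ g (w - v) := fun g v => by
    have := (ContinuousLinearEquiv.neg ℝ (M := ℂ)).comp_right_fderiv (f := fun y => g (w + y))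
      (x := v)
    rw [fderiv_comp_add_left] at this
    ext y
    simpa [Function.comp_def, sub_eq_add_neg] using congrArg (· y) this
  have h' : fderiv ℝ (fun y => φ (w - y)) = fun v => -fderiv ℝ φ (w - v) := funext (h φ)
  rw [laplacian_apply, laplacian_apply, h', fderiv_fun_neg, h]
  simp

/-- **Weyl's lemma**, local form: a weakly harmonic function agrees with a mollification. -/
theorem exists_mollifier_of_weakly_harmonic {d : ℝ} (hd : 0 < d) :
    ∃ η : ℂ → ℝ, ContDiff ℝ (⊤ : ℕ∞) η ∧ HasCompactSupport η ∧
      ∀ (u : ℂ → ℝ) (U V : Set ℂ), LocallyIntegrable u → IsOpen V →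
        (∀ z ∈ V, closedBall z d ⊆ U) →
        (∀ φ : ℂ → ℝ, ContDiff ℝ (⊤ : ℕ∞) φ → HasCompactSupport φ → tsupport φ ⊆ U →
          ∫ z, u z * Δ φ z = 0) →
        ∀ᵐ z, z ∈ V → u z = (u ⋆[ContinuousLinearMap.mul ℝ ℝ] η) z := by
  obtain ⟨κ, η, hκ, hκs, hη, hηc, H⟩ := exists_parametrix hd
  have hηn : ContDiff ℝ (⊤ : ℕ∞) (fun z => -η (-z)) := (hη.comp contDiff_neg).neg
  have hηnc : HasCompactSupport (fun z => -η (-z)) :=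
    (hηc.comp_homeomorph (Homeomorph.neg ℂ)).neg
  refine ⟨fun z => -η (-z), hηn, hηnc, fun u U V hu hV hUV hΔ => ?_⟩
  set v := u ⋆[ContinuousLinearMap.mul ℝ ℝ] (fun z => -η (-z)) with hv
  have hvc : Continuous v := (hηnc.contDiff_convolution_right (n := 0) _ hu
    (hηn.of_le (by simp))).continuous
  have key : ∀ᵐ z, z ∈ V → u z - v z = 0 := by
    refine hV.ae_eq_zero_of_integral_contDiff_smul_eq_zero
      ((hu.sub hvc.locallyIntegrable).locallyIntegrableOn V) fun φ hφ hc hs => ?_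
    have hφ2 := contDiff_two_of_top hφ
    have hκc : HasCompactSupport κ :=
      (isCompact_closedBall 0 d).of_isClosed_subset (isClosed_tsupport _) hκs
    -- The weak equation is tested on κ ⋆ φ. Its Laplacian is φ plus a smooth average of φ, and its
    -- support exceeds that of φ by at most d, so it stays in U.
    set Φ := κ ⋆[ContinuousLinearMap.mul ℝ ℝ] φ with hΦ
    have hΦs : tsupport Φ ⊆ closedBall 0 d + tsupport φ := by
      refine closure_minimal ?_ (((isCompact_closedBall 0 d).add hc).isClosed)
      refine (support_convolution_subset _).trans ?_
      exact add_subset_add (subset_closure.trans hκs) subset_closure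
    have hΦU : tsupport Φ ⊆ U := by
      refine hΦs.trans ?_
      rintro _ ⟨a, ha, b, hb, rfl⟩
      exact hUV b (hs hb) (by simpa using ha)
    have e0 := hΔ Φ (hc.contDiff_convolution_right (n := (⊤ : ℕ∞)) _ hκ hφ)
      (hκc.convolution _ hc) hΦU
    have e1 : ∀ x, Δ Φ x = φ x + ∫ y, η (x - y) * φ y := by
      intro x
      rw [hΦ, laplacian_convolution hκ hφ2 hc]
      have := H (fun t => φ (x - t)) (hφ.comp (contDiff_const.sub contDiff_id))
        (hc.comp_homeomorph (Homeomorph.subLeft x))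
      rw [sub_zero] at this
      rw [convolution_def]
      simp only [laplacian_comp_const_sub] at this
      simp only [ContinuousLinearMap.mul_apply']
      rw [this, ← integral_sub_left_eq_self _ _ x]
      simp
    have hK : IsCompact (tsupport η + tsupport φ) := hηc.isCompact.add hc.isCompact
    -- u is only locally integrable; cutting it off outside the compact set where η(x-y)φ(y) can be
    -- nonzero makes Fubini available.
    have i0 : Integrable ((tsupport η + tsupport φ).indicator u) :=
      (hu.integrableOn_isCompact hK).integrable_indicator hK.measurableSet
    have i1 : Integrable (fun p : ℂ × ℂ => u p.1 * (η (p.1 - p.2) * φ p.2))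
        (volume.prod volume) := by
      have := i0.mul_prod (hφ.continuous.integrable_of_hasCompactSupport (μ := volume) hc)
      obtain ⟨C, hC⟩ := hη.continuous.bounded_above_of_compact_support hηc
      refine (this.bdd_mul (f := fun p : ℂ × ℂ => η (p.1 - p.2))
        (hη.continuous.comp (continuous_fst.sub continuous_snd)).aestronglyMeasurable
        (Eventually.of_forall fun p => hC _)).congr (Eventually.of_forall fun p => ?_)
      simp only
      by_cases hp : η (p.1 - p.2) * φ p.2 = 0
      · rcases mul_eq_zero.1 hp with h | h <;> simp [h]
      · rw [indicator_of_mem]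
        · ring
        · refine ⟨p.1 - p.2, subset_closure (left_ne_zero_of_mul hp), p.2,
            subset_closure (right_ne_zero_of_mul hp), by simp⟩
    have i2 : Integrable (fun x => u x * φ x) :=
      hu.integrable_smul_right_of_hasCompactSupport hφ.continuous hc
    have e2 : ∫ x, u x * ∫ y, η (x - y) * φ y = -∫ y, φ y * v y := by
      simp only [← integral_const_mul]
      rw [integral_integral_swap i1, ← integral_neg]
      congr 1
      funext y
      rw [hv, convolution_def, ← integral_const_mul, ← integral_neg]
      congr 1
      funext x
      simp
      ring
    have i3 : Integrable (fun x => u x * ∫ y, η (x - y) * φ y) := by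
      simpa only [integral_const_mul] using i1.integral_prod_left
    simp only [e1, mul_add] at e0
    rw [integral_add i2 i3, e2] at e0
    simp only [smul_eq_mul, mul_sub]
    rw [integral_sub]
    · rw [← sub_eq_add_neg] at e0
      simpa only [mul_comm] using e0
    · simpa only [mul_comm] using i2
    · exact (hφ.continuous.mul hvc).integrable_of_hasCompactSupport hc.mul_right
  filter_upwards [key] with z hz h
  linarith [hz h]

theorem exists_continuous_of_weakly_harmonic {u : ℂ → ℝ} {U : Set ℂ} {c : ℂ} {R d : ℝ}
    (hd : 0 < d) (hU : ball c (R + 2 * d) ⊆ U) (hu : LocallyIntegrable u)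
    (hΔ : ∀ φ : ℂ → ℝ, ContDiff ℝ (⊤ : ℕ∞) φ → HasCompactSupport φ → tsupport φ ⊆ U →
      ∫ z, u z * Δ φ z = 0) :
    ∃ v : ℂ → ℝ, Continuous v ∧ ∀ᵐ z, z ∈ ball c R → u z = v z := by
  obtain ⟨η, hη, hηc, H⟩ := exists_mollifier_of_weakly_harmonic hd
  refine ⟨_, (hηc.contDiff_convolution_right (n := 0) _ hu (hη.of_le (by simp))).continuous,
    H u U (ball c R) hu isOpen_ball (fun z hz y hy => hU ?_) hΔ⟩
  rw [mem_ball, mem_closedBall] at *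
  linarith [dist_triangle y z c]

/-- **Weyl's lemma** on the whole plane. -/
theorem exists_entire_of_weakly_harmonic {u : ℂ → ℝ} (hu : LocallyIntegrable u)
    (hΔ : ∀ φ : ℂ → ℝ, ContDiff ℝ (⊤ : ℕ∞) φ → HasCompactSupport φ → ∫ z, u z * Δ φ z = 0) :
    ∃ F : ℂ → ℂ, Differentiable ℂ F ∧ ∀ᵐ z, u z = (F z).re := by
  obtain ⟨η, hη, hηc, H⟩ := exists_mollifier_of_weakly_harmonic one_pos
  have e := H u univ univ hu isOpen_univ (fun z _ => subset_univ _) (fun φ h1 h2 _ => hΔ φ h1 h2)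
  set v := u ⋆[ContinuousLinearMap.mul ℝ ℝ] η with hv
  have hv2 : ContDiff ℝ 2 v :=
    contDiff_two_of_top (hηc.contDiff_convolution_right (n := (⊤ : ℕ∞)) _ hu hη)
  -- The mollification v is smooth and equals u almost everywhere, so the weak equation passes to v
  -- and becomes a classical one.
  have h0 : ∀ᵐ z, Δ v z = 0 := by
    refine ae_eq_zero_of_integral_contDiff_smul_eq_zero
      (continuous_laplacian hv2).locallyIntegrable fun φ hφ hc => ?_
    have h1 := hΔ φ hφ hc
    have h2 : ∫ z, v z * Δ φ z = ∫ z, u z * Δ φ z := by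
      refine integral_congr_ae ?_
      filter_upwards [e] with z hz
      rw [hz (mem_univ z)]
    rw [← h1, ← h2, integral_mul_laplacian hv2 (contDiff_two_of_top hφ) hc]
    simp only [smul_eq_mul, mul_comm]
  have h1 : Δ v = 0 := (continuous_laplacian hv2).ae_eq_iff_eq volume continuous_zero |>.1 h0
  obtain ⟨F, hF, hFv⟩ := InnerProductSpace.HarmonicOnNhd.exists_analyticOnNhd_univ_re_eq
    (f := v) (fun z _ => ⟨hv2.contDiffAt, Eventually.of_forall fun y => congrFun h1 y⟩)
  refine ⟨F, fun z => (hF z (mem_univ z)).differentiableAt, ?_⟩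
  filter_upwards [e] with z hz
  rw [hz (mem_univ z), ← hFv]

end PauliZeroModes
namespace PauliZeroModes
open Filter Topology Set Metric Laplacian

/-! ### Logarithmic potentials of locally finite measures -/

/-- The logarithmic kernel of genus two; the correction is only made for `‖w‖ ≥ r₁`. -/
noncomputable def kernel (r₁ : ℝ) (z w : ℂ) : ℝ :=
  if ‖w‖ < r₁ then Real.log ‖z - w‖
  else Real.log ‖z - w‖ - Real.log ‖w‖ + (z / w).re + (z ^ 2 * (w ^ 2)⁻¹).re / 2

/-- The logarithmic potential of a measure. -/
noncomputable def potential (r₁ : ℝ) (ν : Measure ℂ) (z : ℂ) : ℝ :=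
  (2 * Real.pi)⁻¹ * ∫ w, kernel r₁ z w ∂ν

theorem measurable_kernel (r₁ : ℝ) : Measurable fun p : ℂ × ℂ => kernel r₁ p.1 p.2 := by
  unfold kernel
  refine Measurable.ite (measurableSet_lt (by fun_prop) measurable_const) ?_ ?_
  · exact Real.measurable_log.comp (by fun_prop)
  · have h1 : Measurable fun p : ℂ × ℂ => Real.log ‖p.1 - p.2‖ :=
      Real.measurable_log.comp (by fun_prop)
    have h2 : Measurable fun p : ℂ × ℂ => Real.log ‖p.2‖ :=
      Real.measurable_log.comp (by fun_prop)
    have h3 : Measurable fun p : ℂ × ℂ => (p.1 / p.2).re :=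
      Complex.measurable_re.comp (measurable_fst.div measurable_snd)
    have h4 : Measurable fun p : ℂ × ℂ => (p.1 ^ 2 * (p.2 ^ 2)⁻¹).re :=
      Complex.measurable_re.comp ((measurable_fst.pow_const 2).mul (measurable_snd.pow_const 2).inv)
    exact ((h1.sub h2).add h3).add (h4.div_const 2)

/-- In either branch the kernel differs from log|z-w| by the real part of a polynomial in z, which
is harmonic. -/
theorem integral_kernel_mul_laplacian (r₁ : ℝ) {φ : ℂ → ℝ} (hφ : ContDiff ℝ 2 φ)
    (hc : HasCompactSupport φ) (w : ℂ) :
    ∫ z, kernel r₁ z w * Δ φ z = 2 * Real.pi * φ w := by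
  obtain ⟨g, hg, h⟩ : ∃ g : ℂ → ℂ, Differentiable ℂ g ∧
      ∀ z, kernel r₁ z w = Real.log ‖z - w‖ + (g z).re := by
    unfold kernel
    split_ifs
    · exact ⟨fun _ => 0, differentiable_const _, fun z => by simp⟩
    · refine ⟨fun z => -(Real.log ‖w‖ : ℂ) + z / w + z ^ 2 * (w ^ 2)⁻¹ / 2, by fun_prop,
        fun z => ?_⟩
      simp only [Complex.add_re, Complex.neg_re, Complex.ofReal_re]
      rw [Complex.div_ofNat_re]
      ring
  have hg2 : ContDiff ℝ 2 fun z => (g z).re :=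
    Complex.reCLM.contDiff.comp (hg.contDiff.restrict_scalars ℝ)
  have hΔ : ∀ z, Δ (fun z => (g z).re) z = 0 := fun z =>
    ((hg.analyticAt z).harmonicAt_re).2.self_of_nhds
  have hs := hasCompactSupport_laplacian hc
  have hk := continuous_laplacian hφ
  simp only [h, add_mul]
  rw [integral_add, integral_log_norm_sub_mul_laplacian hφ hc,
    integral_mul_laplacian hg2 hφ hc]
  · simp [hΔ]
  · exact (locallyIntegrable_log_norm_sub w).integrable_smul_right_of_hasCompactSupport hk hs
  · exact (hg2.continuous.mul hk).integrable_of_hasCompactSupport hs.mul_left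

/-- The expression is the real part of log(1 - z/w) minus its second Taylor polynomial, so the cubic
remainder estimate applies; |z/w| ≤ 1/2 keeps the factor (1 - |z/w|)⁻¹ below 2. -/
theorem abs_genus_two_le {z w : ℂ} (hw : w ≠ 0) (h : 2 * ‖z‖ ≤ ‖w‖) :
    |Real.log ‖z - w‖ - Real.log ‖w‖ + (z / w).re + (z ^ 2 * (w ^ 2)⁻¹).re / 2| ≤
      (‖z‖ / ‖w‖) ^ 3 := by
  have hw' : 0 < ‖w‖ := norm_pos_iff.2 hw
  have hn : ‖-(z / w)‖ = ‖z‖ / ‖w‖ := by rw [norm_neg, norm_div]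
  have hle : ‖z‖ / ‖w‖ ≤ 1 / 2 := by rw [div_le_iff₀ hw']; linarith
  have h1 := Complex.norm_log_sub_logTaylor_le 2 (z := -(z / w)) (by rw [hn]; linarith)
  have h2 : 1 + -(z / w) = (w - z) / w := by field_simp; ring
  have hzw : z ≠ w := by
    rintro rfl
    linarith
  have h3 : (Complex.log (1 + -(z / w)) - Complex.logTaylor (2 + 1) (-(z / w))).re =
      Real.log ‖z - w‖ - Real.log ‖w‖ + (z / w).re + (z ^ 2 * (w ^ 2)⁻¹).re / 2 := by
    rw [Complex.sub_re, Complex.log_re, h2, norm_div, norm_sub_rev,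
      Real.log_div (norm_ne_zero_iff.2 (sub_ne_zero.2 hzw)) hw'.ne']
    have : Complex.logTaylor (2 + 1) (-(z / w)) = -(z / w) - (z ^ 2 * (w ^ 2)⁻¹) / 2 := by
      simp [Complex.logTaylor, Finset.sum_range_succ]
      field_simp
      ring
    rw [this, Complex.sub_re, Complex.neg_re, Complex.div_ofNat_re]
    ring
  rw [← h3]
  refine (Complex.abs_re_le_norm _).trans (h1.trans ?_)
  rw [hn]
  have h4 : (1 - ‖z‖ / ‖w‖)⁻¹ ≤ 2 := by
    rw [inv_le_comm₀ (by linarith) two_pos]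
    linarith
  have h5 : 0 ≤ (‖z‖ / ‖w‖) ^ 3 := by positivity
  rw [div_le_iff₀ (by norm_num)]
  push_cast
  nlinarith

/-- For w in the ball of radius M, translation carries the integral over the ball of radius N into
that of f over the ball of radius N + M, uniformly in w. -/
theorem integrable_comp_sub_prod {f : ℂ → ℝ} (hf : Measurable f)
    (hint : ∀ R, IntegrableOn f (ball 0 R)) (ν : Measure ℂ) [IsLocallyFiniteMeasure ν] (N M : ℝ) :
    Integrable (fun p : ℂ × ℂ => f (p.1 - p.2))
      ((volume.restrict (ball 0 N)).prod (ν.restrict (ball 0 M))) := by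
  have hfin : IsFiniteMeasure (ν.restrict (ball 0 M)) :=
    isFiniteMeasure_restrict.2 (measure_ball_lt_top).ne
  have hm : AEStronglyMeasurable (fun p : ℂ × ℂ => f (p.1 - p.2))
      ((volume.restrict (ball 0 N)).prod (ν.restrict (ball 0 M))) :=
    (hf.comp (by fun_prop)).aestronglyMeasurable
  rw [integrable_prod_iff' hm]
  have hsub : ∀ w ∈ ball (0 : ℂ) M, ball 0 N ⊆ ball w (N + M) := fun w hw z hz => by
    rw [mem_ball] at *
    linarith [dist_triangle_right z w 0]
  have hint : ∀ w, IntegrableOn (fun z : ℂ => f (z - w)) (ball w (N + M)) := fun w =>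
    (integrableOn_ball_comp_sub w _).2 (hint _)
  constructor
  · filter_upwards [ae_restrict_mem measurableSet_ball] with w hw
    exact (hint w).mono_set (hsub w hw)
  · refine Integrable.of_bound (C := ∫ z in ball (0 : ℂ) (N + M), ‖f z‖)
      hm.norm.prod_swap.integral_prod_right' ?_
    filter_upwards [ae_restrict_mem measurableSet_ball] with w hw
    rw [Real.norm_of_nonneg (integral_nonneg fun _ => norm_nonneg _)]
    have e := (measurePreserving_sub_right (volume : Measure ℂ) w).setIntegral_preimage_emb
      (measurableEmbedding_subRight w) (fun z => ‖f z‖) (ball 0 (N + M))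
    have e' : (fun x => x - w) ⁻¹' ball 0 (N + M) = ball w (N + M) := by
      ext z
      simp [dist_eq_norm]
    rw [← e, e']
    exact setIntegral_mono_set (hint w).norm (Eventually.of_forall fun _ => norm_nonneg _)
      (hsub w hw).eventuallyLE

/-- A majorant that makes Fubini applicable: its first term has a logarithmic singularity and
bounded support, its second is cubic decay independent of z. -/
theorem abs_kernel_le {r₁ N : ℝ} (hr : 0 < r₁) (hN : 0 < N) {z w : ℂ} (hz : ‖z‖ < N) :
    |kernel r₁ z w| ≤ (ball 0 (r₁ + 2 * N)).indicator (fun w => |Real.log ‖z - w‖| +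
      (|Real.log r₁| + |Real.log (r₁ + 2 * N)| + N / r₁ + N ^ 2 / r₁ ^ 2)) w +
      {w : ℂ | r₁ ≤ ‖w‖}.indicator (fun w => N ^ 3 * (‖w‖ ^ 3)⁻¹) w := by
  have hi : 0 ≤ {w : ℂ | r₁ ≤ ‖w‖}.indicator (fun w => N ^ 3 * (‖w‖ ^ 3)⁻¹) w :=
    indicator_nonneg (fun _ _ => by positivity) _
  by_cases hw : w ∈ ball (0 : ℂ) (r₁ + 2 * N)
  · rw [indicator_of_mem hw]
    refine le_trans ?_ (le_add_of_nonneg_right hi)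
    rw [mem_ball_zero_iff] at hw
    unfold kernel
    split_ifs with h
    · refine le_add_of_nonneg_right (by positivity)
    · rw [not_lt] at h
      have hw0 : 0 < ‖w‖ := hr.trans_le h
      have h1 : |Real.log ‖w‖| ≤ |Real.log r₁| + |Real.log (r₁ + 2 * N)| := by
        have a := Real.log_le_log hr h
        have b := Real.log_le_log hw0 hw.le
        rw [abs_le]
        constructor <;> linarith [neg_abs_le (Real.log r₁), le_abs_self (Real.log (r₁ + 2 * N)),
          abs_nonneg (Real.log r₁), abs_nonneg (Real.log (r₁ + 2 * N))]
      have h2 : |(z / w).re| ≤ N / r₁ := by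
        refine (Complex.abs_re_le_norm _).trans ?_
        rw [norm_div]
        gcongr
      have h3 : |(z ^ 2 * (w ^ 2)⁻¹).re / 2| ≤ N ^ 2 / r₁ ^ 2 := by
        rw [abs_div, abs_two]
        refine (half_le_self (abs_nonneg _)).trans ((Complex.abs_re_le_norm _).trans ?_)
        rw [norm_mul, norm_inv, norm_pow, norm_pow, ← div_eq_mul_inv]
        gcongr
      have := abs_add_le (Real.log ‖z - w‖ - Real.log ‖w‖ + (z / w).re)
        ((z ^ 2 * (w ^ 2)⁻¹).re / 2)
      have := abs_add_le (Real.log ‖z - w‖ - Real.log ‖w‖) (z / w).re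
      have := abs_sub (Real.log ‖z - w‖) (Real.log ‖w‖)
      linarith
  · rw [indicator_of_notMem hw, zero_add]
    rw [mem_ball_zero_iff, not_lt] at hw
    have hrw : r₁ ≤ ‖w‖ := by linarith
    have hw0 : 0 < ‖w‖ := hr.trans_le hrw
    rw [indicator_of_mem (show w ∈ {w : ℂ | r₁ ≤ ‖w‖} from hrw), kernel, if_neg (not_lt.2 hrw)]
    refine (abs_genus_two_le (norm_pos_iff.1 hw0) (by linarith)).trans ?_
    rw [div_pow, ← div_eq_mul_inv]
    gcongr

theorem integrable_kernel_prod {r₁ : ℝ} (hr : 0 < r₁) {ν : Measure ℂ} [IsLocallyFiniteMeasure ν]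
    (hν : IntegrableOn (fun w : ℂ => (‖w‖ ^ 3)⁻¹) {w | r₁ ≤ ‖w‖} ν) {N : ℝ} (hN : 0 < N) :
    Integrable (fun p : ℂ × ℂ => kernel r₁ p.1 p.2) ((volume.restrict (ball 0 N)).prod ν) := by
  set c := |Real.log r₁| + |Real.log (r₁ + 2 * N)| + N / r₁ + N ^ 2 / r₁ ^ 2
  have hfin : IsFiniteMeasure (ν.restrict (ball 0 (r₁ + 2 * N))) :=
    isFiniteMeasure_restrict.2 (measure_ball_lt_top).ne
  have hfin' : IsFiniteMeasure ((volume : Measure ℂ).restrict (ball 0 N)) :=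
    isFiniteMeasure_restrict.2 (measure_ball_lt_top).ne
  have hm : MeasurableSet {w : ℂ | r₁ ≤ ‖w‖} := measurableSet_le measurable_const measurable_norm
  have h1 : Integrable (fun p : ℂ × ℂ => (ball (0 : ℂ) (r₁ + 2 * N)).indicator
      (fun w => |Real.log ‖p.1 - w‖| + c) p.2) ((volume.restrict (ball 0 N)).prod ν) := by
    have := ((integrable_comp_sub_prod (Real.measurable_log.comp measurable_norm)
      integrableOn_log_norm ν N (r₁ + 2 * N)).norm.add (integrable_const c))
    have e : (volume.restrict (ball (0 : ℂ) N)).prod (ν.restrict (ball 0 (r₁ + 2 * N))) =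
        ((volume.restrict (ball 0 N)).prod ν).restrict (univ ×ˢ ball 0 (r₁ + 2 * N)) := by
      rw [← Measure.prod_restrict, Measure.restrict_univ]
    rw [e] at this
    exact (integrable_indicator_iff (MeasurableSet.univ.prod measurableSet_ball)).2 this |>.congr
      (Eventually.of_forall fun p => by
        dsimp only
        by_cases hp : p.2 ∈ ball (0 : ℂ) (r₁ + 2 * N)
        · rw [indicator_of_mem hp, indicator_of_mem (by simpa using hp)]
          rfl
        · rw [indicator_of_notMem hp, indicator_of_notMem (by simpa using hp)])
  have h2 : Integrable (fun p : ℂ × ℂ => {w : ℂ | r₁ ≤ ‖w‖}.indicator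
      (fun w => N ^ 3 * (‖w‖ ^ 3)⁻¹) p.2) ((volume.restrict (ball 0 N)).prod ν) := by
    have := (integrable_const (μ := (volume : Measure ℂ).restrict (ball 0 N)) (1 : ℝ)).mul_prod
      ((integrable_indicator_iff hm).2 (hν.const_mul (N ^ 3)))
    simpa using this
  refine (h1.add h2).mono' (measurable_kernel r₁).aestronglyMeasurable ?_
  have e : ∀ᵐ p ∂((volume.restrict (ball 0 N)).prod ν), p.1 ∈ ball (0 : ℂ) N :=
    Measure.quasiMeasurePreserving_fst.ae (ae_restrict_mem measurableSet_ball)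
  filter_upwards [e] with p hp
  exact abs_kernel_le hr hN (by simpa using hp)

theorem ae_integrable_kernel {r₁ : ℝ} (hr : 0 < r₁) {ν : Measure ℂ} [IsLocallyFiniteMeasure ν]
    (hν : IntegrableOn (fun w : ℂ => (‖w‖ ^ 3)⁻¹) {w | r₁ ≤ ‖w‖} ν) :
    ∀ᵐ z, Integrable (kernel r₁ z) ν := by
  have h : ∀ n : ℕ, ∀ᵐ z, z ∈ ball (0 : ℂ) (n + 1) → Integrable (kernel r₁ z) ν := fun n =>
    (ae_restrict_iff' measurableSet_ball).1
      (integrable_kernel_prod hr hν (N := n + 1) (by positivity)).prod_right_ae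
  filter_upwards [ae_all_iff.2 h] with z hz
  obtain ⟨n, hn⟩ := exists_nat_gt ‖z‖
  exact hz n (by simpa using by linarith)

theorem locallyIntegrable_potential {r₁ : ℝ} (hr : 0 < r₁) {ν : Measure ℂ}
    [IsLocallyFiniteMeasure ν]
    (hν : IntegrableOn (fun w : ℂ => (‖w‖ ^ 3)⁻¹) {w | r₁ ≤ ‖w‖} ν) :
    LocallyIntegrable (potential r₁ ν) := fun z =>
  ⟨ball 0 (‖z‖ + 1), isOpen_ball.mem_nhds (by simp),
    ((integrable_kernel_prod hr hν (by positivity)).integral_prod_left).const_mul _⟩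

/-- The distributional Laplacian of the logarithmic potential of `ν` is `ν`. -/
theorem integral_potential_mul_laplacian {r₁ : ℝ} (hr : 0 < r₁) {ν : Measure ℂ}
    [IsLocallyFiniteMeasure ν]
    (hν : IntegrableOn (fun w : ℂ => (‖w‖ ^ 3)⁻¹) {w | r₁ ≤ ‖w‖} ν) {φ : ℂ → ℝ}
    (hφ : ContDiff ℝ 2 φ) (hc : HasCompactSupport φ) :
    ∫ z, potential r₁ ν z * Δ φ z = ∫ z, φ z ∂ν := by
  have hs := hasCompactSupport_laplacian hc
  have hk := continuous_laplacian hφ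
  obtain ⟨R, hR, hsub⟩ := hs.isCompact.isBounded.subset_ball_lt 0 (0 : ℂ)
  have hz : ∀ (f : ℂ → ℝ), ∫ z, f z * Δ φ z = ∫ z in ball 0 R, f z * Δ φ z := fun f => by
    rw [setIntegral_eq_integral_of_forall_compl_eq_zero]
    intro z hz
    rw [image_eq_zero_of_notMem_tsupport fun h => hz (hsub h), mul_zero]
  obtain ⟨C, hC⟩ := hk.bounded_above_of_compact_support hs
  have hi : Integrable (fun p : ℂ × ℂ => kernel r₁ p.1 p.2 * Δ φ p.1)
      ((volume.restrict (ball 0 R)).prod ν) :=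
    (integrable_kernel_prod hr hν hR).mul_bdd (hk.comp continuous_fst).aestronglyMeasurable
      (Eventually.of_forall fun p => hC p.1)
  have hp := Real.pi_pos
  have e : ∫ z in ball 0 R, (∫ w, kernel r₁ z w ∂ν) * Δ φ z = 2 * Real.pi * ∫ w, φ w ∂ν := by
    simp only [← integral_mul_const]
    rw [integral_integral_swap hi, ← integral_const_mul]
    congr 1
    funext w
    rw [← hz, integral_kernel_mul_laplacian r₁ hφ hc]
  rw [hz]
  simp only [potential, mul_assoc]
  rw [integral_const_mul, e]
  field_simp

end PauliZeroModes
namespace PauliZeroModes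
open Filter Topology Set Metric Laplacian

/-! ### Local integrability of `exp (-2Ψ)` -/

theorem integrableOn_exp_neg_mul_log {s : ℝ} (hs : s < 2) (R : ℝ) :
    IntegrableOn (fun z : ℂ => Real.exp (-s * Real.log ‖z‖)) (ball 0 R) := by
  have h : IntegrableOn (fun z : ℂ => ‖z‖ ^ (-s) + 1) (ball 0 R) :=
    (integrableOn_norm_rpow hs R).add (integrableOn_const measure_ball_lt_top.ne)
  refine h.mono' (Real.measurable_exp.comp ((Real.measurable_log.comp
    measurable_norm).const_mul _)).aestronglyMeasurable (Eventually.of_forall fun z => ?_)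
  rw [Real.norm_of_nonneg (Real.exp_pos _).le]
  rcases eq_or_ne z 0 with rfl | hz
  · simp [Real.rpow_nonneg]
  · rw [Real.rpow_def_of_pos (norm_pos_iff.2 hz), mul_comm]
    linarith

/-- With m the total mass, Jensen's inequality bounds e^{-2 potential} by the average over w of
|z-w|^{-m/π}, and m/π < 2. The condition on r₁ keeps the measure in |w| < r₁, where the kernel is
the plain logarithm. -/
theorem integrableOn_exp_neg_potential {z₀ : ℂ} {t : ℝ} {P : Measure ℂ} [IsLocallyFiniteMeasure P]
    (hP : P.real (ball z₀ t) < 2 * Real.pi) {r₁ : ℝ} (hr : ‖z₀‖ + t ≤ r₁) :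
    IntegrableOn (fun z => Real.exp (-2 * potential r₁ (P.restrict (ball z₀ t)) z))
      (ball 0 r₁) := by
  have hsub : ball z₀ t ⊆ ball 0 r₁ := fun w hw => by
    rw [mem_ball] at *
    have := dist_triangle w z₀ 0
    rw [dist_zero_right z₀] at this
    linarith
  set P' := P.restrict (ball z₀ t) with hP'
  have hfin : IsFiniteMeasure P' := isFiniteMeasure_restrict.2 (measure_ball_lt_top).ne
  have hk : ∀ z, ∫ w, kernel r₁ z w ∂P' = ∫ w, Real.log ‖z - w‖ ∂P' := fun z => by
    refine setIntegral_congr_fun measurableSet_ball fun w hw => ?_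
    have := hsub hw
    rw [mem_ball_zero_iff] at this
    simp [kernel, this]
  set m := P'.real univ with hm
  have hm' : m = P.real (ball z₀ t) := by simp [hm, hP', measureReal_def]
  have hpi := Real.pi_pos
  have hs : m / Real.pi < 2 := by
    rw [div_lt_iff₀ hpi]
    linarith
  rcases eq_or_ne P' 0 with h0 | h0
  · simp only [potential, h0, integral_zero_measure, mul_zero, Real.exp_zero]
    exact integrableOn_const measure_ball_lt_top.ne
  have : NeZero P' := ⟨h0⟩
  have hm0 : 0 < m := by
    rw [hm, measureReal_def]
    exact ENNReal.toReal_pos (by simpa using h0) (measure_ne_top _ _)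
  have hres : P'.restrict (ball 0 r₁) = P' := by
    rw [hP', Measure.restrict_restrict measurableSet_ball, inter_eq_right.2 hsub]
  have i1 := integrable_comp_sub_prod (Real.measurable_log.comp measurable_norm)
    integrableOn_log_norm P' r₁ r₁
  have i2 := integrable_comp_sub_prod (f := fun z : ℂ => Real.exp (-(m / Real.pi) * Real.log ‖z‖))
    (Real.measurable_exp.comp ((Real.measurable_log.comp measurable_norm).const_mul _))
    (integrableOn_exp_neg_mul_log hs) P' r₁ r₁
  rw [hres] at i1 i2
  refine (i2.integral_prod_left.const_mul m⁻¹).mono' ?_ ?_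
  · have : AEStronglyMeasurable (fun z => ∫ w, kernel r₁ z w ∂P')
      (volume.restrict (ball (0 : ℂ) r₁)) :=
      ((measurable_kernel r₁).aestronglyMeasurable (μ := (volume.restrict (ball (0 : ℂ) r₁)).prod
        P')).integral_prod_right'
    exact Real.continuous_exp.comp_aestronglyMeasurable ((this.const_mul _).const_mul _)
  filter_upwards [i1.prod_right_ae, i2.prod_right_ae] with z h1 h2
  rw [Real.norm_of_nonneg (Real.exp_pos _).le]
  have hj := convexOn_exp.map_average_le (μ := P')
    (f := fun w => -(m / Real.pi) * Real.log ‖z - w‖) Real.continuous_exp.continuousOn isClosed_univ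
    (by simp) (h1.const_mul _) h2
  rw [average_eq, average_eq, smul_eq_mul, smul_eq_mul, integral_const_mul] at hj
  refine le_trans (le_of_eq ?_) hj
  rw [potential, hk]
  congr 1
  rw [← hm]
  field_simp

theorem potential_restrict_nonpos {z₀ z : ℂ} {t : ℝ} (P : Measure ℂ) {r₁ : ℝ}
    (hr : ‖z₀‖ + t ≤ r₁) (ht : 2 * t ≤ 1) (hz : z ∈ ball z₀ t) :
    potential r₁ (P.restrict (ball z₀ t)) z ≤ 0 := by
  refine mul_nonpos_of_nonneg_of_nonpos (by have := Real.pi_pos; positivity) ?_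
  refine setIntegral_nonpos measurableSet_ball fun w hw => ?_
  rw [mem_ball] at hw hz
  have h1 : ‖w‖ < r₁ := by
    have := dist_triangle w z₀ 0
    rw [dist_zero_right, dist_zero_right] at this
    linarith
  rw [kernel, if_pos h1]
  refine Real.log_nonpos (norm_nonneg _) ?_
  have := dist_triangle_right z w z₀
  rw [dist_eq_norm z w] at this
  linarith

theorem integrableOn_inv_cube_of_restrict {z₀ : ℂ} {t r₁ : ℝ} (P : Measure ℂ)
    (hr : ‖z₀‖ + t ≤ r₁) :
    IntegrableOn (fun w : ℂ => (‖w‖ ^ 3)⁻¹) {w | r₁ ≤ ‖w‖} (P.restrict (ball z₀ t)) := by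
  have : (P.restrict (ball z₀ t)).restrict {w | r₁ ≤ ‖w‖} = 0 := by
    rw [Measure.restrict_restrict (measurableSet_le measurable_const measurable_norm)]
    have : {w : ℂ | r₁ ≤ ‖w‖} ∩ ball z₀ t = ∅ := by
      ext w
      simp only [mem_inter_iff, mem_ball, mem_empty_iff_false, iff_false, not_and, not_lt]
      intro h
      have := dist_triangle w z₀ 0
      rw [dist_zero_right, dist_zero_right] at this
      have h' : r₁ ≤ ‖w‖ := h
      linarith
    rw [this, Measure.restrict_empty]
  rw [IntegrableOn, this]
  exact integrable_zero_measure

theorem setIntegral_of_tsupport_subset {P : Measure ℂ} {φ : ℂ → ℝ} {U : Set ℂ}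
    (h : tsupport φ ⊆ U) : ∫ z in U, φ z ∂P = ∫ z, φ z ∂P :=
  setIntegral_eq_integral_of_forall_compl_eq_zero fun _ hz =>
    image_eq_zero_of_notMem_tsupport fun h' => hz (h h')

/-- Some disc about z₀ has positive mass below 2π. There Ψ is the potential of the restricted field
plus a weakly harmonic function, which is bounded nearer to z₀ by Weyl's lemma. The potential of the
negative part is nonpositive on a small disc and enters Ψ with a minus sign, so it only decreases
e^{-2Ψ}; the positive part is handled by Jensen's inequality. -/
theorem SignedField.IsPotential.locallyIntegrable_exp {μ : SignedField} {Ψ : ℂ → ℝ}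
    (hΨ : μ.IsPotential Ψ) (hμ : ∀ z, μ.pos.real {z} < 2 * Real.pi) :
    LocallyIntegrable fun z => Real.exp (-2 * Ψ z) := by
  intro z₀
  obtain ⟨U, hzU, hU, hPU⟩ := Set.exists_isOpen_lt_of_lt (μ := μ.pos) {z₀}
    (ENNReal.ofReal (2 * Real.pi)) (by
      rw [← ENNReal.ofReal_toReal (measure_singleton_lt_top (μ := μ.pos) (a := z₀)).ne]
      exact (ENNReal.ofReal_lt_ofReal_iff (by positivity)).2 (hμ z₀))
  obtain ⟨t₀, ht₀, hball⟩ := Metric.isOpen_iff.1 hU z₀ (hzU rfl)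
  set t := min t₀ (1 / 4) with htdef
  have ht : 0 < t := by positivity
  have ht1 : 2 * t ≤ 1 := by linarith [min_le_right t₀ (1 / 4)]
  have hPt : μ.pos.real (ball z₀ t) < 2 * Real.pi := by
    rw [measureReal_def]
    refine ENNReal.toReal_lt_of_lt_ofReal ((measure_mono ?_).trans_lt hPU)
    exact (ball_subset_ball (min_le_left _ _)).trans hball
  set r₁ := ‖z₀‖ + t with hr₁
  have hr : 0 < r₁ := by positivity
  have cP := integrableOn_inv_cube_of_restrict μ.pos hr₁.ge
  have cN := integrableOn_inv_cube_of_restrict μ.neg hr₁.ge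
  have lP := locallyIntegrable_potential hr cP
  have lN := locallyIntegrable_potential hr cN
  obtain ⟨v, hv, hveq⟩ := exists_continuous_of_weakly_harmonic (c := z₀) (R := t / 2) (d := t / 4)
    (u := fun z => Ψ z - (potential r₁ (μ.pos.restrict (ball z₀ t)) z -
      potential r₁ (μ.neg.restrict (ball z₀ t)) z)) (U := ball z₀ t) (by positivity)
    (ball_subset_ball (by linarith)) (hΨ.1.sub (lP.sub lN)) (by
      intro φ hφ hc hs
      have hk := continuous_laplacian (contDiff_two_of_top hφ)
      have hks := hasCompactSupport_laplacian hc
      simp only [sub_mul]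
      have iP := lP.integrable_smul_right_of_hasCompactSupport hk hks
      have iN := lN.integrable_smul_right_of_hasCompactSupport hk hks
      have iΨ := hΨ.1.integrable_smul_right_of_hasCompactSupport hk hks
      simp only [smul_eq_mul] at iP iN iΨ
      have e := integral_sub iΨ (iP.sub iN)
      simp only [Pi.sub_apply] at e
      rw [e, integral_sub iP iN,
        integral_potential_mul_laplacian hr cP (contDiff_two_of_top hφ) hc,
        integral_potential_mul_laplacian hr cN (contDiff_two_of_top hφ) hc,
        setIntegral_of_tsupport_subset hs, setIntegral_of_tsupport_subset hs, hΨ.2 φ hφ hc,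
        sub_self])
  obtain ⟨C, hC⟩ := (isCompact_closedBall z₀ (t / 2)).exists_bound_of_continuousOn hv.continuousOn
  refine ⟨ball z₀ (t / 2), ball_mem_nhds _ (by positivity), ?_⟩
  have hsub : ball z₀ (t / 2) ⊆ ball 0 r₁ := fun w hw => by
    rw [mem_ball] at *
    have := dist_triangle w z₀ 0
    rw [dist_zero_right z₀] at this
    linarith
  have hI := ((integrableOn_exp_neg_potential hPt hr₁.ge).mono_set hsub).const_mul
    (Real.exp (2 * C))
  refine hI.mono' ?_ ?_
  · exact Real.continuous_exp.comp_aestronglyMeasurable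
      (hΨ.1.aestronglyMeasurable.restrict.const_mul _)
  rw [ae_restrict_iff' measurableSet_ball]
  filter_upwards [hveq] with z hz hzm
  have h1 := hz hzm
  have h2 := potential_restrict_nonpos μ.neg hr₁.ge ht1 (ball_subset_ball (by linarith) hzm)
  have h3 := hC z (ball_subset_closedBall hzm)
  rw [Real.norm_eq_abs, abs_le] at h3
  rw [Real.norm_of_nonneg (Real.exp_pos _).le, ← Real.exp_add]
  refine Real.exp_le_exp.2 ?_
  linarith

end PauliZeroModes
namespace PauliZeroModes
open Filter Topology Set Metric

/-! ### Measures of quadratic growth -/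

/-- The device behind the dyadic estimates: a layered bound on f costs one weighted ball mass per
layer. -/
theorem setLIntegral_le_sum_ball {ν : Measure ℂ} {c : ℂ} {S : Set ℂ} {ι : Type*} [Countable ι]
    (f : ℂ → ENNReal) (k : ι → ENNReal) (t : ι → ℝ)
    (h : ∀ w ∈ S, ∃ i, w ∈ ball c (t i) ∧ f w ≤ k i) (hS : MeasurableSet S) :
    ∫⁻ w in S, f w ∂ν ≤ ∑' i, k i * ν (ball c (t i)) := by
  calc ∫⁻ w in S, f w ∂ν ≤ ∫⁻ w in S, ∑' i, (ball c (t i)).indicator (fun _ => k i) w ∂ν := by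
        refine setLIntegral_mono' hS fun w hw => ?_
        obtain ⟨i, hi, hle⟩ := h w hw
        refine le_trans ?_ (ENNReal.le_tsum i)
        rwa [indicator_of_mem hi]
    _ ≤ ∫⁻ w, ∑' i, (ball c (t i)).indicator (fun _ => k i) w ∂ν := setLIntegral_le_lintegral _ _
    _ = ∑' i, k i * ν (ball c (t i)) := by
        rw [lintegral_tsum fun i => (measurable_const.indicator measurableSet_ball).aemeasurable]
        congr 1
        funext i
        rw [lintegral_indicator_const measurableSet_ball]

/-- On the dyadic shell |w-c| ~ σ2⁻ᵏ the integrand is about 2ᵏ. Against the mass a(σ2⁻ᵏ)² the sum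
converges geometrically; against the mass b it grows, but stops once 2ᵏ reaches σ/δ, whence the term
bσ/δ. -/
theorem lintegral_inv_dist_le {ν : Measure ℂ} {c : ℂ} {a b : ℝ} (ha : 0 ≤ a) (hb : 0 ≤ b)
    (hν : ∀ s, 0 < s → ν (ball c s) ≤ ENNReal.ofReal (a * s ^ 2 + b)) {δ σ : ℝ} (hδ : 0 < δ)
    (hσ : 0 < σ) :
    ∫⁻ w in {w | δ ≤ ‖w - c‖ ∧ ‖w - c‖ ≤ σ}, ENNReal.ofReal (σ / ‖w - c‖) ∂ν ≤
      ENNReal.ofReal (16 * (a * σ ^ 2 + b * σ / δ)) := by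
  rcases lt_or_ge σ δ with h | h
  · have : {w : ℂ | δ ≤ ‖w - c‖ ∧ ‖w - c‖ ≤ σ} = ∅ := by
      ext w
      simp only [mem_ofPred_eq, mem_empty_iff_false, iff_false, not_and]
      intro h1 h2
      linarith
    rw [this]
    simp
  obtain ⟨n, hn1, hn2⟩ := exists_nat_pow_near (x := σ / δ) (y := 2) ((one_le_div hδ).2 h) one_lt_two
  refine (setLIntegral_le_sum_ball (ι := Fin (n + 1)) (c := c) _
    (fun k => ENNReal.ofReal (2 ^ (k.1 + 1))) (fun k => 2 * σ / 2 ^ k.1) ?_ ?_).trans ?_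
  · rintro w ⟨h1, h2⟩
    have h0 : 0 < ‖w - c‖ := hδ.trans_le h1
    obtain ⟨k, hk1, hk2⟩ := exists_nat_pow_near (x := σ / ‖w - c‖) (y := 2)
      ((one_le_div h0).2 h2) one_lt_two
    have hkn : k < n + 1 := by
      refine (pow_lt_pow_iff_right₀ (one_lt_two (α := ℝ))).1 (hk1.trans_lt (lt_of_le_of_lt ?_ hn2))
      gcongr
    refine ⟨⟨k, hkn⟩, ?_, ENNReal.ofReal_le_ofReal hk2.le⟩
    rw [mem_ball, dist_eq_norm]
    rw [le_div_iff₀ h0] at hk1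
    rw [lt_div_iff₀ (by positivity)]
    nlinarith
  · have hn : Measurable fun w : ℂ => ‖w - c‖ := by fun_prop
    exact (measurableSet_le measurable_const hn).inter (measurableSet_le hn measurable_const)
  · rw [tsum_fintype]
    calc ∑ k : Fin (n + 1), ENNReal.ofReal (2 ^ (k.1 + 1)) * ν (ball c (2 * σ / 2 ^ k.1))
        ≤ ∑ k : Fin (n + 1), ENNReal.ofReal (8 * a * σ ^ 2 * (1 / 2) ^ k.1 + 2 * b * 2 ^ k.1) := by
          refine Finset.sum_le_sum fun k _ => ?_
          refine (mul_le_mul_right (hν _ (by positivity)) _).trans ?_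
          rw [← ENNReal.ofReal_mul (by positivity)]
          refine ENNReal.ofReal_le_ofReal (le_of_eq ?_)
          rw [one_div, inv_pow]
          field_simp
          ring
      _ = ENNReal.ofReal (∑ k : Fin (n + 1), (8 * a * σ ^ 2 * (1 / 2) ^ k.1 + 2 * b * 2 ^ k.1)) :=
          (ENNReal.ofReal_sum_of_nonneg fun k _ => by positivity).symm
      _ ≤ _ := by
          refine ENNReal.ofReal_le_ofReal ?_
          rw [Fin.sum_univ_eq_sum_range (fun k => 8 * a * σ ^ 2 * (1 / 2 : ℝ) ^ k + 2 * b * 2 ^ k),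
            Finset.sum_add_distrib, ← Finset.mul_sum, ← Finset.mul_sum, geom_sum_eq (by norm_num),
            geom_sum_eq (by norm_num)]
          have e1 : (0 : ℝ) ≤ (1 / 2) ^ (n + 1) := by positivity
          have e2 : (2 : ℝ) ^ (n + 1) ≤ 2 * (σ / δ) := by rw [pow_succ]; linarith
          have e3 : 0 ≤ a * σ ^ 2 := by positivity
          have e4 : b * σ / δ = b * (σ / δ) := by ring
          have e5 : 0 < σ / δ := by positivity
          have e6 : ((1 / 2 : ℝ) ^ (n + 1) - 1) / (1 / 2 - 1) = 2 * (1 - (1 / 2) ^ (n + 1)) := by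
            ring
          have e7 : ((2 : ℝ) ^ (n + 1) - 1) / (2 - 1) = 2 ^ (n + 1) - 1 := by norm_num
          rw [e4, e6, e7]
          nlinarith [mul_nonneg e3 e1, mul_le_mul_of_nonneg_left e2 hb, mul_nonneg hb e5.le]

/-- On outward dyadic shells the decay 8⁻ᵏ beats the growth 4ᵏ of the mass. -/
theorem lintegral_inv_dist_cube_le {ν : Measure ℂ} {c : ℂ} {a b : ℝ} (ha : 0 ≤ a) (hb : 0 ≤ b)
    (hν : ∀ s, 0 < s → ν (ball c s) ≤ ENNReal.ofReal (a * s ^ 2 + b)) {σ : ℝ} (hσ : 0 < σ) :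
    ∫⁻ w in {w | σ ≤ ‖w - c‖}, ENNReal.ofReal ((σ / ‖w - c‖) ^ 3) ∂ν ≤
      ENNReal.ofReal (16 * (a * σ ^ 2 + b)) := by
  refine (setLIntegral_le_sum_ball (ι := ℕ) (c := c) _
    (fun k => ENNReal.ofReal ((1 / 8) ^ k)) (fun k => σ * 2 ^ (k + 1)) ?_ ?_).trans ?_
  · intro w h1
    have h1 : σ ≤ ‖w - c‖ := h1
    have h0 : 0 < ‖w - c‖ := hσ.trans_le h1
    obtain ⟨k, hk1, hk2⟩ := exists_nat_pow_near (x := ‖w - c‖ / σ) (y := 2)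
      ((one_le_div hσ).2 h1) one_lt_two
    refine ⟨k, ?_, ENNReal.ofReal_le_ofReal ?_⟩
    · rw [mem_ball, dist_eq_norm]
      rw [div_lt_iff₀ hσ] at hk2
      linarith
    · have : σ / ‖w - c‖ ≤ (1 / 2) ^ k := by
        rw [one_div, inv_pow, ← inv_div]
        exact inv_anti₀ (by positivity) hk1
      calc (σ / ‖w - c‖) ^ 3 ≤ ((1 / 2) ^ k) ^ 3 := by gcongr
        _ = (1 / 8) ^ k := by rw [← pow_mul, mul_comm, pow_mul]; norm_num
  · exact measurableSet_le measurable_const (by fun_prop)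
  · calc ∑' k : ℕ, ENNReal.ofReal ((1 / 8) ^ k) * ν (ball c (σ * 2 ^ (k + 1)))
        ≤ ∑' k : ℕ, ENNReal.ofReal ((4 * a * σ ^ 2 + b) * (1 / 2) ^ k) := by
          refine ENNReal.tsum_le_tsum fun k => ?_
          refine (mul_le_mul_right (hν _ (by positivity)) _).trans ?_
          rw [← ENNReal.ofReal_mul (by positivity)]
          refine ENNReal.ofReal_le_ofReal ?_
          have e1 : (1 / 8 : ℝ) ^ k * (4 ^ k) = (1 / 2) ^ k := by
            rw [← mul_pow]; norm_num
          have e2 : (2 : ℝ) ^ (k + 1) * 2 ^ (k + 1) = 4 * 4 ^ k := by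
            rw [← mul_pow, pow_succ]; norm_num; ring
          have e3 : (1 / 8 : ℝ) ^ k ≤ (1 / 2) ^ k :=
            pow_le_pow_left₀ (by norm_num) (by norm_num) k
          calc (1 / 8 : ℝ) ^ k * (a * (σ * 2 ^ (k + 1)) ^ 2 + b)
              = a * σ ^ 2 * ((1 / 8 : ℝ) ^ k * (2 ^ (k + 1) * 2 ^ (k + 1))) + b * (1 / 8) ^ k := by
                ring
            _ = 4 * a * σ ^ 2 * (1 / 2) ^ k + b * (1 / 8) ^ k := by
                rw [e2, ← e1]; ring
            _ ≤ _ := by rw [add_mul]; gcongr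
      _ = ENNReal.ofReal (∑' k : ℕ, (4 * a * σ ^ 2 + b) * (1 / 2) ^ k) :=
          (ENNReal.ofReal_tsum_of_nonneg (fun k => by positivity)
            (summable_geometric_two.mul_left _)).symm
      _ ≤ _ := by
          refine ENNReal.ofReal_le_ofReal ?_
          rw [tsum_mul_left, tsum_geometric_two]
          nlinarith [mul_nonneg ha (sq_nonneg σ)]

/-- A measure whose balls of one fixed radius have bounded mass has at most quadratic growth. -/
theorem measure_ball_le_of_uniform {ν : Measure ℂ} [SFinite ν] {b : ENNReal} {ρ : ℝ} (hρ : 0 < ρ)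
    (h : ∀ z, ν (ball z ρ) ≤ b) (z : ℂ) {s : ℝ} (hs : 0 < s) :
    ν (ball z s) ≤ b * ENNReal.ofReal (((s + ρ) / ρ) ^ 2) := by
  have hm : Measurable (Function.uncurry fun y w : ℂ => (ball w ρ).indicator (1 : ℂ → ENNReal) y) :=
    measurable_one.indicator (s := {p : ℂ × ℂ | dist p.1 p.2 < ρ})
      (measurableSet_lt (by fun_prop) measurable_const)
  -- Double counting of pairs with |y-w| < ρ: for fixed y they have mass at most b, while each w in
  -- the ball of radius s sees a full disc of y's.
  have h1 : ∫⁻ y in ball z (s + ρ), ∫⁻ w, (ball w ρ).indicator (1 : ℂ → ENNReal) y ∂ν ≤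
      b * volume (ball z (s + ρ)) := by
    rw [← setLIntegral_const]
    refine lintegral_mono fun y => ?_
    have : ∀ w, (ball w ρ).indicator (1 : ℂ → ENNReal) y = (ball y ρ).indicator 1 w := fun w => by
      simp only [indicator, mem_ball, dist_comm]
      rfl
    simp only [this]
    rw [lintegral_indicator_one measurableSet_ball]
    exact h y
  rw [lintegral_lintegral_swap hm.aemeasurable] at h1
  have h2 : volume (ball (0 : ℂ) ρ) * ν (ball z s) ≤ b * volume (ball z (s + ρ)) := by
    refine le_trans ?_ h1
    rw [← setLIntegral_const]
    refine (setLIntegral_mono' measurableSet_ball fun w hw => ?_).trans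
      (setLIntegral_le_lintegral (ball z s) _)
    have hsub : ball w ρ ⊆ ball z (s + ρ) := fun y hy => by
      rw [mem_ball] at *
      linarith [dist_triangle y w z]
    rw [lintegral_indicator_one measurableSet_ball, Measure.restrict_apply measurableSet_ball,
      inter_eq_left.2 hsub]
    exact (Measure.addHaar_ball_center volume w ρ).ge
  have hV0 : volume (ball (0 : ℂ) ρ) ≠ 0 := (measure_ball_pos _ _ hρ).ne'
  refine (ENNReal.mul_le_mul_iff_right hV0 measure_ball_lt_top.ne).1 (h2.trans_eq ?_)
  rw [Complex.volume_ball, Complex.volume_ball, ← ENNReal.ofReal_pow (by positivity),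
    ← ENNReal.ofReal_pow hρ.le]
  have e : (s + ρ) ^ 2 = ρ ^ 2 * ((s + ρ) / ρ) ^ 2 := by field_simp
  rw [e, ENNReal.ofReal_mul (by positivity)]
  ring

theorem SignedField.pos_or_neg_singleton (μ : SignedField) (z : ℂ) :
    μ.pos {z} = 0 ∨ μ.neg {z} = 0 := by
  obtain ⟨s, -, h1, h2⟩ := μ.mutuallySingular
  by_cases h : z ∈ s
  · exact Or.inl (measure_mono_null (singleton_subset_iff.2 h) h1)
  · exact Or.inr (measure_mono_null (singleton_subset_iff.2 h) h2)

theorem SignedField.variation_singleton (μ : SignedField) (z : ℂ) :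
    μ.variation {z} = ENNReal.ofReal (2 * Real.pi * |μ.intensity z|) := by
  have hp : 2 * Real.pi * |μ.intensity z| = |μ.pos.real {z} - μ.neg.real {z}| := by
    have := Real.pi_pos
    rw [SignedField.intensity, abs_div, abs_of_pos (by positivity : 0 < 2 * Real.pi)]
    field_simp
  rw [hp, SignedField.variation, Measure.add_apply]
  rcases μ.pos_or_neg_singleton z with h | h
  · simp [measureReal_def, h, ENNReal.ofReal_toReal (measure_singleton_lt_top (μ := μ.neg)).ne]
  · simp [measureReal_def, h, ENNReal.ofReal_toReal (measure_singleton_lt_top (μ := μ.pos)).ne]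

theorem SignedField.contVariation_singleton (μ : SignedField) (z : ℂ) :
    μ.contVariation {z} = 0 := by
  rw [SignedField.contVariation, Measure.restrict_apply (measurableSet_singleton z)]
  by_cases h : μ.intensity z = 0
  · exact measure_mono_null inter_subset_left (by simp [SignedField.variation_singleton, h])
  · have : {z} ∩ μ.atomsᶜ = ∅ := by
      ext w
      simp only [mem_inter_iff, mem_singleton_iff, mem_compl_iff, mem_empty_iff_false, iff_false,
        not_and, not_not]
      rintro rfl
      exact h
    rw [this, measure_empty]

theorem UniformlyDiscrete.isClosed {L : Set ℂ} {r : ℝ} (hr : 0 < r) (h : UniformlyDiscrete L r) :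
    IsClosed L :=
  Metric.isClosed_of_pairwise_le_dist hr fun x hx y hy hxy => h x hx y hy hxy

theorem UniformlyDiscrete.eq_of_mem_ball {L : Set ℂ} {r δ : ℝ} (h : UniformlyDiscrete L r)
    (hδ : 2 * δ ≤ r) {z l l' : ℂ} (hl : l ∈ L) (hl' : l' ∈ L) (h1 : dist z l < δ)
    (h2 : dist z l' < δ) : l = l' := by
  by_contra hne
  linarith [h l hl l' hl' hne, dist_triangle_left l l' z]

/-- A disc of radius r/2 contains at most one atom, and its mass is at most 2πθ < 2π. -/
theorem SignedField.variation_restrict_atoms_ball_le {μ : SignedField} {r B : ℝ}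
    (h : μ.IsPerturbation r B) (z : ℂ) :
    μ.variation (ball z (r / 2) ∩ μ.atoms) ≤ ENNReal.ofReal (2 * Real.pi) := by
  rcases (ball z (r / 2) ∩ μ.atoms).eq_empty_or_nonempty with h0 | ⟨l, hl, hla⟩
  · simp [h0]
  have hsub : ball z (r / 2) ∩ μ.atoms ⊆ {l} := fun w ⟨hw, hwa⟩ =>
    h.separated.eq_of_mem_ball (by linarith) hwa hla (mem_ball'.1 hw) (mem_ball'.1 hl)
  refine (measure_mono hsub).trans ?_
  rw [SignedField.variation_singleton]
  obtain ⟨θ, hθ, hle⟩ := h.intensity_le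
  have := hle l hla
  refine ENNReal.ofReal_le_ofReal ?_
  have := Real.pi_pos
  nlinarith

/-- Since log x ≤ x - 1, the weight |log|w-z|| is at least 1/2 on a disc of radius at most 1/2, so
the logarithmic bound controls the mass. The centre, where `Real.log 0 = 0`, is null because this
measure has no atoms. -/
theorem SignedField.contVariation_ball_le {μ : SignedField} {r B : ℝ} (h : μ.IsPerturbation r B)
    {z : ℂ} {ρ : ℝ} (h1 : ρ ≤ r) (h2 : ρ ≤ 1 / 2) :
    μ.contVariation (ball z ρ) ≤ ENNReal.ofReal (2 * |B|) := by
  have key : ENNReal.ofReal (1 / 2) * μ.contVariation (ball z ρ) ≤ ENNReal.ofReal |B| := by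
    refine le_trans ?_ ((h.log_bound z).trans (ENNReal.ofReal_le_ofReal (le_abs_self B)))
    refine le_trans ?_ (lintegral_mono_set (ball_subset_ball h1))
    rw [← setLIntegral_const]
    refine lintegral_mono_ae ?_
    rw [ae_restrict_iff' measurableSet_ball]
    have hz : ∀ᵐ w ∂μ.contVariation, w ≠ z := by
      rw [ae_iff]
      simpa using μ.contVariation_singleton z
    filter_upwards [hz] with w hw hwb
    refine ENNReal.ofReal_le_ofReal ?_
    rw [mem_ball, dist_eq_norm] at hwb
    have h0 : 0 < ‖w - z‖ := norm_pos_iff.2 (sub_ne_zero.2 hw)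
    have : Real.log ‖w - z‖ ≤ -(1 / 2) := by
      have := Real.log_le_sub_one_of_pos h0
      linarith
    rw [abs_of_neg (by linarith)]
    linarith
  calc μ.contVariation (ball z ρ)
      = ENNReal.ofReal 2 * (ENNReal.ofReal (1 / 2) * μ.contVariation (ball z ρ)) := by
        rw [← mul_assoc, ← ENNReal.ofReal_mul (by norm_num)]
        norm_num
    _ ≤ ENNReal.ofReal 2 * ENNReal.ofReal |B| := by gcongr
    _ = _ := by rw [ENNReal.ofReal_mul (by norm_num)]

instance SignedField.variation_locallyFinite (μ : SignedField) :
    IsLocallyFiniteMeasure μ.variation := instLocallyFiniteAdd _ _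

/-- The constant in the quadratic growth of the variation of a perturbation. -/
theorem SignedField.exists_variation_ball_le (r B : ℝ) (hr : 0 < r) :
    ∃ A : ℝ, 0 < A ∧ ∀ μ : SignedField, μ.IsPerturbation r B → ∀ z s, 0 < s →
      μ.variation (ball z s) ≤ ENNReal.ofReal (A * s ^ 2 + A) := by
  set ρ := min (r / 2) (1 / 2) with hρ
  have hρ0 : 0 < ρ := by positivity
  have hρ1 : ρ ≤ r / 2 := min_le_left _ _
  have hb : ∀ μ : SignedField, μ.IsPerturbation r B → ∀ z, μ.variation (ball z ρ) ≤
      ENNReal.ofReal (2 * Real.pi + 2 * |B|) := fun μ h z => by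
    rw [ENNReal.ofReal_add (by positivity) (by positivity)]
    refine (measure_le_inter_add_sdiff _ _ μ.atoms).trans (add_le_add ?_ ?_)
    · exact (measure_mono (inter_subset_inter_left _ (ball_subset_ball hρ1))).trans
        (μ.variation_restrict_atoms_ball_le h z)
    · refine le_trans ?_ (μ.contVariation_ball_le h (z := z) (by linarith) (min_le_right _ _))
      rw [SignedField.contVariation, Measure.restrict_apply measurableSet_ball, sdiff_eq]
  have hp := Real.pi_pos
  refine ⟨(2 * Real.pi + 2 * |B|) * (2 / ρ ^ 2 + 2), by positivity, fun μ h z s hs => ?_⟩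
  refine (measure_ball_le_of_uniform hρ0 (hb μ h) z hs).trans ?_
  rw [← ENNReal.ofReal_mul (by positivity)]
  refine ENNReal.ofReal_le_ofReal ?_
  have e : ((s + ρ) / ρ) ^ 2 ≤ (2 / ρ ^ 2 + 2) * s ^ 2 + (2 / ρ ^ 2 + 2) := by
    rw [div_pow, div_le_iff₀ (by positivity)]
    have e1 : ((2 / ρ ^ 2 + 2) * s ^ 2 + (2 / ρ ^ 2 + 2)) * ρ ^ 2 =
      2 * s ^ 2 + 2 * ρ ^ 2 + 2 * s ^ 2 * ρ ^ 2 + 2 := by field_simp; ring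
    rw [e1]
    clear e1
    nlinarith [sq_nonneg (s - ρ), sq_nonneg (s * ρ)]
  exact (mul_le_mul_of_nonneg_left e (by positivity)).trans_eq (by ring)

end PauliZeroModes
namespace PauliZeroModes
open Filter Topology Set Metric

/-! ### Lower bounds for the potential of a perturbation -/

/-- The part of the kernel that is not controlled by absolute values: the quadratic correction in
the annulus `r₁ ≤ ‖w‖ ≤ 2‖z‖`, and the singularities at the points of `S`. -/
noncomputable def principalPart (r₁ : ℝ) (S : Set ℂ) (z w : ℂ) : ℝ :=
  {w : ℂ | r₁ ≤ ‖w‖ ∧ ‖w‖ ≤ 2 * ‖z‖}.indicator (fun w => (z ^ 2 * (w ^ 2)⁻¹).re / 2) w +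
    S.indicator (fun w => Real.log ‖z - w‖) w

/-- For |w| > 2|z| the cubic remainder bound applies. Otherwise log|z-w| is compared with log(4|z|),
which dominates it since |z-w| ≤ 3|z|. The difference is at most log(4/√ε) beyond √ε|z|, at most
√ε|z|/|w-z| more between δ and √ε|z|, and within δ it is either removed as a pole or kept as
|log|w-z||. The terms log(4|z|) survive only on discs of fixed radius, so they contribute o(|z|²)
after integration. -/
theorem abs_kernel_sub_principalPart_le {r₁ δ ε : ℝ} {L : Set ℂ} {z : ℂ} (hr : 0 < r₁)
    (hδ : 0 < δ) (hδ' : δ ≤ 1 / 2) (hε : 0 < ε) (hε' : ε ≤ 1) (hz : 1 ≤ ‖z‖) (hzr : r₁ ≤ ‖z‖)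
    (w : ℂ) :
    |kernel r₁ z w - principalPart r₁ (ball z δ ∩ L) z w| ≤
      {w : ℂ | 2 * ‖z‖ ≤ ‖w - 0‖}.indicator (fun w => (2 * ‖z‖ / ‖w - 0‖) ^ 3) w +
      ({w : ℂ | r₁ ≤ ‖w - 0‖ ∧ ‖w - 0‖ ≤ 2 * ‖z‖}.indicator
        (fun w => 3 * (2 * ‖z‖ / ‖w - 0‖)) w +
      ((ball 0 (4 * ‖z‖)).indicator (fun _ => Real.log 2 + Real.log (4 / √ε)) w +
      ((ball 0 r₁).indicator (fun _ => Real.log (4 * ‖z‖)) w +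
      ({w : ℂ | δ ≤ ‖w - z‖ ∧ ‖w - z‖ ≤ √ε * ‖z‖}.indicator
        (fun w => √ε * ‖z‖ / ‖w - z‖) w +
      ((ball z δ).indicator (fun _ => Real.log (4 * ‖z‖)) w +
      (ball z δ ∩ Lᶜ).indicator (fun w => |Real.log ‖w - z‖|) w))))) := by
  simp only [sub_zero]
  set ρ := ‖z‖ with hρ
  have hs : 0 < √ε := Real.sqrt_pos.2 hε
  have hs1 : √ε ≤ 1 := Real.sqrt_le_one.2 hε'
  have l2 : 0 ≤ Real.log 2 := Real.log_nonneg (by norm_num)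
  have l4 : 0 ≤ Real.log (4 / √ε) := Real.log_nonneg (by rw [le_div_iff₀ hs]; linarith)
  have lρ : 0 ≤ Real.log (4 * ρ) := Real.log_nonneg (by linarith)
  have n1 : 0 ≤ {w : ℂ | 2 * ρ ≤ ‖w‖}.indicator (fun w => (2 * ρ / ‖w‖) ^ 3) w :=
    indicator_nonneg (fun _ _ => by positivity) _
  have n2 : 0 ≤ {w : ℂ | r₁ ≤ ‖w‖ ∧ ‖w‖ ≤ 2 * ρ}.indicator (fun w => 3 * (2 * ρ / ‖w‖)) w :=
    indicator_nonneg (fun _ _ => by positivity) _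
  have n3 : 0 ≤ (ball 0 (4 * ρ)).indicator (fun _ => Real.log 2 + Real.log (4 / √ε)) w :=
    indicator_nonneg (fun _ _ => by positivity) _
  have n4 : 0 ≤ (ball 0 r₁).indicator (fun _ => Real.log (4 * ρ)) w :=
    indicator_nonneg (fun _ _ => lρ) _
  have n5 : 0 ≤ {w : ℂ | δ ≤ ‖w - z‖ ∧ ‖w - z‖ ≤ √ε * ρ}.indicator
      (fun w => √ε * ρ / ‖w - z‖) w := indicator_nonneg (fun _ _ => by positivity) _
  have n6 : 0 ≤ (ball z δ).indicator (fun _ => Real.log (4 * ρ)) w :=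
    indicator_nonneg (fun _ _ => lρ) _
  have n7 : 0 ≤ (ball z δ ∩ Lᶜ).indicator (fun w => |Real.log ‖w - z‖|) w :=
    indicator_nonneg (fun _ _ => abs_nonneg _) _
  rcases lt_or_ge (2 * ρ) ‖w‖ with hw | hw
  · have e1 : kernel r₁ z w - principalPart r₁ (ball z δ ∩ L) z w =
        Real.log ‖z - w‖ - Real.log ‖w‖ + (z / w).re + (z ^ 2 * (w ^ 2)⁻¹).re / 2 := by
      rw [kernel, if_neg (by linarith), principalPart, indicator_of_notMem, indicator_of_notMem]
      · ring
      · rintro ⟨h, -⟩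
        rw [mem_ball, dist_eq_norm] at h
        have := norm_sub_norm_le w z
        linarith
      · rintro ⟨-, h⟩
        exact absurd h (not_le.2 hw)
    have hw0 : 0 < ‖w‖ := by linarith
    rw [e1]
    refine (abs_genus_two_le (norm_pos_iff.1 hw0) hw.le).trans ?_
    rw [indicator_of_mem (show w ∈ {w : ℂ | 2 * ρ ≤ ‖w‖} from hw.le)]
    have : (ρ / ‖w‖) ^ 3 ≤ (2 * ρ / ‖w‖) ^ 3 := by gcongr; linarith
    linarith
  · have hzw : ‖z - w‖ ≤ 3 * ρ := (norm_sub_le z w).trans (by linarith)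
    -- q gathers log(4|z|) and what remains of the kernel's correction once its quadratic term is
    -- removed; for |w| < r₁ there is no correction and q = log(4|z|).
    obtain ⟨q, hq, hqb⟩ : ∃ q : ℝ, kernel r₁ z w - principalPart r₁ (ball z δ ∩ L) z w =
        (Real.log ‖z - w‖ - Real.log (4 * ρ) -
          (ball z δ ∩ L).indicator (fun w => Real.log ‖z - w‖) w) + q ∧
        |q| ≤ {w : ℂ | r₁ ≤ ‖w‖ ∧ ‖w‖ ≤ 2 * ρ}.indicator (fun w => 3 * (2 * ρ / ‖w‖)) w +
          Real.log 2 + (ball 0 r₁).indicator (fun _ => Real.log (4 * ρ)) w := by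
      rcases lt_or_ge ‖w‖ r₁ with h | h
      · refine ⟨Real.log (4 * ρ), ?_, ?_⟩
        · rw [kernel, if_pos h, principalPart, indicator_of_notMem (fun h' => not_lt.2 h'.1 h)]
          ring
        · rw [indicator_of_mem (show w ∈ ball (0 : ℂ) r₁ by simpa using h), abs_of_nonneg lρ]
          linarith
      · have hw0 : 0 < ‖w‖ := hr.trans_le h
        refine ⟨Real.log (4 * ρ) - Real.log ‖w‖ + (z / w).re, ?_, ?_⟩
        · rw [kernel, if_neg (not_lt.2 h), principalPart,
            indicator_of_mem (show w ∈ {w : ℂ | r₁ ≤ ‖w‖ ∧ ‖w‖ ≤ 2 * ‖z‖} from ⟨h, hw⟩)]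
          ring
        · rw [indicator_of_mem (show w ∈ {w : ℂ | r₁ ≤ ‖w‖ ∧ ‖w‖ ≤ 2 * ρ} from ⟨h, hw⟩)]
          have e2 : Real.log (4 * ρ) - Real.log ‖w‖ = Real.log 2 + Real.log (2 * ρ / ‖w‖) := by
            rw [Real.log_div (by positivity) hw0.ne', ← add_sub_assoc,
              ← Real.log_mul (by norm_num) (by positivity)]
            ring_nf
          have e3 : 0 ≤ Real.log (2 * ρ / ‖w‖) := Real.log_nonneg ((one_le_div hw0).2 hw)
          have e4 : Real.log (2 * ρ / ‖w‖) ≤ 2 * ρ / ‖w‖ :=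
            (Real.log_le_sub_one_of_pos (by positivity)).trans (by linarith)
          have e5 : |(z / w).re| ≤ 2 * ρ / ‖w‖ := by
            refine (Complex.abs_re_le_norm _).trans ?_
            rw [norm_div]
            gcongr
            linarith
          have e6 : 0 < 2 * ρ / ‖w‖ := by positivity
          rw [e2]
          refine (abs_add_le _ _).trans ?_
          rw [abs_of_nonneg (by positivity)]
          linarith
    have hqb2 : |Real.log ‖z - w‖ - Real.log (4 * ρ) -
          (ball z δ ∩ L).indicator (fun w => Real.log ‖z - w‖) w| ≤
        Real.log (4 / √ε) + {w : ℂ | δ ≤ ‖w - z‖ ∧ ‖w - z‖ ≤ √ε * ρ}.indicator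
          (fun w => √ε * ρ / ‖w - z‖) w + (ball z δ).indicator (fun _ => Real.log (4 * ρ)) w +
        (ball z δ ∩ Lᶜ).indicator (fun w => |Real.log ‖w - z‖|) w := by
      rw [norm_sub_rev] at hzw
      simp only [norm_sub_rev z]
      rcases lt_or_ge ‖w - z‖ δ with h | h
      · have hb : w ∈ ball z δ := by rwa [mem_ball, dist_eq_norm]
        rw [indicator_of_mem hb]
        by_cases hL : w ∈ L
        · rw [indicator_of_mem (show w ∈ ball z δ ∩ L from ⟨hb, hL⟩), sub_right_comm, sub_self,
            zero_sub, abs_neg, abs_of_nonneg lρ]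
          linarith
        · rw [indicator_of_notMem (fun h : w ∈ ball z δ ∩ L => hL h.2),
            indicator_of_mem (show w ∈ ball z δ ∩ Lᶜ from ⟨hb, hL⟩), sub_zero]
          refine (abs_sub _ _).trans ?_
          rw [abs_of_nonneg lρ]
          linarith
      · have h0 : 0 < ‖w - z‖ := hδ.trans_le h
        rw [indicator_of_notMem (s := ball z δ ∩ L), sub_zero, abs_sub_comm,
          ← Real.log_div (by positivity) h0.ne',
          abs_of_nonneg (Real.log_nonneg ((one_le_div h0).2 (by linarith)))]
        · rcases lt_or_ge (√ε * ρ) ‖w - z‖ with h' | h'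
          · have : Real.log (4 * ρ / ‖w - z‖) ≤ Real.log (4 / √ε) := by
              refine Real.log_le_log (by positivity) ?_
              rw [div_le_div_iff₀ h0 hs]
              nlinarith
            linarith
          · rw [indicator_of_mem (show w ∈ {w | δ ≤ ‖w - z‖ ∧ ‖w - z‖ ≤ √ε * ρ} from ⟨h, h'⟩)]
            have e7 : Real.log (4 * ρ / ‖w - z‖) =
                Real.log (4 / √ε) + Real.log (√ε * ρ / ‖w - z‖) := by
              rw [← Real.log_mul (by positivity) (by positivity)]
              congr 1
              field_simp
            have e8 : Real.log (√ε * ρ / ‖w - z‖) ≤ √ε * ρ / ‖w - z‖ :=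
              (Real.log_le_sub_one_of_pos (by positivity)).trans (by linarith)
            linarith
        · rintro ⟨h', -⟩
          rw [mem_ball, dist_eq_norm] at h'
          linarith
    rw [hq, indicator_of_mem (show w ∈ ball (0 : ℂ) (4 * ρ) by
      rw [mem_ball_zero_iff]; linarith)]
    refine (abs_add_le _ _).trans ?_
    linarith

theorem lintegral_ofReal_indicator {ν : Measure ℂ} {S : Set ℂ} (hS : MeasurableSet S) (f : ℂ → ℝ) :
    ∫⁻ w, ENNReal.ofReal (S.indicator f w) ∂ν = ∫⁻ w in S, ENNReal.ofReal (f w) ∂ν := by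
  rw [← lintegral_indicator hS]
  congr 1
  funext w
  by_cases h : w ∈ S <;> simp [h]

theorem lintegral_ofReal_indicator_add_le {ν : Measure ℂ} {S : Set ℂ} (hS : MeasurableSet S)
    {f g : ℂ → ℝ} (hf : Measurable f) {a b : ℝ} (ha : 0 ≤ a) (hb : 0 ≤ b)
    (h1 : ∫⁻ w in S, ENNReal.ofReal (f w) ∂ν ≤ ENNReal.ofReal a)
    (h2 : ∫⁻ w, ENNReal.ofReal (g w) ∂ν ≤ ENNReal.ofReal b) :
    ∫⁻ w, ENNReal.ofReal (S.indicator f w + g w) ∂ν ≤ ENNReal.ofReal (a + b) := by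
  rw [ENNReal.ofReal_add ha hb]
  refine le_trans ?_ (add_le_add h1 h2)
  rw [← lintegral_ofReal_indicator hS, ← lintegral_add_left (hf.indicator hS).ennreal_ofReal]
  exact lintegral_mono fun w => ENNReal.ofReal_add_le

theorem setLIntegral_ofReal_const_le {ν : Measure ℂ} {S : Set ℂ} {c m : ℝ} (hc : 0 ≤ c)
    (h : ν S ≤ ENNReal.ofReal m) :
    ∫⁻ _ in S, ENNReal.ofReal c ∂ν ≤ ENNReal.ofReal (c * m) := by
  rw [setLIntegral_const, ENNReal.ofReal_mul hc]
  gcongr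

/-- The centred growth ε s² + D is used for all far terms, and the uniform growth A s² + A only
within √ε|z| of z, where it also yields A ε|z|². As ε ≤ 1/2, 2 log(1/ε) ≥ 1, so each ε|z|² is at
most 2ε log(1/ε)|z|². The quadratic terms add up to 64 + 192 = 256 times ε|z|², 64 times ε
log(1/ε)|z|² and 16A ε|z|², that is at most 576 + 32A. -/
theorem lintegral_kernel_sub_principalPart_le {ν : Measure ℂ} {L : Set ℂ} (hL : MeasurableSet L)
    {r₁ δ ε A D B : ℝ} (hr : 0 < r₁) (hδ : 0 < δ) (hδ' : δ ≤ 1 / 2) (hε : 0 < ε) (hε' : ε ≤ 1 / 2)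
    (hA : 0 ≤ A) (hD : 0 ≤ D) (hB : 0 ≤ B)
    (hν : ∀ s, 0 < s → ν (ball 0 s) ≤ ENNReal.ofReal (ε * s ^ 2 + D))
    (hν' : ∀ z s, 0 < s → ν (ball z s) ≤ ENNReal.ofReal (A * s ^ 2 + A))
    (hlog : ∀ z, ∫⁻ w in ball z δ ∩ Lᶜ, ENNReal.ofReal |Real.log ‖w - z‖| ∂ν ≤ ENNReal.ofReal B) :
    ∃ E : ℝ, 0 ≤ E ∧ ∀ z : ℂ, 1 ≤ ‖z‖ → r₁ ≤ ‖z‖ →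
      ∫⁻ w, ENNReal.ofReal |kernel r₁ z w - principalPart r₁ (ball z δ ∩ L) z w| ∂ν ≤
        ENNReal.ofReal ((600 + 32 * A) * (ε * Real.log (1 / ε)) * ‖z‖ ^ 2 + E * ‖z‖) := by
  have hs : 0 < √ε := Real.sqrt_pos.2 hε
  have hs1 : √ε ≤ 1 := Real.sqrt_le_one.2 (by linarith)
  have hs2 : √ε ^ 2 = ε := Real.sq_sqrt hε.le
  set ℓ := Real.log (1 / ε) with hℓ
  have hl2 : 1 / 2 ≤ Real.log 2 := by
    have := Real.one_sub_inv_le_log_of_pos (x := 2) (by norm_num)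
    norm_num at this ⊢
    linarith
  have hl : Real.log 2 ≤ ℓ := Real.log_le_log (by norm_num) (by
    rw [le_div_iff₀ hε]; linarith)
  have hℓ0 : 0 ≤ ℓ := by linarith
  have hl4 : Real.log 2 + Real.log (4 / √ε) ≤ 4 * ℓ := by
    rw [Real.log_div (by norm_num) hs.ne', Real.log_sqrt hε.le,
      show (4 : ℝ) = 2 ^ 2 by norm_num, Real.log_pow]
    rw [hℓ, one_div, Real.log_inv] at *
    push_cast
    linarith
  have hl40 : 0 ≤ Real.log 2 + Real.log (4 / √ε) := by
    have : 0 ≤ Real.log (4 / √ε) := Real.log_nonneg (by rw [le_div_iff₀ hs]; linarith)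
    linarith
  -- E collects what is constant or linear in ‖z‖; constants are absorbed by 1 ≤ ‖z‖ and log(4‖z‖)
  -- by 4‖z‖.
  refine ⟨16 * D + 96 * D / r₁ + 4 * ℓ * D + 4 * (ε * r₁ ^ 2 + D) + 16 * A / δ +
    4 * (A * δ ^ 2 + A) + B, by positivity, fun z hz hzr => ?_⟩
  have hm0 : ∀ c : ℂ, Measurable fun w : ℂ => ‖w - c‖ := fun c => by fun_prop
  have lρ : 0 ≤ Real.log (4 * ‖z‖) := Real.log_nonneg (by linarith)
  have lρ' : Real.log (4 * ‖z‖) ≤ 4 * ‖z‖ :=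
    (Real.log_le_sub_one_of_pos (by positivity)).trans (by linarith)
  have hmann : ∀ (c : ℂ) (a b : ℝ), MeasurableSet {w : ℂ | a ≤ ‖w - c‖ ∧ ‖w - c‖ ≤ b} :=
    fun c a b => (measurableSet_le measurable_const (hm0 c)).inter
      (measurableSet_le (hm0 c) measurable_const)
  have b1 := lintegral_inv_dist_cube_le (c := 0) hε.le hD hν (σ := 2 * ‖z‖) (by positivity)
  have b2 : ∫⁻ w in {w : ℂ | r₁ ≤ ‖w - 0‖ ∧ ‖w - 0‖ ≤ 2 * ‖z‖},
      ENNReal.ofReal (3 * (2 * ‖z‖ / ‖w - 0‖)) ∂ν ≤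
      ENNReal.ofReal (3 * (16 * (ε * (2 * ‖z‖) ^ 2 + D * (2 * ‖z‖) / r₁))) := by
    have := lintegral_inv_dist_le (c := 0) hε.le hD hν hr (σ := 2 * ‖z‖) (by positivity)
    rw [ENNReal.ofReal_mul (p := 3) (by norm_num)]
    simp only [ENNReal.ofReal_mul (p := 3) (by norm_num)]
    rw [lintegral_const_mul' _ _ ENNReal.ofReal_ne_top]
    gcongr
  have b3 := setLIntegral_ofReal_const_le hl40 (hν (4 * ‖z‖) (by positivity))
  have b4 := setLIntegral_ofReal_const_le lρ (hν r₁ hr)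
  have b5 := lintegral_inv_dist_le (c := z) hA hA (hν' z) hδ (σ := √ε * ‖z‖) (by positivity)
  have b6 := setLIntegral_ofReal_const_le lρ (hν' z δ hδ)
  have b7 : ∫⁻ w, ENNReal.ofReal ((ball z δ ∩ Lᶜ).indicator (fun w => |Real.log ‖w - z‖|) w) ∂ν ≤
      ENNReal.ofReal B := by
    rw [lintegral_ofReal_indicator (measurableSet_ball.inter hL.compl)]
    exact hlog z
  refine (lintegral_mono fun w => ENNReal.ofReal_le_ofReal (abs_kernel_sub_principalPart_le hr hδ
    hδ' hε (by linarith) hz hzr w)).trans ?_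
  refine (lintegral_ofReal_indicator_add_le (measurableSet_le measurable_const (hm0 0))
    ((measurable_const.div (hm0 0)).pow_const 3) (by positivity) (by positivity) b1
    (lintegral_ofReal_indicator_add_le (hmann 0 _ _)
      ((measurable_const.div (hm0 0)).const_mul 3) (by positivity) (by positivity) b2
    (lintegral_ofReal_indicator_add_le measurableSet_ball measurable_const (by positivity)
      (by positivity) b3
    (lintegral_ofReal_indicator_add_le measurableSet_ball measurable_const (by positivity)
      (by positivity) b4
    (lintegral_ofReal_indicator_add_le (hmann z _ _) (measurable_const.div (hm0 z))
      (by positivity) (by positivity) b5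
    (lintegral_ofReal_indicator_add_le measurableSet_ball measurable_const (by positivity)
      hB b6 b7)))))).trans ?_
  refine ENNReal.ofReal_le_ofReal ?_
  set ρ := ‖z‖
  have c3 : (Real.log 2 + Real.log (4 / √ε)) * (ε * (4 * ρ) ^ 2 + D) ≤
      4 * ℓ * (ε * (4 * ρ) ^ 2 + D) := by gcongr
  have c4 : Real.log (4 * ρ) * (ε * r₁ ^ 2 + D) ≤ 4 * ρ * (ε * r₁ ^ 2 + D) := by gcongr
  have c5 : A * (√ε * ρ) ^ 2 + A * (√ε * ρ) / δ ≤ A * ε * ρ ^ 2 + A * ρ / δ := by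
    rw [mul_pow, hs2, ← mul_assoc]
    gcongr
    exact mul_le_of_le_one_left (by positivity) hs1
  have c6 : Real.log (4 * ρ) * (A * δ ^ 2 + A) ≤ 4 * ρ * (A * δ ^ 2 + A) := by gcongr
  have hℓ1 : 1 ≤ 2 * ℓ := by linarith
  have d1 : ε * ρ ^ 2 ≤ 2 * (ε * ℓ * ρ ^ 2) := by
    have := mul_le_mul_of_nonneg_left hℓ1 (by positivity : 0 ≤ ε * ρ ^ 2)
    linarith
  have d2 : A * ε * ρ ^ 2 ≤ 2 * (A * (ε * ℓ * ρ ^ 2)) := by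
    have := mul_le_mul_of_nonneg_left d1 hA
    linarith
  have d3 : D ≤ D * ρ := le_mul_of_one_le_right hD hz
  have d4 : B ≤ B * ρ := le_mul_of_one_le_right hB hz
  have d5 : ℓ * D ≤ ℓ * D * ρ := le_mul_of_one_le_right (by positivity) hz
  have f1 : D * (2 * ρ) / r₁ = 2 * (D / r₁ * ρ) := by ring
  have f2 : 96 * D / r₁ = 96 * (D / r₁) := by ring
  have f3 : A * ρ / δ = A / δ * ρ := by ring
  have f4 : 16 * A / δ = 16 * (A / δ) := by ring
  have d6 : 0 ≤ ε * ℓ * ρ ^ 2 := by positivity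
  rw [f3] at c5
  rw [f1, f2, f4]
  generalize D / r₁ = x at *
  generalize A / δ = y at *
  nlinarith

end PauliZeroModes
-- Sparse fields are small; integrals of the principal part
namespace PauliZeroModes
open Filter Topology Set Metric

namespace SignedField

theorem growth_mono (μ : SignedField) {s t : ℝ} (h : s ≤ t) : μ.growth s ≤ μ.growth t :=
  ENNReal.toReal_mono measure_ball_lt_top.ne (measure_mono (ball_subset_ball h))

theorem variation_ball_eq (μ : SignedField) (s : ℝ) :
    μ.variation (ball 0 s) = ENNReal.ofReal (μ.growth s) := by
  rw [growth, measureReal_def, ENNReal.ofReal_toReal measure_ball_lt_top.ne]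

theorem pos_le_variation (μ : SignedField) : μ.pos ≤ μ.variation := Measure.le_add_right le_rfl

theorem neg_le_variation (μ : SignedField) : μ.neg ≤ μ.variation := Measure.le_add_left le_rfl

/-- Dyadic shells contribute a geometric series of ratio 2^{-τ}, so the tails of ∫|w|⁻² d|μ| vanish
as σ → ∞. -/
theorem lintegral_inv_sq_le {μ : SignedField} {τ K R : ℝ} (hτ : 0 < τ)
    (h : ∀ ρ, R ≤ ρ → μ.growth ρ ≤ K * ρ ^ (2 - τ)) {σ : ℝ} (hσ : 0 < σ) (hR : R ≤ σ) :
    ∫⁻ w in {w : ℂ | σ ≤ ‖w‖}, ENNReal.ofReal (‖w‖ ^ 2)⁻¹ ∂μ.variation ≤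
      ENNReal.ofReal (4 * |K| * (1 - 2 ^ (-τ))⁻¹ * σ ^ (-τ)) := by
  set q : ℝ := 2 ^ (-τ) with hq
  have hq0 : 0 < q := by positivity
  have hq1 : q < 1 := Real.rpow_lt_one_of_one_lt_of_neg one_lt_two (by linarith)
  refine (setLIntegral_le_sum_ball (ι := ℕ) (c := 0) _
    (fun k => ENNReal.ofReal ((σ * 2 ^ k) ^ 2)⁻¹) (fun k => σ * 2 ^ (k + 1)) ?_ ?_).trans ?_
  · intro w h1
    have h1 : σ ≤ ‖w‖ := h1
    obtain ⟨k, hk1, hk2⟩ := exists_nat_pow_near (x := ‖w‖ / σ) (y := 2)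
      ((one_le_div hσ).2 h1) one_lt_two
    refine ⟨k, ?_, ENNReal.ofReal_le_ofReal ?_⟩
    · rw [mem_ball_zero_iff]
      rw [div_lt_iff₀ hσ] at hk2
      linarith
    · rw [le_div_iff₀ hσ] at hk1
      refine inv_anti₀ (by positivity) ?_
      gcongr
      linarith
  · exact measurableSet_le measurable_const measurable_norm
  · calc ∑' k : ℕ, ENNReal.ofReal ((σ * 2 ^ k) ^ 2)⁻¹ * μ.variation (ball 0 (σ * 2 ^ (k + 1)))
        ≤ ∑' k : ℕ, ENNReal.ofReal (4 * |K| * σ ^ (-τ) * q ^ k) := by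
          refine ENNReal.tsum_le_tsum fun k => ?_
          rw [variation_ball_eq, ← ENNReal.ofReal_mul (by positivity)]
          refine ENNReal.ofReal_le_ofReal ?_
          have hs : 0 < σ * 2 ^ (k + 1) := by positivity
          have h1 : R ≤ σ * 2 ^ (k + 1) :=
            hR.trans (le_mul_of_one_le_right hσ.le (one_le_pow₀ one_le_two))
          have h2 : (σ * 2 ^ (k + 1)) ^ (2 - τ) = (σ * 2 ^ (k + 1)) ^ 2 * (σ ^ (-τ) * q ^ (k + 1)) := by
            rw [sub_eq_add_neg, Real.rpow_add hs, Real.rpow_two,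
              Real.mul_rpow hσ.le (by positivity), ← Real.rpow_natCast 2, ← Real.rpow_natCast q, hq,
              ← Real.rpow_mul zero_le_two, ← Real.rpow_mul zero_le_two, mul_comm (-τ)]
          calc ((σ * 2 ^ k) ^ 2)⁻¹ * μ.growth (σ * 2 ^ (k + 1))
              ≤ ((σ * 2 ^ k) ^ 2)⁻¹ * (|K| * (σ * 2 ^ (k + 1)) ^ (2 - τ)) := by
                gcongr
                exact (h _ h1).trans (by gcongr; exact le_abs_self K)
            _ = 4 * |K| * σ ^ (-τ) * q ^ (k + 1) := by
                rw [h2]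
                field_simp
                ring
            _ ≤ _ := by
                gcongr 4 * |K| * σ ^ (-τ) * ?_
                exact pow_le_pow_of_le_one hq0.le hq1.le (Nat.le_succ k)
      _ = ENNReal.ofReal (∑' k : ℕ, 4 * |K| * σ ^ (-τ) * q ^ k) :=
          (ENNReal.ofReal_tsum_of_nonneg (fun k => by positivity)
            ((summable_geometric_of_lt_one hq0.le hq1).mul_left _)).symm
      _ = _ := by
          rw [tsum_mul_left, tsum_geometric_of_lt_one hq0.le hq1]
          congr 1
          ring

theorem norm_setIntegral_inv_sq_le {P : Measure ℂ} {σ ρ c : ℝ} (hc : 0 ≤ c)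
    (h : ∫⁻ w in {w : ℂ | σ ≤ ‖w‖}, ENNReal.ofReal (‖w‖ ^ 2)⁻¹ ∂P ≤ ENNReal.ofReal c) :
    ‖∫ w in {w : ℂ | σ ≤ ‖w‖ ∧ ‖w‖ ≤ ρ}, (w ^ 2)⁻¹ ∂P‖ ≤ c := by
  have h1 := enorm_integral_le_lintegral_enorm
    (μ := P.restrict {w : ℂ | σ ≤ ‖w‖ ∧ ‖w‖ ≤ ρ}) (fun w : ℂ => (w ^ 2)⁻¹)
  have h2 : ∀ w : ℂ, ‖(w ^ 2)⁻¹‖ₑ = ENNReal.ofReal (‖w‖ ^ 2)⁻¹ := fun w => by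
    rw [← ofReal_norm, norm_inv, norm_pow]
  simp only [h2] at h1
  have h3 := (h1.trans (lintegral_mono_set fun w hw => hw.1)).trans h
  rw [← ofReal_norm] at h3
  exact (ENNReal.ofReal_le_ofReal_iff hc).1 h3

/-- A sparse perturbation is small for every `ε`. -/
theorem IsSparse.isSmall {μ : SignedField} (h : μ.IsSparse) {ε : ℝ} (hε : 0 < ε) :
    μ.IsSmall ε := by
  obtain ⟨τ, K, R, hτ, h⟩ := h
  have t0 : Tendsto (fun σ : ℝ => σ ^ (-τ)) atTop (𝓝 0) := tendsto_rpow_neg_atTop hτ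
  have t1 := t0.const_mul K
  have t2 := t0.const_mul (4 * |K| * (1 - 2 ^ (-τ))⁻¹)
  rw [mul_zero] at t1 t2
  have e1 := t1.eventually_le_const hε
  have e2 := t2.eventually_le_const (half_pos hε)
  obtain ⟨R₀, hR₀⟩ := eventually_atTop.1 (e1.and (e2.and ((eventually_ge_atTop R).and
    (eventually_gt_atTop 0))))
  -- The same R₀ serves as r₁: the moment then sees only the tail |w| ≥ R₀, where |w|⁻² has integral
  -- at most ε/2 against |μ|, hence against each Jordan part.
  refine ⟨R₀, R₀, (hR₀ R₀ le_rfl).2.2.2, fun ρ hρ => ⟨?_, ?_⟩⟩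
  · obtain ⟨h1, -, h2, h3⟩ := hR₀ ρ hρ.le
    refine (h ρ h2).trans ?_
    rw [sub_eq_add_neg, Real.rpow_add h3, Real.rpow_two]
    have := mul_le_mul_of_nonneg_right h1 (sq_nonneg ρ)
    linarith
  · obtain ⟨-, h1, h2, h3⟩ := hR₀ R₀ le_rfl
    have h4 := (lintegral_inv_sq_le hτ h h3 h2).trans (ENNReal.ofReal_le_ofReal h1)
    have hP := norm_setIntegral_inv_sq_le (ρ := ρ) (half_pos hε).le ((lintegral_mono'
      (Measure.restrict_mono le_rfl μ.pos_le_variation) le_rfl).trans h4)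
    have hN := norm_setIntegral_inv_sq_le (ρ := ρ) (half_pos hε).le ((lintegral_mono'
      (Measure.restrict_mono le_rfl μ.neg_le_variation) le_rfl).trans h4)
    rw [secondMoment]
    refine (norm_sub_le _ _).trans ?_
    linarith

theorem exists_variation_ball_zero_le {μ : SignedField} {ε R₀ : ℝ} (hε : 0 < ε)
    (h : ∀ ρ, R₀ < ρ → μ.growth ρ ≤ ε * ρ ^ 2) :
    ∃ D : ℝ, 0 ≤ D ∧ ∀ s, 0 < s → μ.variation (ball 0 s) ≤ ENNReal.ofReal (ε * s ^ 2 + D) := by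
  have hD : 0 ≤ μ.growth R₀ := measureReal_nonneg
  refine ⟨μ.growth R₀, hD, fun s _ => ?_⟩
  rw [variation_ball_eq]
  refine ENNReal.ofReal_le_ofReal ?_
  have : 0 ≤ ε * s ^ 2 := by positivity
  rcases le_or_gt s R₀ with hs | hs
  · linarith [μ.growth_mono hs]
  · linarith [h s hs]

theorem integrableOn_inv_cube {ν P : Measure ℂ} {a b r₁ : ℝ} (ha : 0 ≤ a) (hb : 0 ≤ b)
    (hν : ∀ s, 0 < s → ν (ball 0 s) ≤ ENNReal.ofReal (a * s ^ 2 + b)) (hr : 0 < r₁) (hP : P ≤ ν) :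
    IntegrableOn (fun w : ℂ => (‖w‖ ^ 3)⁻¹) {w | r₁ ≤ ‖w‖} P := by
  have h1 := lintegral_inv_dist_cube_le (c := 0) ha hb hν hr
  simp only [sub_zero] at h1
  have h2 : IntegrableOn (fun w : ℂ => (r₁ / ‖w‖) ^ 3) {w | r₁ ≤ ‖w‖} P := by
    refine ⟨((measurable_const.div measurable_norm).pow_const 3).aestronglyMeasurable, ?_⟩
    refine lt_of_le_of_lt ?_ (h1.trans_lt ENNReal.ofReal_lt_top)
    refine le_trans (le_of_eq ?_) (lintegral_mono' (Measure.restrict_mono le_rfl hP) le_rfl)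
    congr 1
    funext w
    rw [← ofReal_norm, Real.norm_of_nonneg (by positivity)]
  refine (h2.const_mul (r₁ ^ 3)⁻¹).congr (Eventually.of_forall fun w => ?_)
  dsimp only
  rw [div_pow]
  field_simp

theorem integrable_principalPart {P : Measure ℂ} [IsLocallyFiniteMeasure P] {r₁ : ℝ} (hr : 0 < r₁)
    {S : Set ℂ} (hS : S.Subsingleton) (z : ℂ) :
    Integrable (fun w => {w : ℂ | r₁ ≤ ‖w‖ ∧ ‖w‖ ≤ 2 * ‖z‖}.indicator
      (fun w => (w ^ 2)⁻¹) w) P ∧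
    Integrable (fun w => S.indicator (fun w => Real.log ‖z - w‖) w) P := by
  have hm : MeasurableSet {w : ℂ | r₁ ≤ ‖w‖ ∧ ‖w‖ ≤ 2 * ‖z‖} :=
    (measurableSet_le measurable_const measurable_norm).inter
      (measurableSet_le measurable_norm measurable_const)
  constructor
  · rw [integrable_indicator_iff hm]
    have hfin : P {w : ℂ | r₁ ≤ ‖w‖ ∧ ‖w‖ ≤ 2 * ‖z‖} < ⊤ :=
      (measure_mono fun w hw => by simpa using hw.2).trans_lt
        (isCompact_closedBall (0 : ℂ) (2 * ‖z‖)).measure_lt_top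
    refine Measure.integrableOn_of_bounded (M := (r₁ ^ 2)⁻¹) hfin.ne
      ((measurable_id.pow_const 2).inv).aestronglyMeasurable ?_
    rw [ae_restrict_iff' hm]
    refine Eventually.of_forall fun w hw => ?_
    rw [norm_inv, norm_pow]
    have := hw.1
    gcongr
  · rw [integrable_indicator_iff hS.measurableSet]
    rcases hS.eq_empty_or_singleton with rfl | ⟨l, rfl⟩
    · simp
    · exact integrableOn_singleton (by simp) (measure_singleton_lt_top)

theorem integral_principalPart {P : Measure ℂ} [IsLocallyFiniteMeasure P] {r₁ : ℝ} (hr : 0 < r₁)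
    {S : Set ℂ} (hS : S.Subsingleton) (z : ℂ) :
    Integrable (principalPart r₁ S z) P ∧ ∫ w, principalPart r₁ S z w ∂P =
      (z ^ 2 * ∫ w in {w : ℂ | r₁ ≤ ‖w‖ ∧ ‖w‖ ≤ 2 * ‖z‖}, (w ^ 2)⁻¹ ∂P).re / 2 +
      ∫ w in S, Real.log ‖z - w‖ ∂P := by
  have hm : MeasurableSet {w : ℂ | r₁ ≤ ‖w‖ ∧ ‖w‖ ≤ 2 * ‖z‖} :=
    (measurableSet_le measurable_const measurable_norm).inter
      (measurableSet_le measurable_norm measurable_const)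
  obtain ⟨h1, h2⟩ := integrable_principalPart (P := P) hr hS z
  have h3 := (h1.const_mul (z ^ 2))
  have e : ∀ w, {w : ℂ | r₁ ≤ ‖w‖ ∧ ‖w‖ ≤ 2 * ‖z‖}.indicator
      (fun w => (z ^ 2 * (w ^ 2)⁻¹).re / 2) w = (z ^ 2 * {w : ℂ | r₁ ≤ ‖w‖ ∧
        ‖w‖ ≤ 2 * ‖z‖}.indicator (fun w => (w ^ 2)⁻¹) w).re / 2 := fun w => by
    by_cases hw : w ∈ {w : ℂ | r₁ ≤ ‖w‖ ∧ ‖w‖ ≤ 2 * ‖z‖}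
    · rw [indicator_of_mem hw, indicator_of_mem hw]
    · rw [indicator_of_notMem hw, indicator_of_notMem hw]
      simp
  have h4 : Integrable (fun w => {w : ℂ | r₁ ≤ ‖w‖ ∧ ‖w‖ ≤ 2 * ‖z‖}.indicator
      (fun w => (z ^ 2 * (w ^ 2)⁻¹).re / 2) w) P := by
    simp only [e]
    exact h3.re.div_const 2
  refine ⟨h4.add h2, ?_⟩
  simp only [principalPart]
  rw [integral_add h4 h2, integral_indicator hS.measurableSet]
  congr 1
  simp only [e]
  rw [integral_div, ← integral_indicator hm, ← integral_const_mul]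
  congr 1
  exact integral_re h3

end SignedField
end PauliZeroModes
-- The potential of a perturbation
namespace PauliZeroModes
open Filter Topology Set Metric

theorem integrable_mul_laplacian {f φ : ℂ → ℝ} (hf : LocallyIntegrable f)
    (hφ : ContDiff ℝ (⊤ : ℕ∞) φ) (hc : HasCompactSupport φ) :
    Integrable fun z => f z * Laplacian.laplacian φ z :=
  hf.integrable_smul_right_of_hasCompactSupport (continuous_laplacian (contDiff_two_of_top hφ))
    (hasCompactSupport_laplacian hc)

namespace SignedField

theorem isPotential_potential {μ : SignedField} {r₁ : ℝ} (hr : 0 < r₁)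
    (hP : IntegrableOn (fun w : ℂ => (‖w‖ ^ 3)⁻¹) {w | r₁ ≤ ‖w‖} μ.pos)
    (hN : IntegrableOn (fun w : ℂ => (‖w‖ ^ 3)⁻¹) {w | r₁ ≤ ‖w‖} μ.neg) :
    μ.IsPotential fun z => potential r₁ μ.pos z - potential r₁ μ.neg z := by
  have lP := locallyIntegrable_potential hr hP
  have lN := locallyIntegrable_potential hr hN
  refine ⟨lP.sub lN, fun φ hφ hc => ?_⟩
  have hφ2 := contDiff_two_of_top hφ
  simp only [sub_mul]
  rw [integral_sub (integrable_mul_laplacian lP hφ hc) (integrable_mul_laplacian lN hφ hc),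
    integral_potential_mul_laplacian hr hP hφ2 hc, integral_potential_mul_laplacian hr hN hφ2 hc]

theorem IsPerturbation.subsingleton {μ : SignedField} {r B δ : ℝ} (h : μ.IsPerturbation r B)
    (hδ : 2 * δ ≤ r) (z : ℂ) : (ball z δ ∩ μ.atoms).Subsingleton := fun _ hl _ hl' =>
  h.separated.eq_of_mem_ball hδ hl.2 hl'.2 (mem_ball'.1 hl.1) (mem_ball'.1 hl'.1)

/-- The point l need not be an atom of μ: if its intensity is zero, S is empty and both sides
vanish. This lets l range over the atoms of both fields. -/
theorem setIntegral_log_sub {μ : SignedField} {S : Set ℂ} {z l : ℂ} {δ : ℝ}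
    (hS : S = ball z δ ∩ μ.atoms) (hl : S ⊆ {l}) (hlz : dist z l < δ) :
    (∫ w in S, Real.log ‖z - w‖ ∂μ.pos) - ∫ w in S, Real.log ‖z - w‖ ∂μ.neg =
      2 * Real.pi * (μ.intensity l * Real.log (dist z l)) := by
  have hp := Real.pi_pos
  by_cases h : μ.intensity l = 0
  · have : S = ∅ := by
      rw [eq_empty_iff_forall_notMem]
      intro w hw
      have h1 := hl hw
      rw [mem_singleton_iff] at h1
      rw [hS] at hw
      exact hw.2 (h1 ▸ h)
    simp [this, h]
  · have : S = {l} := by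
      refine hl.antisymm (singleton_subset_iff.2 ?_)
      rw [hS]
      exact ⟨mem_ball'.2 hlz, h⟩
    rw [this, integral_singleton, integral_singleton, dist_eq_norm, intensity, smul_eq_mul,
      smul_eq_mul]
    field_simp

theorem abs_integral_sub_le {μ : SignedField} {f g : ℂ → ℝ} {Q : ℝ} (hQ : 0 ≤ Q)
    (hfP : Integrable f μ.pos) (hfN : Integrable f μ.neg) (hgP : Integrable g μ.pos)
    (hgN : Integrable g μ.neg)
    (h : ∫⁻ w, ENNReal.ofReal |f w - g w| ∂μ.variation ≤ ENNReal.ofReal Q) :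
    |((∫ w, f w ∂μ.pos) - ∫ w, f w ∂μ.neg) - ((∫ w, g w ∂μ.pos) - ∫ w, g w ∂μ.neg)| ≤ Q := by
  have hP := hfP.sub hgP
  have hN := hfN.sub hgN
  have e1 : ∫ w, |f w - g w| ∂μ.variation ≤ Q := by
    rw [integral_eq_lintegral_of_nonneg_ae (Eventually.of_forall fun _ => abs_nonneg _)]
    · exact ENNReal.toReal_le_of_le_ofReal hQ h
    · exact (hP.abs.add_measure hN.abs).aestronglyMeasurable
  have e2 : ∫ w, |f w - g w| ∂μ.variation =
      (∫ w, |f w - g w| ∂μ.pos) + ∫ w, |f w - g w| ∂μ.neg :=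
    integral_add_measure hP.abs hN.abs
  have e3 : ((∫ w, f w ∂μ.pos) - ∫ w, f w ∂μ.neg) - ((∫ w, g w ∂μ.pos) - ∫ w, g w ∂μ.neg) =
      (∫ w, (f w - g w) ∂μ.pos) - ∫ w, (f w - g w) ∂μ.neg := by
    rw [integral_sub hfP hgP, integral_sub hfN hgN]
    ring
  rw [e3]
  refine (abs_sub _ _).trans ?_
  have e4 := abs_integral_le_integral_abs (f := fun w => f w - g w) (μ := μ.pos)
  have e5 := abs_integral_le_integral_abs (f := fun w => f w - g w) (μ := μ.neg)
  linarith

/-- The potential of a small perturbation is bounded below, up to its logarithmic poles, by a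
small multiple of `‖z‖²`. -/
theorem IsPerturbation.exists_potential {μ : SignedField} {r B A ε : ℝ} (hr : 0 < r)
    (h : μ.IsPerturbation r B) (hA : 0 ≤ A)
    (hA' : ∀ z s, 0 < s → μ.variation (ball z s) ≤ ENNReal.ofReal (A * s ^ 2 + A))
    (hε : 0 < ε) (hε' : ε ≤ 1 / 2) (hsmall : μ.IsSmall ε) :
    ∃ Ψ : ℂ → ℝ, μ.IsPotential Ψ ∧ ∀ δ, 0 < δ → 2 * δ ≤ r → δ ≤ 1 / 2 →
      ∃ E R : ℝ, ∀ᵐ z : ℂ, R ≤ ‖z‖ →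
        (∀ l, ball z δ ∩ μ.atoms ⊆ {l} → dist z l < δ →
          μ.intensity l * Real.log (dist z l) - ((601 + 32 * A) * (ε * Real.log (1 / ε)) * ‖z‖ ^ 2 +
            E * ‖z‖) ≤ Ψ z) ∧
        (ball z δ ∩ μ.atoms = ∅ →
          -((601 + 32 * A) * (ε * Real.log (1 / ε)) * ‖z‖ ^ 2 + E * ‖z‖) ≤ Ψ z) := by
  obtain ⟨r₁, R₀, hr₁, hs⟩ := hsmall
  obtain ⟨D, hD, hν⟩ := exists_variation_ball_zero_le hε fun ρ hρ => (hs ρ hρ).1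
  have cP := integrableOn_inv_cube hε.le hD hν hr₁ μ.pos_le_variation
  have cN := integrableOn_inv_cube hε.le hD hν hr₁ μ.neg_le_variation
  refine ⟨_, isPotential_potential hr₁ cP cN, fun δ hδ hδr hδ' => ?_⟩
  have hL : MeasurableSet μ.atoms := (h.separated.isClosed hr).measurableSet
  have hlog : ∀ z, ∫⁻ w in ball z δ ∩ μ.atomsᶜ, ENNReal.ofReal |Real.log ‖w - z‖| ∂μ.variation ≤
      ENNReal.ofReal |B| := fun z => by
    refine le_trans ?_ ((h.log_bound z).trans (ENNReal.ofReal_le_ofReal (le_abs_self B)))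
    rw [contVariation, Measure.restrict_restrict measurableSet_ball]
    exact lintegral_mono_set (inter_subset_inter_left _ (ball_subset_ball (by linarith)))
  obtain ⟨E, hE, hK⟩ := lintegral_kernel_sub_principalPart_le hL hr₁ hδ hδ' hε hε' hA hD
    (abs_nonneg B) hν hA' hlog
  refine ⟨E, max 1 (max r₁ R₀), ?_⟩
  filter_upwards [ae_integrable_kernel hr₁ cP, ae_integrable_kernel hr₁ cN] with z kP kN hz
  have hz1 : 1 ≤ ‖z‖ := (le_max_left _ _).trans hz
  have hzr : r₁ ≤ ‖z‖ := (le_max_left _ _).trans ((le_max_right _ _).trans hz)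
  have hzR : R₀ < 2 * ‖z‖ := by
    linarith [(le_max_right r₁ R₀).trans ((le_max_right _ _).trans hz)]
  set S := ball z δ ∩ μ.atoms with hS
  have hSs : S.Subsingleton := h.subsingleton hδr z
  obtain ⟨pP, eP⟩ := integral_principalPart (P := μ.pos) hr₁ hSs z
  obtain ⟨pN, eN⟩ := integral_principalPart (P := μ.neg) hr₁ hSs z
  set ℓ := Real.log (1 / ε) with hℓ
  have hℓ2 : 1 ≤ 2 * ℓ := by
    have h1 : Real.log 2 ≤ ℓ := Real.log_le_log (by norm_num) (by
      rw [le_div_iff₀ hε]; linarith)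
    have := Real.one_sub_inv_le_log_of_pos (x := 2) (by norm_num)
    norm_num at this
    linarith
  have hℓ0 : 0 ≤ ℓ := by linarith
  have hQ : 0 ≤ (600 + 32 * A) * (ε * ℓ) * ‖z‖ ^ 2 + E * ‖z‖ := by positivity
  have key := abs_integral_sub_le hQ kP kN pP pN (hK z hz1 hzr)
  have hM : |(z ^ 2 * μ.secondMoment r₁ (2 * ‖z‖)).re| ≤ ‖z‖ ^ 2 * ε := by
    refine (Complex.abs_re_le_norm _).trans ?_
    rw [norm_mul, norm_pow]
    gcongr
    exact (hs _ hzR).2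
  rw [eP, eN] at key
  have hM' : (z ^ 2 * μ.secondMoment r₁ (2 * ‖z‖)).re =
      (z ^ 2 * ∫ w in {w : ℂ | r₁ ≤ ‖w‖ ∧ ‖w‖ ≤ 2 * ‖z‖}, (w ^ 2)⁻¹ ∂μ.pos).re -
      (z ^ 2 * ∫ w in {w : ℂ | r₁ ≤ ‖w‖ ∧ ‖w‖ ≤ 2 * ‖z‖}, (w ^ 2)⁻¹ ∂μ.neg).re := by
    rw [secondMoment, mul_sub, Complex.sub_re]
  have hpi : 1 ≤ 2 * Real.pi := by linarith [Real.two_le_pi]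
  -- The moment term costs |Re(z²M)|/2 ≤ ε|z|²/2 ≤ ε log(1/ε)|z|², which raises 600 to 601. In the
  -- division of the error by 2π only 2π ≥ 1 is used.
  have main : ∀ t, (∫ w in S, Real.log ‖z - w‖ ∂μ.pos) - ∫ w in S, Real.log ‖z - w‖ ∂μ.neg =
      2 * Real.pi * t → t - ((601 + 32 * A) * (ε * ℓ) * ‖z‖ ^ 2 + E * ‖z‖) ≤
        potential r₁ μ.pos z - potential r₁ μ.neg z := by
    intro t ht
    have e1 : 2 * Real.pi * (potential r₁ μ.pos z - potential r₁ μ.neg z) =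
        (∫ w, kernel r₁ z w ∂μ.pos) - ∫ w, kernel r₁ z w ∂μ.neg := by
      simp only [potential]
      field_simp
    have hd : ‖z‖ ^ 2 * ε ≤ 2 * (ε * ℓ * ‖z‖ ^ 2) := by
      have := mul_le_mul_of_nonneg_left hℓ2 (by positivity : 0 ≤ ‖z‖ ^ 2 * ε)
      linarith
    have k1 := (abs_le.1 key).1
    have k2 := (abs_le.1 hM).1
    rw [hM'] at k2
    have hQ' : 0 ≤ (601 + 32 * A) * (ε * ℓ) * ‖z‖ ^ 2 + E * ‖z‖ := by positivity
    have e2 : 2 * Real.pi * t - ((601 + 32 * A) * (ε * ℓ) * ‖z‖ ^ 2 + E * ‖z‖) ≤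
        2 * Real.pi * (potential r₁ μ.pos z - potential r₁ μ.neg z) := by
      rw [e1, ← ht]
      linarith
    have e3 := mul_le_mul_of_nonneg_right hpi hQ'
    have e4 : 0 ≤ 2 * Real.pi * ((potential r₁ μ.pos z - potential r₁ μ.neg z) -
        (t - ((601 + 32 * A) * (ε * ℓ) * ‖z‖ ^ 2 + E * ‖z‖))) := by linarith
    have := nonneg_of_mul_nonneg_right e4 (by linarith)
    linarith
  refine ⟨fun l hl hlz => main _ (setIntegral_log_sub hS hl hlz), fun h0 => ?_⟩
  have := main 0 (by simp [h0])
  linarith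

/-! ### Sums of fields -/

/-- Jordan parts do not add, because masses may cancel. This subtraction-free identity is what
transfers intensities and integrals of test functions to the sum. -/
theorem add_pos (μ ν : SignedField) :
    (μ + ν).pos + (μ.neg + ν.neg) = (μ.pos + ν.pos) + (μ + ν).neg :=
  excess_add (μ.pos + ν.pos) (μ.neg + ν.neg)

theorem intensity_add (μ ν : SignedField) (z : ℂ) :
    (μ + ν).intensity z = μ.intensity z + ν.intensity z := by
  have h := congrArg (fun P : Measure ℂ => P.real {z}) (add_pos μ ν)
  simp only [measureReal_add_apply (measure_singleton_lt_top).ne (measure_singleton_lt_top).ne] at h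
  simp only [intensity]
  rw [← add_div]
  congr 1
  linarith

theorem IsPotential.add {μ ν : SignedField} {Ψ Φ : ℂ → ℝ} (hΨ : μ.IsPotential Ψ)
    (hΦ : ν.IsPotential Φ) : (μ + ν).IsPotential fun z => Ψ z + Φ z := by
  refine ⟨hΨ.1.add hΦ.1, fun φ hφ hc => ?_⟩
  have hi : ∀ (P : Measure ℂ) [IsLocallyFiniteMeasure P], Integrable φ P := fun P _ =>
    hφ.continuous.integrable_of_hasCompactSupport hc
  simp only [add_mul]
  rw [integral_add (integrable_mul_laplacian hΨ.1 hφ hc) (integrable_mul_laplacian hΦ.1 hφ hc),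
    hΨ.2 φ hφ hc, hΦ.2 φ hφ hc]
  have h := congrArg (fun P : Measure ℂ => ∫ z, φ z ∂P) (add_pos μ ν)
  rw [integral_add_measure (hi _) (hi _), integral_add_measure (hi _) (hi _),
    integral_add_measure (hi _) (hi _), integral_add_measure (hi _) (hi _)] at h
  linarith

theorem atoms_add_subset (μ ν : SignedField) : (μ + ν).atoms ⊆ μ.atoms ∪ ν.atoms := by
  intro z hz
  by_contra h
  simp only [mem_union, not_or, atoms, mem_ofPred_eq, not_not] at h
  exact hz (by rw [intensity_add, h.1, h.2, add_zero])

end SignedField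
end PauliZeroModes
-- Quadratic lower bounds with logarithmic poles
namespace PauliZeroModes
open Filter Topology Set Metric

theorem UniformlyDiscrete.mono {L L' : Set ℂ} {r : ℝ} (h : UniformlyDiscrete L r) (hL : L' ⊆ L) :
    UniformlyDiscrete L' r := fun l hl l' hl' => h l (hL hl) l' (hL hl')

theorem UniformlyDiscrete.exists_nearest {L : Set ℂ} {r : ℝ} (hr : 0 < r)
    (h : UniformlyDiscrete L r) (hL : L.Nonempty) (z : ℂ) :
    ∃ l ∈ L, ∀ l' ∈ L, dist z l ≤ dist z l' := by
  obtain ⟨l, hl, he⟩ := (h.isClosed hr).exists_infDist_eq_dist hL z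
  exact ⟨l, hl, fun l' hl' => he ▸ infDist_le_dist_of_mem hl'⟩

/-- Far from the poles, the logarithmic term is of lower order. -/
theorem abs_mul_log_dist_le {α K δ d c t : ℝ} (hα : |α| ≤ K) (hδ : 0 < δ) (hd : δ ≤ d)
    (hdc : d ≤ t + c) :
    |α * Real.log d| ≤ K * (c + |Real.log δ|) + K * t := by
  have hd0 : 0 < d := hδ.trans_le hd
  have hlog : |Real.log d| ≤ t + c + |Real.log δ| := by
    have h1 := Real.log_le_log hδ hd
    have h2 := Real.log_le_sub_one_of_pos hd0
    rw [abs_le]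
    constructor
    · linarith [neg_abs_le (Real.log δ)]
    · linarith [abs_nonneg (Real.log δ)]
  rw [abs_mul]
  have := mul_le_mul hα hlog (abs_nonneg _) ((abs_nonneg _).trans hα)
  linarith

namespace SignedField

/-- A lower bound by `γ ‖z‖² - E ‖z‖` up to logarithmic poles at the points of `S`, where only the
poles at distance less than `δ` are taken into account. -/
def PoleLowerBound (α : ℂ → ℝ) (S : Set ℂ) (Ψ : ℂ → ℝ) (δ γ : ℝ) : Prop :=
  ∃ E R : ℝ, ∀ᵐ z : ℂ, R ≤ ‖z‖ →
    (∀ l ∈ S, dist z l < δ → α l * Real.log (dist z l) + γ * ‖z‖ ^ 2 - E * ‖z‖ ≤ Ψ z) ∧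
    ((∀ l ∈ S, δ ≤ dist z l) → γ * ‖z‖ ^ 2 - E * ‖z‖ ≤ Ψ z)

/-- The nearest-atom form of the bound is not additive, since two fields have different nearest
atoms. With poles indexed by one common set S it is, even where intensities cancel. -/
theorem PoleLowerBound.add {α β : ℂ → ℝ} {S : Set ℂ} {Ψ Φ : ℂ → ℝ} {δ γ κ : ℝ}
    (h : PoleLowerBound α S Ψ δ γ) (h' : PoleLowerBound β S Φ δ κ) :
    PoleLowerBound (fun z => α z + β z) S (fun z => Ψ z + Φ z) δ (γ + κ) := by
  obtain ⟨E, R, h⟩ := h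
  obtain ⟨E', R', h'⟩ := h'
  refine ⟨E + E', max R R', ?_⟩
  filter_upwards [h, h'] with z h1 h2 hz
  obtain ⟨a1, a2⟩ := h1 ((le_max_left _ _).trans hz)
  obtain ⟨b1, b2⟩ := h2 ((le_max_right _ _).trans hz)
  refine ⟨fun l hl hlz => ?_, fun hl => ?_⟩
  · linarith [a1 l hl hlz, b1 l hl hlz]
  · linarith [a2 hl, b2 hl]

/-- An atom within δ of z is the nearest one, S being separated. A nearest atom farther away lies at
distance at most ‖z‖ + ‖l₁‖, so its logarithm is O(‖z‖) and goes into E. -/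
theorem QuadraticLowerBound.poleLowerBound {μ : SignedField} {Ψ : ℂ → ℝ} {γ δ r : ℝ} {S : Set ℂ}
    (h : μ.QuadraticLowerBound Ψ γ) (hS : UniformlyDiscrete S r) (hr : 0 < r) (hμ : μ.atoms ⊆ S)
    (hδ : 0 < δ) (hδr : 2 * δ ≤ r) {K : ℝ} (hK : ∀ l ∈ μ.atoms, |μ.intensity l| ≤ K) :
    PoleLowerBound μ.intensity S Ψ δ γ := by
  obtain ⟨R, h⟩ := h
  have hsep := hS.mono hμ
  rcases μ.atoms.eq_empty_or_nonempty with h0 | ⟨l₁, hl₁⟩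
  · refine ⟨0, R, ?_⟩
    filter_upwards [h] with z hz hzR
    have h1 := (hz hzR).1 h0
    refine ⟨fun l _ _ => ?_, fun _ => by linarith⟩
    have : μ.intensity l = 0 := by
      by_contra hne
      exact eq_empty_iff_forall_notMem.1 h0 l hne
    rw [this]
    linarith
  · have hK0 : 0 ≤ K := (abs_nonneg _).trans (hK l₁ hl₁)
    refine ⟨K * (‖l₁‖ + |Real.log δ|) + K, max R 1, ?_⟩
    filter_upwards [h] with z hz hzR
    have hz1 : 1 ≤ ‖z‖ := (le_max_right _ _).trans hzR
    obtain ⟨-, hz⟩ := hz ((le_max_left _ _).trans hzR)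
    have hc : 0 ≤ K * (‖l₁‖ + |Real.log δ|) := by positivity
    have hc' := le_mul_of_one_le_right hc hz1
    have hE : 0 ≤ (K * (‖l₁‖ + |Real.log δ|) + K) * ‖z‖ := by positivity
    obtain ⟨l₀, hl₀, hmin⟩ := hsep.exists_nearest hr ⟨l₁, hl₁⟩ z
    have hnear := hz l₀ hl₀ hmin
    have hfar : δ ≤ dist z l₀ → γ * ‖z‖ ^ 2 - (K * (‖l₁‖ + |Real.log δ|) + K) * ‖z‖ ≤ Ψ z := by
      intro hd
      have := abs_mul_log_dist_le (hK l₀ hl₀) hδ hd ((hmin l₁ hl₁).trans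
        ((dist_eq_norm z l₁).le.trans (norm_sub_le z l₁)))
      have := (abs_le.1 this).1
      linarith
    refine ⟨fun l hl hlz => ?_, fun hall => hfar (hall l₀ (hμ hl₀))⟩
    -- If the point of S near z is not an atom of μ, separation pushes all atoms of μ to distance at
    -- least δ.
    by_cases hlμ : μ.intensity l = 0
    · have hd : δ ≤ dist z l₀ := by
        by_contra hlt
        have := hS.eq_of_mem_ball hδr hl (hμ hl₀) hlz (not_le.1 hlt)
        exact hl₀ (this ▸ hlμ)
      rw [hlμ]
      linarith [hfar hd]
    · have : l = l₀ := hS.eq_of_mem_ball hδr hl (hμ hl₀) hlz ((hmin l hlμ).trans_lt hlz)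
      rw [this]
      linarith

/-- The slack γ - γ' absorbs, for large ‖z‖, both E‖z‖ and the O(‖z‖) logarithm of a distant nearest
atom. A point of S whose intensity cancelled contributes no pole. -/
theorem PoleLowerBound.quadraticLowerBound {μ : SignedField} {Ψ : ℂ → ℝ} {γ γ' δ r : ℝ} {S : Set ℂ}
    (h : PoleLowerBound μ.intensity S Ψ δ γ) (hS : UniformlyDiscrete S r) (hμ : μ.atoms ⊆ S)
    (hδ : 0 < δ) (hδr : 2 * δ ≤ r) {K : ℝ} (hK : ∀ l ∈ μ.atoms, |μ.intensity l| ≤ K)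
    (hγ : γ' < γ) : μ.QuadraticLowerBound Ψ γ' := by
  obtain ⟨E, R, h⟩ := h
  obtain ⟨F, hF⟩ : ∃ F, ∀ z l : ℂ, 1 ≤ ‖z‖ → l ∈ μ.atoms → (∀ l' ∈ μ.atoms, dist z l ≤ dist z l') →
      δ ≤ dist z l → |μ.intensity l * Real.log (dist z l)| ≤ F * ‖z‖ := by
    rcases μ.atoms.eq_empty_or_nonempty with h0 | ⟨l₁, hl₁⟩
    · exact ⟨0, fun z l _ hl => absurd hl (by simp [h0])⟩
    · have hK0 : 0 ≤ K := (abs_nonneg _).trans (hK l₁ hl₁)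
      refine ⟨K * (‖l₁‖ + |Real.log δ|) + K, fun z l hz1 hl hmin hd => ?_⟩
      have hc : 0 ≤ K * (‖l₁‖ + |Real.log δ|) := by positivity
      have hc' := le_mul_of_one_le_right hc hz1
      have := abs_mul_log_dist_le (hK l hl) hδ hd ((hmin l₁ hl₁).trans
        ((dist_eq_norm z l₁).le.trans (norm_sub_le z l₁)))
      linarith
  set G := |E| + |F|
  refine ⟨max (max R 1) (G / (γ - γ')), ?_⟩
  filter_upwards [h] with z hz hzR
  have hz1 : 1 ≤ ‖z‖ := (le_max_right R 1).trans ((le_max_left _ _).trans hzR)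
  have hzG : G * ‖z‖ ≤ (γ - γ') * ‖z‖ ^ 2 := by
    have : G / (γ - γ') ≤ ‖z‖ := (le_max_right _ _).trans hzR
    rw [div_le_iff₀ (by linarith)] at this
    nlinarith
  have hE : E * ‖z‖ ≤ |E| * ‖z‖ := by gcongr; exact le_abs_self E
  have hF' : F * ‖z‖ ≤ |F| * ‖z‖ := by gcongr; exact le_abs_self F
  have hE0 : 0 ≤ |E| * ‖z‖ := by positivity
  have hF0 : 0 ≤ |F| * ‖z‖ := by positivity
  have hG : G * ‖z‖ = |E| * ‖z‖ + |F| * ‖z‖ := add_mul _ _ _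
  obtain ⟨h1, h2⟩ := hz ((le_max_left R 1).trans ((le_max_left _ _).trans hzR))
  have hno : ∀ l ∈ μ.atoms, (∀ l' ∈ μ.atoms, dist z l ≤ dist z l') → δ ≤ dist z l →
      γ * ‖z‖ ^ 2 - E * ‖z‖ ≤ Ψ z → γ' * ‖z‖ ^ 2 ≤ Ψ z - μ.intensity l * Real.log (dist z l) := by
    intro l hl hmin hd hΨ
    have := (abs_le.1 (hF z l hz1 hl hmin hd)).2
    linarith
  have hcase : (∀ l ∈ S, δ ≤ dist z l) ∨ ∃ s ∈ S, dist z s < δ := by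
    by_contra! hcon
    obtain ⟨⟨l, hl, hl1⟩, hl2⟩ := hcon
    exact absurd (hl2 l hl) (not_le.2 hl1)
  rcases hcase with hall | ⟨s, hs, hsz⟩
  · have hΨ := h2 hall
    exact ⟨fun _ => by linarith, fun l hl hmin => hno l hl hmin (hall l (hμ hl)) hΨ⟩
  · have hΨ := h1 s hs hsz
    by_cases hsμ : μ.intensity s = 0
    · rw [hsμ, zero_mul, zero_add] at hΨ
      refine ⟨fun _ => by linarith, fun l hl hmin => hno l hl hmin ?_ hΨ⟩
      by_contra hlt
      have := hS.eq_of_mem_ball hδr (hμ hl) hs (not_le.1 hlt) hsz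
      exact hl (this ▸ hsμ)
    · refine ⟨fun h0 => absurd hsμ (fun hne => eq_empty_iff_forall_notMem.1 h0 s hne),
        fun l hl hmin => ?_⟩
      have : l = s := hS.eq_of_mem_ball hδr (hμ hl) hs ((hmin s hsμ).trans_lt hsz) hsz
      rw [this]
      linarith

theorem IsPerturbation.exists_poleLowerBound {μ : SignedField} {r B A ε : ℝ} (hr : 0 < r)
    (h : μ.IsPerturbation r B) (hA : 0 ≤ A)
    (hA' : ∀ z s, 0 < s → μ.variation (ball z s) ≤ ENNReal.ofReal (A * s ^ 2 + A))
    (hε : 0 < ε) (hε' : ε ≤ 1 / 2) (hsmall : μ.IsSmall ε) :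
    ∃ Φ : ℂ → ℝ, μ.IsPotential Φ ∧ ∀ (S : Set ℂ) (r' δ : ℝ), UniformlyDiscrete S r' → μ.atoms ⊆ S →
      0 < δ → 2 * δ ≤ r' → 2 * δ ≤ r → δ ≤ 1 / 2 →
      PoleLowerBound μ.intensity S Φ δ (-((601 + 32 * A) * (ε * Real.log (1 / ε)))) := by
  obtain ⟨Φ, hΦ, H⟩ := h.exists_potential hr hA hA' hε hε' hsmall
  refine ⟨Φ, hΦ, fun S r' δ hS hμ hδ hδr' hδr hδ1 => ?_⟩
  obtain ⟨E, R, H⟩ := H δ hδ hδr hδ1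
  refine ⟨E, R, ?_⟩
  filter_upwards [H] with z hz hzR
  obtain ⟨h1, h2⟩ := hz hzR
  refine ⟨fun l hl hlz => ?_, fun hall => ?_⟩
  · have := h1 l (fun w hw => hS.eq_of_mem_ball hδr' (hμ hw.2) hl (mem_ball'.1 hw.1) hlz) hlz
    linarith
  · have := h2 (eq_empty_iff_forall_notMem.2 fun w hw =>
      absurd (hall w (hμ hw.2)) (not_le.2 (mem_ball'.1 hw.1)))
    linarith

theorem abs_intensity_le_one {μ : SignedField} (h : μ.MaxNormalized ∨ μ.EVNormalized) :
    ∀ l ∈ μ.atoms, |μ.intensity l| ≤ 1 := by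
  intro l hl
  rw [abs_le]
  rcases h with ⟨θ, hθ, h⟩ | h
  · constructor <;> linarith [(h l hl).1, (h l hl).2]
  · constructor <;> linarith [(h l hl).1, (h l hl).2]

theorem abs_intensity_add_le {μ ν : SignedField} {a b : ℝ} (ha : 0 ≤ a) (hb : 0 ≤ b)
    (hμ : ∀ l ∈ μ.atoms, |μ.intensity l| ≤ a) (hν : ∀ l ∈ ν.atoms, |ν.intensity l| ≤ b) (l : ℂ) :
    |(μ + ν).intensity l| ≤ a + b := by
  have h : ∀ {κ : SignedField} {c : ℝ}, 0 ≤ c → (∀ l ∈ κ.atoms, |κ.intensity l| ≤ c) →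
      |κ.intensity l| ≤ c := fun {κ c} hc hκ => by
    by_cases h0 : κ.intensity l = 0
    · simpa [h0]
    · exact hκ l h0
  rw [intensity_add]
  exact (abs_add_le _ _).trans (add_le_add (h ha hμ) (h hb hν))

end SignedField
end PauliZeroModes
-- Integrability of e^{-2Ψ} with polynomial weights
namespace PauliZeroModes
open Metric Set Filter Topology

/-- By Tonelli the global integral is an average of integrals over small discs, which turns uniform
local bounds on the poles into global ones. -/
theorem volume_ball_mul_lintegral {f : ℂ → ENNReal} (hf : Measurable f) (δ : ℝ) :
    volume (ball (0 : ℂ) δ) * ∫⁻ z, f z = ∫⁻ a, ∫⁻ z in ball a δ, f z := by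
  have hm : Measurable (Function.uncurry fun a z : ℂ => (ball a δ).indicator f z) :=
    (hf.comp measurable_snd).indicator (s := {p : ℂ × ℂ | dist p.2 p.1 < δ})
      (measurableSet_lt (by fun_prop) measurable_const)
  simp only [← lintegral_indicator measurableSet_ball]
  rw [lintegral_lintegral_swap hm.aemeasurable, ← lintegral_const_mul _ hf]
  refine lintegral_congr fun z => ?_
  have : ∀ a, (ball a δ).indicator f z = (ball z δ).indicator (fun _ => f z) a := fun a => by
    simp only [indicator, mem_ball, dist_comm]
  simp only [this]
  rw [lintegral_indicator measurableSet_ball, setLIntegral_const, mul_comm, ← Measure.addHaar_ball_center volume z]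

theorem integrable_exp_neg_mul_norm_sq {c : ℝ} (hc : 0 < c) :
    Integrable fun z : ℂ => Real.exp (-c * ‖z‖ ^ 2) := by
  have h := (GaussianFourier.integrable_cexp_neg_mul_sq_norm_add (b := (c : ℂ)) (by simpa) 0
    (0 : ℂ)).norm
  refine h.congr (Eventually.of_forall fun z => ?_)
  simp only [Complex.norm_exp]
  congr 1
  simp [← Complex.ofReal_pow]

/-- The singular factor `d ^ (-s)` near a discrete set, `d` being the distance to the set. -/
noncomputable def poleFactor (S : Set ℂ) (s δ : ℝ) (z : ℂ) : ℝ :=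
  if infDist z S < δ then Real.exp (-s * Real.log (infDist z S)) else 0

theorem measurable_poleFactor (S : Set ℂ) (s δ : ℝ) : Measurable (poleFactor S s δ) :=
  Measurable.ite (measurableSet_lt measurable_infDist measurable_const)
    (Real.measurable_exp.comp ((Real.measurable_log.comp measurable_infDist).const_mul _))
    measurable_const

theorem poleFactor_nonneg (S : Set ℂ) (s δ : ℝ) (z : ℂ) : 0 ≤ poleFactor S s δ z := by
  unfold poleFactor
  split_ifs <;> positivity

/-- Only poles within 2δ of a can matter, and 4δ ≤ r leaves at most one; translating it to the
origin gives a bound independent of a. -/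
theorem setLIntegral_poleFactor_le {S : Set ℂ} {s δ r : ℝ} (hS : UniformlyDiscrete S r)
    (hr : 0 < r) (h0 : S.Nonempty) (hδr : 4 * δ ≤ r) (a : ℂ) :
    ∫⁻ z in ball a δ, ENNReal.ofReal (poleFactor S s δ z) ≤
      ∫⁻ z in ball (0 : ℂ) δ, ENNReal.ofReal (Real.exp (-s * Real.log ‖z‖)) := by
  have key : ∀ z, infDist z S < δ → ∃ l ∈ S, infDist z S = dist z l := fun z _ =>
    (hS.isClosed hr).exists_infDist_eq_dist h0 z
  by_cases hl : ∃ l ∈ S, dist a l < 2 * δ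
  · obtain ⟨l, hlS, hl⟩ := hl
    have e : ∫⁻ z in ball l δ, ENNReal.ofReal (Real.exp (-s * Real.log ‖z - l‖)) =
        ∫⁻ z in ball (0 : ℂ) δ, ENNReal.ofReal (Real.exp (-s * Real.log ‖z‖)) := by
      have := (measurePreserving_sub_right (volume : Measure ℂ) l).setLIntegral_comp_preimage_emb
        (measurableEmbedding_subRight l)
        (fun z => ENNReal.ofReal (Real.exp (-s * Real.log ‖z‖))) (ball 0 δ)
      rw [← this]
      congr 2
      ext z
      simp [dist_eq_norm]
    rw [← e, ← lintegral_indicator measurableSet_ball, ← lintegral_indicator measurableSet_ball]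
    refine lintegral_mono fun z => ?_
    by_cases hz : z ∈ ball a δ
    · rw [indicator_of_mem hz, poleFactor]
      split_ifs with hd
      · obtain ⟨l', hl', he⟩ := key z hd
        have hll : l' = l := by
          refine hS.eq_of_mem_ball (z := a) (δ := 2 * δ) (by linarith) hl' hlS ?_ hl
          have := dist_triangle a z l'
          rw [mem_ball, dist_comm] at hz
          linarith
        subst hll
        rw [he] at hd ⊢
        rw [indicator_of_mem (by simpa using hd), dist_eq_norm]
      · simp
    · rw [indicator_of_notMem hz]
      exact zero_le
  · refine (setLIntegral_mono' (g := fun _ => 0) measurableSet_ball fun z hz => ?_).trans (by simp)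
    rw [poleFactor, if_neg, ENNReal.ofReal_zero]
    intro hd
    obtain ⟨l', hl', he⟩ := key z hd
    refine hl ⟨l', hl', ?_⟩
    have := dist_triangle a z l'
    rw [mem_ball, dist_comm] at hz
    linarith

/-- On a disc of radius δ ≤ 1 about a, |a|² ≤ 2|z|² + 2, so the Gaussian is at most e^c
e^{-c|a|²/2}. The pole factor has uniformly bounded integral there, and averaging over a finishes.
-/
theorem integrable_gaussian_mul_poleFactor {S : Set ℂ} {s δ r c : ℝ} (hS : UniformlyDiscrete S r)
    (hs : s < 2) (hc : 0 < c) (hδ : 0 < δ) (hδ1 : δ ≤ 1) (hδr : 4 * δ ≤ r) :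
    Integrable fun z => Real.exp (-c * ‖z‖ ^ 2) * poleFactor S s δ z := by
  rcases S.eq_empty_or_nonempty with rfl | h0
  -- The distance to the empty set is 0 by convention and `Real.log 0 = 0`, so the pole factor is
  -- then identically 1.
  · simpa [poleFactor, hδ] using integrable_exp_neg_mul_norm_sq hc
  have hm : Measurable fun z => Real.exp (-c * ‖z‖ ^ 2) * poleFactor S s δ z :=
    (Continuous.measurable (by fun_prop)).mul (measurable_poleFactor S s δ)
  have hnn : ∀ z, 0 ≤ Real.exp (-c * ‖z‖ ^ 2) * poleFactor S s δ z := fun z =>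
    mul_nonneg (Real.exp_pos _).le (poleFactor_nonneg _ _ _ _)
  refine ⟨hm.aestronglyMeasurable, ?_⟩
  rw [hasFiniteIntegral_iff_ofReal (Eventually.of_forall hnn)]
  have hG : ∫⁻ a : ℂ, ENNReal.ofReal (Real.exp c * Real.exp (-(c / 2) * ‖a‖ ^ 2)) < ⊤ :=
    (hasFiniteIntegral_iff_ofReal (Eventually.of_forall fun a => (by positivity : 0 ≤
      Real.exp c * Real.exp (-(c / 2) * ‖a‖ ^ 2)))).1
      ((integrable_exp_neg_mul_norm_sq (half_pos hc)).const_mul (Real.exp c)).2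
  have hI : ∫⁻ z in ball (0 : ℂ) δ, ENNReal.ofReal (Real.exp (-s * Real.log ‖z‖)) < ⊤ :=
    (hasFiniteIntegral_iff_ofReal (Eventually.of_forall fun z => (Real.exp_pos _).le)).1
      (integrableOn_exp_neg_mul_log hs δ).2
  have h1 := volume_ball_mul_lintegral hm.ennreal_ofReal δ
  have h2 : ∫⁻ a : ℂ, ∫⁻ z in ball a δ,
      ENNReal.ofReal (Real.exp (-c * ‖z‖ ^ 2) * poleFactor S s δ z) ≤
      ∫⁻ a : ℂ, ENNReal.ofReal (Real.exp c * Real.exp (-(c / 2) * ‖a‖ ^ 2)) *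
        ∫⁻ z in ball (0 : ℂ) δ, ENNReal.ofReal (Real.exp (-s * Real.log ‖z‖)) := by
    refine lintegral_mono fun a => ?_
    refine le_trans ?_ (mul_le_mul_right
      (setLIntegral_poleFactor_le hS (by linarith) h0 hδr a) _)
    rw [← lintegral_const_mul _ (measurable_poleFactor S s δ).ennreal_ofReal]
    refine setLIntegral_mono' measurableSet_ball fun z hz => ?_
    rw [← ENNReal.ofReal_mul (by positivity)]
    refine ENNReal.ofReal_le_ofReal (mul_le_mul_of_nonneg_right ?_ (poleFactor_nonneg _ _ _ _))
    rw [← Real.exp_add, Real.exp_le_exp]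
    have h3 : ‖a‖ ≤ ‖z‖ + 1 := by
      rw [mem_ball, dist_comm, dist_eq_norm] at hz
      have := norm_le_norm_add_norm_sub' a z
      linarith
    nlinarith [norm_nonneg a, norm_nonneg z, sq_nonneg (‖z‖ - 1),
      pow_le_pow_left₀ (norm_nonneg a) h3 2]
  rw [lintegral_mul_const' _ _ hI.ne] at h2
  have h3 : volume (ball (0 : ℂ) δ) * _ < ⊤ := h1 ▸ h2.trans_lt (ENNReal.mul_lt_top hG hI)
  exact ENNReal.lt_top_of_mul_ne_top_right h3.ne (measure_ball_pos _ _ hδ).ne'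

namespace SignedField

theorem pos_real_singleton_lt {μ : SignedField} {θ : ℝ} (hθ : θ < 1)
    (h : ∀ l ∈ μ.atoms, μ.intensity l ≤ θ) (z : ℂ) : μ.pos.real {z} < 2 * Real.pi := by
  have hpi := Real.pi_pos
  rcases μ.pos_or_neg_singleton z with h0 | h0
  · simp only [Measure.real, h0, ENNReal.toReal_zero]
    positivity
  · have e : μ.intensity z = μ.pos.real {z} / (2 * Real.pi) := by
      simp [intensity, Measure.real, h0]
    have h1 : μ.intensity z < 1 := by
      by_cases hz : μ.intensity z = 0
      · rw [hz]; exact one_pos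
      · exact (h z hz).trans_lt hθ
    rwa [e, div_lt_one (by positivity)] at h1

end SignedField

/-- Of the exponent -2γt², one part γt²/2 absorbs the power, another γt²/2 absorbs the linear term,
and -γt² is left. -/
theorem pow_mul_exp_le {γ : ℝ} (hγ : 0 < γ) (E : ℝ) (n : ℕ) :
    ∃ K : ℝ, ∀ t : ℝ, t ^ (2 * n) * Real.exp (-2 * (γ * t ^ 2 - E * t)) ≤
      K * Real.exp (-γ * t ^ 2) := by
  refine ⟨n.factorial * (2 / γ) ^ n * Real.exp (2 * E ^ 2 / γ), fun t => ?_⟩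
  have h1 := Real.pow_div_factorial_le_exp (x := γ / 2 * t ^ 2) (by positivity) n
  have h2 : t ^ (2 * n) ≤ n.factorial * (2 / γ) ^ n * Real.exp (γ / 2 * t ^ 2) := by
    rw [div_le_iff₀ (by positivity)] at h1
    calc t ^ (2 * n) = (2 / γ) ^ n * (γ / 2 * t ^ 2) ^ n := by
          rw [← mul_pow, ← mul_assoc, div_mul_div_cancel₀ hγ.ne', div_self two_ne_zero, one_mul,
            pow_mul]
      _ ≤ (2 / γ) ^ n * (Real.exp (γ / 2 * t ^ 2) * n.factorial) := by gcongr
      _ = _ := by ring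
  calc _ ≤ n.factorial * (2 / γ) ^ n * Real.exp (γ / 2 * t ^ 2) *
        Real.exp (-2 * (γ * t ^ 2 - E * t)) := by gcongr
    _ ≤ _ := by
      rw [mul_assoc, mul_assoc (_ * _) (Real.exp _), ← Real.exp_add, ← Real.exp_add]
      refine mul_le_mul_of_nonneg_left (Real.exp_le_exp.2 ?_) (by positivity)
      have : 2 * E * t ≤ γ / 2 * t ^ 2 + 2 * E ^ 2 / γ := by
        have e : γ / 2 * t ^ 2 + 2 * E ^ 2 / γ - 2 * E * t = (γ * t - 2 * E) ^ 2 / (2 * γ) := by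
          field_simp
          ring
        have : 0 ≤ (γ * t - 2 * E) ^ 2 / (2 * γ) := by positivity
        linarith
      linarith

namespace SignedField

/-- Within δ ≤ 1 of a pole the logarithm is nonpositive, so replacing 2α by the larger s only
increases the bound. -/
theorem PoleLowerBound.ae_exp_le {α : ℂ → ℝ} {S : Set ℂ} {Ψ : ℂ → ℝ} {δ γ r s : ℝ}
    (h : PoleLowerBound α S Ψ δ γ) (hS : UniformlyDiscrete S r) (hr : 0 < r) (hδ1 : δ ≤ 1)
    (hα : ∀ l ∈ S, 2 * α l ≤ s) :
    ∃ E R : ℝ, ∀ᵐ z : ℂ, R ≤ ‖z‖ → Real.exp (-2 * Ψ z) ≤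
      Real.exp (-2 * (γ * ‖z‖ ^ 2 - E * ‖z‖)) * (1 + poleFactor S s δ z) := by
  obtain ⟨E, R, h⟩ := h
  refine ⟨E, R, ?_⟩
  filter_upwards [h] with z hz hR
  obtain ⟨h1, h2⟩ := hz hR
  have far : (∀ l ∈ S, δ ≤ dist z l) → Real.exp (-2 * Ψ z) ≤
      Real.exp (-2 * (γ * ‖z‖ ^ 2 - E * ‖z‖)) * (1 + poleFactor S s δ z) := fun hf => by
    refine le_trans ?_ (le_mul_of_one_le_right (Real.exp_pos _).le
      (le_add_of_nonneg_right (poleFactor_nonneg _ _ _ _)))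
    rw [Real.exp_le_exp]
    linarith [h2 hf]
  by_cases hd : ∃ l ∈ S, dist z l < δ
  · obtain ⟨l₀, hl₀, hd₀⟩ := hd
    obtain ⟨l, hl, he⟩ := (hS.isClosed hr).exists_infDist_eq_dist ⟨l₀, hl₀⟩ z
    have hd : infDist z S < δ := (infDist_le_dist_of_mem hl₀).trans_lt hd₀
    have h3 := h1 l hl (he ▸ hd)
    have hlog : Real.log (dist z l) ≤ 0 :=
      Real.log_nonpos dist_nonneg ((he ▸ hd.le).trans hδ1)
    have h4 : Real.exp (-2 * Ψ z) ≤
        Real.exp (-2 * (γ * ‖z‖ ^ 2 - E * ‖z‖)) * poleFactor S s δ z := by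
      rw [poleFactor, if_pos hd, he, ← Real.exp_add, Real.exp_le_exp]
      nlinarith [mul_nonneg (sub_nonneg.2 (hα l hl)) (neg_nonneg.2 hlog)]
    refine h4.trans ?_
    gcongr
    linarith
  · refine far fun l hl => le_of_not_gt fun h' => hd ⟨l, hl, h'⟩

/-- The lower bound holds only for large ‖z‖; on the remaining compact disc local integrability of
e^{-2Ψ} takes over. -/
theorem PoleLowerBound.integrable {μ : SignedField} {S : Set ℂ} {Ψ : ℂ → ℝ} {δ γ r θ : ℝ}
    (h : PoleLowerBound μ.intensity S Ψ δ γ) (hΨ : μ.IsPotential Ψ) (hS : UniformlyDiscrete S r)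
    (hγ : 0 < γ) (hδ : 0 < δ) (hδ1 : δ ≤ 1) (hδr : 4 * δ ≤ r) (hθ : θ < 1)
    (hμ : ∀ l ∈ μ.atoms, μ.intensity l ≤ θ) (n : ℕ) :
    Integrable fun z => ‖z‖ ^ (2 * n) * Real.exp (-2 * Ψ z) := by
  -- The maximum with 0 covers points of S that are not atoms of μ and have intensity 0.
  have hα : ∀ l ∈ S, 2 * μ.intensity l ≤ 2 * max θ 0 := fun l _ => by
    by_cases h0 : μ.intensity l = 0
    · simp [h0]
    · linarith [hμ l h0, le_max_left θ 0]
  have hs : 2 * max θ 0 < 2 := by linarith [max_lt hθ one_pos]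
  obtain ⟨E, R, hb⟩ := h.ae_exp_le hS (by linarith) hδ1 hα
  obtain ⟨K, hK⟩ := pow_mul_exp_le hγ E n
  have hloc : LocallyIntegrable fun z => ‖z‖ ^ (2 * n) * Real.exp (-2 * Ψ z) := by
    have := (hΨ.locallyIntegrable_exp (pos_real_singleton_lt hθ hμ))
    exact this.continuous_mul (g := fun z : ℂ => ‖z‖ ^ (2 * n)) (by fun_prop)
  have hg : Integrable fun z =>
      K * (Real.exp (-γ * ‖z‖ ^ 2) * (1 + poleFactor S (2 * max θ 0) δ z)) := by
    refine Integrable.const_mul ?_ K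
    simp only [mul_add, mul_one]
    exact (integrable_exp_neg_mul_norm_sq hγ).add
      (integrable_gaussian_mul_poleFactor hS hs hγ hδ hδ1 hδr)
  have hU : closedBall (0 : ℂ) R ∪ {z | R ≤ ‖z‖} = univ := by
    ext z
    simpa using le_total _ _
  rw [← integrableOn_univ, ← hU]
  refine (hloc.integrableOn_isCompact (isCompact_closedBall _ _)).union ?_
  refine hg.integrableOn.mono' hloc.aestronglyMeasurable.restrict ?_
  rw [ae_restrict_iff' (measurableSet_le measurable_const measurable_norm)]
  filter_upwards [hb] with z hz hR
  rw [Real.norm_of_nonneg (by positivity), ← mul_assoc]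
  calc _ ≤ ‖z‖ ^ (2 * n) * (Real.exp (-2 * (γ * ‖z‖ ^ 2 - E * ‖z‖)) *
        (1 + poleFactor S (2 * max θ 0) δ z)) := by gcongr; exact hz hR
    _ ≤ _ := by
      rw [← mul_assoc]
      exact mul_le_mul_of_nonneg_right (hK _)
        (by linarith [poleFactor_nonneg S (2 * max θ 0) δ z])

end SignedField
end PauliZeroModes
-- Zero modes from antiholomorphic functions
namespace PauliZeroModes
open Metric Set Filter Topology

/-- By the Cauchy–Riemann equations ∂ annihilates the conjugate of a holomorphic function;
integration by parts moves ∂ from the test function. -/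
theorem hasWeakDel_conj_of_differentiable {H : ℂ → ℂ} (hH : Differentiable ℂ H) (Ω : Set ℂ) :
    HasWeakDel Ω (fun z => (starRingEnd ℂ) (H z)) fun _ => 0 := by
  have hG : ContDiff ℝ 1 fun z => (starRingEnd ℂ) (H z) :=
    Complex.conjCLE.contDiff.comp (hH.contDiff.restrict_scalars ℝ)
  have hd : ∀ z v, fderiv ℝ (fun z => (starRingEnd ℂ) (H z)) z v =
      (starRingEnd ℂ) (deriv H z * v) := fun z v => by
    have h1 : HasFDerivAt (fun z => (starRingEnd ℂ) (H z)) _ z :=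
      (Complex.conjCLE : ℂ ≃L[ℝ] ℂ).hasFDerivAt.comp z
        (((hH z).hasDerivAt.hasFDerivAt).restrictScalars ℝ)
    rw [h1.fderiv]
    simp [mul_comm]
  refine ⟨hG.continuous.locallyIntegrable.locallyIntegrableOn _, locallyIntegrableOn_zero,
    fun φ hφ hc _ => ?_⟩
  have hφ1 : ContDiff ℝ 1 φ := hφ.of_le (by simp)
  have hi : ∀ v, Integrable fun z => (starRingEnd ℂ) (H z) * fderiv ℝ φ z v := fun v =>
    (hG.continuous.mul ((hφ1.continuous_fderiv one_ne_zero).clm_apply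
      continuous_const)).integrable_of_hasCompactSupport (hc.fderiv_apply (𝕜 := ℝ) v).mul_left
  have hi' : ∀ v, Integrable fun z => fderiv ℝ (fun z => (starRingEnd ℂ) (H z)) z v * φ z :=
    fun v => (((hG.continuous_fderiv one_ne_zero).clm_apply
      continuous_const).mul hφ.continuous).integrable_of_hasCompactSupport hc.mul_left
  have hp : ∀ v, ∫ z, (starRingEnd ℂ) (H z) * fderiv ℝ φ z v =
      -∫ z, fderiv ℝ (fun z => (starRingEnd ℂ) (H z)) z v * φ z := fun v =>
    integral_mul_fderiv_eq_neg_fderiv_mul_of_integrable (hi' v) (hi v)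
      ((hG.continuous.mul hφ.continuous).integrable_of_hasCompactSupport hc.mul_left)
      (fun z _ => (hG.differentiable one_ne_zero) z) (fun z _ => (hφ1.differentiable one_ne_zero) z)
  have e : ∀ z, (starRingEnd ℂ) (H z) * del φ z = 2⁻¹ * ((starRingEnd ℂ) (H z) * fderiv ℝ φ z 1 -
      Complex.I * ((starRingEnd ℂ) (H z) * fderiv ℝ φ z Complex.I)) := fun z => by
    rw [del]; ring
  simp only [e]
  rw [integral_const_mul, integral_sub (hi 1) ((hi Complex.I).const_mul _), integral_const_mul,
    hp, hp, mul_neg, sub_neg_eq_add, ← integral_const_mul, neg_add_eq_sub,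
    ← integral_sub ((hi' Complex.I).const_mul _) (hi' 1)]
  have e' : ∀ z, Complex.I * (fderiv ℝ (fun z => (starRingEnd ℂ) (H z)) z Complex.I * φ z) -
      fderiv ℝ (fun z => (starRingEnd ℂ) (H z)) z 1 * φ z = 0 := fun z => by
    rw [hd, hd]
    simp only [map_mul, Complex.conj_I, map_one]
    linear_combination (-(starRingEnd ℂ) (deriv H z) * φ z) * Complex.I_mul_I
  simp [e']

theorem differentiable_conj_eval_conj (p : Polynomial ℂ) :
    Differentiable ℂ fun z => (starRingEnd ℂ) (p.eval ((starRingEnd ℂ) z)) := by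
  have : (fun z => (starRingEnd ℂ) (p.eval ((starRingEnd ℂ) z))) =
      fun z => (p.map (starRingEnd ℂ)).eval z := by
    funext z
    rw [Polynomial.eval_map, Polynomial.eval, Polynomial.hom_eval₂]
    simp
  rw [this]
  exact Polynomial.differentiable _

/-- The function `e^{-Ψ} p(z̄) conj (e^F)`. -/
noncomputable def zeroModeFun (Ψ : ℂ → ℝ) (F : ℂ → ℂ) (p : Polynomial ℂ) (z : ℂ) : ℂ :=
  (Real.exp (-Ψ z) : ℂ) *
    (p.eval ((starRingEnd ℂ) z) * (starRingEnd ℂ) (Complex.exp (F z)))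

/-- The factor conj(e^F) has modulus e^{Ψ-Ψ'}, so it trades Ψ for the potential Ψ' with good bounds.
Monomials then suffice by linearity. -/
theorem memLp_zeroModeFun {Ψ Ψ' : ℂ → ℝ} {F : ℂ → ℂ} (hΨ : AEStronglyMeasurable Ψ)
    (hF : Differentiable ℂ F) (he : ∀ᵐ z, Ψ z - Ψ' z = (F z).re)
    (hI : ∀ n : ℕ, Integrable fun z => ‖z‖ ^ (2 * n) * Real.exp (-2 * Ψ' z)) (p : Polynomial ℂ) :
    MemLp (zeroModeFun Ψ F p) 2 := by
  have hFc := hF.continuous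
  have hm : ∀ n : ℕ, MemLp (zeroModeFun Ψ F (Polynomial.X ^ n)) 2 := fun n => by
    have h1 : AEStronglyMeasurable (zeroModeFun Ψ F (Polynomial.X ^ n)) :=
      ((Complex.continuous_ofReal.comp (Real.continuous_exp.comp
        continuous_neg)).comp_aestronglyMeasurable hΨ).mul
        (Continuous.aestronglyMeasurable (by fun_prop))
    rw [memLp_two_iff_integrable_sq_norm h1]
    refine (hI n).congr ?_
    filter_upwards [he] with z hz
    simp only [zeroModeFun, norm_mul, Complex.norm_real, Real.norm_eq_abs, Real.abs_exp,
      RCLike.norm_conj, Complex.norm_exp, Polynomial.eval_pow, Polynomial.eval_X, norm_pow,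
      ← hz, mul_pow, ← pow_mul, ← Real.exp_nat_mul]
    rw [mul_left_comm, ← Real.exp_add, mul_comm n 2]
    congr 2
    push_cast
    ring
  have hs : zeroModeFun Ψ F p = fun z => ∑ i ∈ Finset.range (p.natDegree + 1),
      p.coeff i * zeroModeFun Ψ F (Polynomial.X ^ i) z := by
    funext z
    simp only [zeroModeFun, Polynomial.eval_pow, Polynomial.eval_X]
    rw [Polynomial.eval_eq_sum_range, Finset.sum_mul, Finset.mul_sum]
    exact Finset.sum_congr rfl fun i _ => by ring
  rw [hs]
  exact memLp_finsetSum _ fun i _ => (hm i).const_mul _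

/-- Multiplying by e^Ψ leaves the conjugate of an entire function, so the weak derivative is h = 0
on any Ω, with or without the atoms; both operators are covered at once. -/
theorem isPauliValue_zeroModeFun {Ψ : ℂ → ℝ} {F : ℂ → ℂ} (hF : Differentiable ℂ F)
    {p : Polynomial ℂ} (hp : MemLp (zeroModeFun Ψ F p) 2) (Ω : Set ℂ) :
    IsPauliValue Ω Ψ (hp.toLp _) 0 := by
  refine ⟨fun _ => 0, ⟨?_, by simp⟩, fun φ k _ => by simp⟩
  refine (hasWeakDel_conj_of_differentiable
    ((differentiable_conj_eval_conj p).mul hF.cexp) Ω).congr ?_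
  filter_upwards [hp.coeFn_toLp] with z hz
  rw [hz, zeroModeFun, ← mul_assoc, ← Complex.ofReal_mul, ← Real.exp_add, add_neg_cancel]
  simp

/-- The map p ↦ zero mode is linear and injective on the infinite-dimensional space of polynomials:
the exponential factors never vanish, and a continuous function vanishing almost everywhere is zero.
-/
theorem not_finiteDimensional_zeroModes {Ψ Ψ' : ℂ → ℝ} {F : ℂ → ℂ} (hΨ : AEStronglyMeasurable Ψ)
    (hF : Differentiable ℂ F) (he : ∀ᵐ z, Ψ z - Ψ' z = (F z).re)
    (hI : ∀ n : ℕ, Integrable fun z => ‖z‖ ^ (2 * n) * Real.exp (-2 * Ψ' z)) (Ω : Set ℂ) :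
    ¬ FiniteDimensional ℂ (zeroModes Ω Ψ) := by
  intro hfin
  have hp := memLp_zeroModeFun hΨ hF he hI
  let T : Polynomial ℂ →ₗ[ℂ] zeroModes Ω Ψ :=
    { toFun := fun p => ⟨(hp p).toLp _, isPauliValue_zeroModeFun hF (hp p) Ω⟩
      map_add' := fun p q => by
        refine Subtype.ext ?_
        change (hp (p + q)).toLp _ = (hp p).toLp _ + (hp q).toLp _
        rw [← MemLp.toLp_add]
        congr 1
        funext z
        simp only [zeroModeFun, Polynomial.eval_add, Pi.add_apply]
        ring
      map_smul' := fun c p => by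
        refine Subtype.ext ?_
        change (hp (c • p)).toLp _ = c • (hp p).toLp _
        rw [← MemLp.toLp_const_smul]
        congr 1
        funext z
        simp only [zeroModeFun, Polynomial.eval_smul, Pi.smul_apply, smul_eq_mul]
        ring }
  have hT : Function.Injective T := by
    rw [injective_iff_map_eq_zero]
    intro p h0
    have h1 : (hp p).toLp _ = (0 : L2) := congrArg Subtype.val h0
    have h2 : zeroModeFun Ψ F p =ᵐ[volume] 0 := 
      (hp p).coeFn_toLp.symm.trans (Lp.eq_zero_iff_ae_eq_zero.1 h1)
    have h3 : (fun z : ℂ => p.eval ((starRingEnd ℂ) z)) =ᵐ[volume] fun _ => 0 := by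
      filter_upwards [h2] with z hz
      simpa [zeroModeFun] using hz
    have h4 := (Continuous.ae_eq_iff_eq volume (by fun_prop) (by fun_prop)).1 h3
    refine Polynomial.funext fun z => ?_
    simpa using congrFun h4 ((starRingEnd ℂ) z)
  exact Polynomial.not_finite (Module.Finite.of_injective T hT)

end PauliZeroModes
-- Conclusion
namespace PauliZeroModes
open Metric Set Filter Topology

namespace SignedField

theorem PoleLowerBound.not_finiteDimensional_zeroModes {μ : SignedField} {S : Set ℂ}
    {Ψ Ψ' : ℂ → ℝ} {δ γ r θ : ℝ} (h : PoleLowerBound μ.intensity S Ψ' δ γ)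
    (hΨ' : μ.IsPotential Ψ') (hS : UniformlyDiscrete S r) (hγ : 0 < γ) (hδ : 0 < δ) (hδ1 : δ ≤ 1)
    (hδr : 4 * δ ≤ r) (hθ : θ < 1) (hμ : ∀ l ∈ μ.atoms, μ.intensity l ≤ θ)
    (hΨ : μ.IsPotential Ψ) (Ω : Set ℂ) : ¬ FiniteDimensional ℂ (zeroModes Ω Ψ) := by
  obtain ⟨F, hF, he⟩ := exists_entire_of_weakly_harmonic (hΨ.1.sub hΨ'.1) fun φ hφ hc => by
    simp only [Pi.sub_apply, sub_mul]
    rw [integral_sub (integrable_mul_laplacian hΨ.1 hφ hc) (integrable_mul_laplacian hΨ'.1 hφ hc),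
      hΨ.2 φ hφ hc, hΨ'.2 φ hφ hc, sub_self]
  exact PauliZeroModes.not_finiteDimensional_zeroModes hΨ.1.aestronglyMeasurable hF he
    (h.integrable hΨ' hS hγ hδ hδ1 hδr hθ hμ) Ω

theorem exists_small_of_pos {C γ : ℝ} (hγ : 0 < γ) :
    ∃ ε : ℝ, 0 < ε ∧ ε ≤ 1 / 2 ∧ C * (ε * Real.log (1 / ε)) < γ := by
  have h : Tendsto (fun x : ℝ => C * (x * Real.log (1 / x))) (𝓝[>] 0) (𝓝 0) := by
    have h1 : Tendsto (fun x : ℝ => C * -(x * Real.log x)) (𝓝 0) (𝓝 0) := by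
      simpa using (Real.continuous_mul_log.neg.const_mul C).tendsto 0
    refine (h1.mono_left nhdsWithin_le_nhds).congr fun x => ?_
    rw [one_div, Real.log_inv, mul_neg x]
  obtain ⟨ε, h1, h2, h3⟩ := ((h.eventually_lt_const hγ).and
    ((Ioc_mem_nhdsGT (show (0 : ℝ) < 1 / 2 by norm_num)))).exists
  exact ⟨ε, h2, h3, h1⟩

end SignedField
end PauliZeroModes

open PauliZeroModes in
theorem mainTheorem12 (r B : ℝ) (hr : 0 < r) :
    ∃ C : ℝ, 0 < C ∧
      ∀ (μ₀ μ : SignedField) (Ψ₀ : ℂ → ℝ) (γ : ℝ),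
        -- the unperturbed field
        (∃ r₀ : ℝ, 0 < r₀ ∧ UniformlyDiscrete μ₀.atoms r₀) →
        (μ₀.MaxNormalized ∨ μ₀.EVNormalized) →
        0 < γ → μ₀.IsPotential Ψ₀ → μ₀.QuadraticLowerBound Ψ₀ γ →
        -- the perturbation
        μ.IsPerturbation r B →
        (μ.IsSparse ∨
          ∃ ε : ℝ, 0 < ε ∧ ε ≤ 1 / 2 ∧ μ.IsSmall ε ∧ C * (ε * Real.log (1 / ε)) < γ) →
        (∃ r' : ℝ, 0 < r' ∧ UniformlyDiscrete (μ₀.atoms ∪ μ.atoms) r') →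
        -- the potential of the perturbed field
        (∃ (Ψ' : ℂ → ℝ) (γ' : ℝ), 0 < γ' ∧
          (μ₀ + μ).IsPotential Ψ' ∧ (μ₀ + μ).QuadraticLowerBound Ψ' γ') ∧
        -- zero modes of the maximal operator
        (μ₀.MaxNormalized →
          (∃ θ : ℝ, θ < 1 ∧ ∀ l ∈ (μ₀ + μ).atoms, (μ₀ + μ).intensity l ≤ θ) →
          ∀ Ψ : ℂ → ℝ, (μ₀ + μ).IsPotential Ψ →
            ¬ FiniteDimensional ℂ (zeroModesMax (μ₀ + μ) Ψ)) ∧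
        -- zero modes of the EV operator
        (μ₀.EVNormalized → (μ₀ + μ).EVNormalized →
          ∀ Ψ : ℂ → ℝ, (μ₀ + μ).IsPotential Ψ →
            ¬ FiniteDimensional ℂ (zeroModesEV Ψ)) := by
  obtain ⟨A, hA, hA'⟩ := SignedField.exists_variation_ball_le r B hr
  refine ⟨601 + 32 * A, by positivity, ?_⟩
  rintro μ₀ μ Ψ₀ γ - hnorm hγ hΨ₀ hlow hμ hcase ⟨r', hr', hS⟩
  obtain ⟨ε, hε, hε', hsmall, hCε⟩ : ∃ ε : ℝ, 0 < ε ∧ ε ≤ 1 / 2 ∧ μ.IsSmall ε ∧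
      (601 + 32 * A) * (ε * Real.log (1 / ε)) < γ := by
    rcases hcase with h | h
    · obtain ⟨ε, h1, h2, h3⟩ := SignedField.exists_small_of_pos (C := 601 + 32 * A) hγ
      exact ⟨ε, h1, h2, h.isSmall h1, h3⟩
    · exact h
  obtain ⟨Φ, hΦ, hpole⟩ := hμ.exists_poleLowerBound hr hA.le (hA' μ hμ) hε hε' hsmall
  set S := μ₀.atoms ∪ μ.atoms
  -- 4δ ≤ r' isolates the poles of S for the pole-factor integral, 2δ ≤ r isolates the atoms of μ,
  -- and δ ≤ 1/2 is required in the kernel estimate.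
  obtain ⟨δ, hδ, hδr', hδr, hδ1⟩ : ∃ δ : ℝ, 0 < δ ∧ 4 * δ ≤ r' ∧ 2 * δ ≤ r ∧ δ ≤ 1 / 2 := by
    refine ⟨min (r' / 4) (min (r / 2) (1 / 2)), by positivity, ?_, ?_, ?_⟩
    · linarith [min_le_left (r' / 4) (min (r / 2) (1 / 2))]
    · linarith [(min_le_right (r' / 4) _).trans (min_le_left (r / 2) (1 / 2))]
    · exact (min_le_right _ _).trans (min_le_right _ _)
  have hint : (μ₀ + μ).intensity = fun z => μ₀.intensity z + μ.intensity z :=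
    funext fun z => SignedField.intensity_add μ₀ μ z
  have hbound : SignedField.PoleLowerBound (μ₀ + μ).intensity S (fun z => Ψ₀ z + Φ z) δ
      (γ + -((601 + 32 * A) * (ε * Real.log (1 / ε)))) := by
    rw [hint]
    exact (hlow.poleLowerBound hS hr' Set.subset_union_left hδ (by linarith)
      (SignedField.abs_intensity_le_one hnorm)).add
      (hpole S r' δ hS Set.subset_union_right hδ (by linarith) hδr hδ1)
  have hpot := hΨ₀.add hΦ
  obtain ⟨θ, hθ, hμθ⟩ := hμ.intensity_le
  have hK := SignedField.abs_intensity_add_le zero_le_one zero_le_one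
    (SignedField.abs_intensity_le_one hnorm) fun l hl => (hμθ l hl).trans hθ.le
  -- Half of the available constant leaves room to absorb the terms linear in ‖z‖.
  refine ⟨⟨_, (γ + -((601 + 32 * A) * (ε * Real.log (1 / ε)))) / 2, by linarith, hpot,
    hbound.quadraticLowerBound hS (SignedField.atoms_add_subset μ₀ μ) hδ (by linarith)
      (fun l _ => hK l) (by linarith)⟩, ?_, ?_⟩
  · rintro - ⟨θ', hθ', hle⟩ Ψ hΨ
    exact hbound.not_finiteDimensional_zeroModes hpot hS (by linarith) hδ (by linarith) hδr' hθ'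
      hle hΨ _
  · intro _ hEV Ψ hΨ
    exact hbound.not_finiteDimensional_zeroModes hpot hS (by linarith) hδ (by linarith) hδr'
      one_half_lt_one (fun l hl => (hEV l hl).2.le) hΨ _
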